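/- Let $F$ be a totally real number field of degree $g$ with ring of integers $\mathcal O_F$, let $I$ be the set of embeddings $F\hookrightarrow\mathbb R$, and fix a numbering $I=\{\tau_1,\dots,\tau_g\}$. Let $\mathcal O_{F+}$ be the set of totally positive integers, $\Delta=\mathcal O_{F+}^\times$ the group of totally positive units, and $A\subset\mathcal O_{F+}$ the set of primitive elements, i.e. those $\alpha$ with $\alpha/N\notin\mathcal O_{F+}$ for every integer $N>1$. Let $\xi\colon\mathcal O_F\to\mathbb C^\times$ be a nontrivial additive character of finite order (a nontrivial torsion point of $\mathbb T=\mathrm{Hom}_{\mathbb Z}(\mathcal O_F,\mathbb G_m)$), $\mathbb Q(\xi)$ the field generated by its values, $\Delta_\xi=\{\varepsilon\in\Delta\mid \xi(\varepsilon\alpha)=\xi(\alpha)\ \forall\alpha\in\mathcal O_F\}$, and $A_\xi=\{\alpha\in A\mid\xi(\alpha)\ne1\}$. Regard $\xi=\operatorname{Spec}\mathbb Q(\xi)$ as a scheme with trivial $\Delta_\xi$-action, and let $H^m(\xi/\Delta_\xi,-)$ be the right derived functors of $\mathcal F\mapsto\Gamma(\xi,\mathcal F)^{\Delta_\xi}$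 on $\Delta_\xi$-equivariant $\mathcal O_\xi$-modules. For $q\ge0$ let $C^q=\bigl(\prod^{\mathrm{alt}}_{A_\xi^{q+1}}\mathbb Q(\xi)\bigr)^{\Delta_\xi}$ be the space of functions $\eta\colon A_\xi^{q+1}\to\mathbb Q(\xi)$ that are alternating ($\eta_{\rho(\boldsymbol\alpha)}=\operatorname{sgn}(\rho)\eta_{\boldsymbol\alpha}$ for permutations $\rho$, and $\eta_{\boldsymbol\alpha}=0$ if $\boldsymbol\alpha$ has a repeated entry) and satisfy $\eta_{\varepsilon\boldsymbol\alpha}=\eta_{\boldsymbol\alpha}$ for $\varepsilon\in\Delta_\xi$, with the differential $(d\eta)_{\alpha_0\cdots\alpha_{q+1}}=\sum_j(-1)^j\eta_{\alpha_0\cdots\check\alpha_j\cdots\alpha_{q+1}}$. The corresponding alternating Čech resolution of $\mathcal O_\xi$ by equivariant sheaves induces a canonical isomorphism $H^{g-1}(C^\bullet)\cong H^{g-1}(\xi/\Delta_\xi,\mathcal O_\xi)$, through which cocycles in $C^{g-1}$ represent classes. For $\alpha_1,\dots,\alpha_m\in\mathcal O_{F+}$ let $\sigma_{\boldsymbol\alpha}\subset\mathbb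 R^I$ be the closed cone generated by the images of the $\alpha_i$. A cone is simplicial if it has an $\mathbb R$-linearly independent generating tuple in $\mathcal O_{F+}$; its faces are the cones generated by the subsets of such a tuple. Let $\Gamma$ be a group with $\Delta_\xi\subseteq\Gamma\subseteq\Delta$, and let $\Phi$ be a Shintani decomposition for $\Gamma$: a set of simplicial cones, closed under taking faces, any two of which intersect in a common face, such that $\mathbb R_{+}^I\cup\{0\}$ is the disjoint union of the relative interiors of the $\sigma\in\Phi$, such that $\varepsilon\sigma\in\Phi$ for $\sigma\in\Phi$, $\varepsilon\in\Gamma$, and such that $\Gamma\backslash\Phi$ is finite. Assume that every $\sigma\in\Phi$ of dimension $d$ is of the form $\sigma_{\boldsymbol\alpha}$ with $\boldsymbol\alpha\in A_\xi^d$. Let $\Phi_g$ be the set of $g$-dimensional cones of $\Phi$, and for a cocycle $\eta\in C^{g-1}$ and $\sigma=\sigma_{\boldsymbol\alpha}\in\Phi_g$ with $\boldsymbol\alpha\in A_\xi^g$ put $\eta_\sigma=\operatorname{sgn}(\boldsymbol\alpha)\,\eta_{\boldsymbol\alpha}$, where $\operatorname{sgn}(\boldsymbol\alpha)$ is the sign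 of $\det(\tau_i(\alpha_j))_{i,j}$. Then $\Delta_\xi\backslash\Phi_g$ is finite, $\sum_{\bar\sigma\in\Delta_\xi\backslash\Phi_g}\eta_\sigma$ does not depend on the choice of representatives $\sigma$ and of generators $\boldsymbol\alpha$, and there is a unique $\mathbb Q(\xi)$-linear map $$H^{g-1}(\xi/\Delta_\xi,\mathcal O_\xi)\longrightarrow\mathbb Q(\xi)$$ sending the class of every cocycle $\eta$ to $\sum_{\bar\sigma\in\Delta_\xi\backslash\Phi_g}\eta_\sigma$. This map is an isomorphism, and it is canonical: it is the same for all $\Gamma$ and $\Phi$ as above. -/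

import Mathlib

open CategoryTheory AlgebraicGeometry

namespace ShintaniEcc
noncomputable section

section AlternatingCochains

variable (K : Type) [Field K] (G : Type) [Group G] (S : Type) [MulAction G S]

/-- Alternating functions on `S^(q+1)` with values in `K`: the sign rule under permutations, and
vanishing on tuples with a repeated entry. -/
def altCochains (q : ℕ) : Submodule K ((Fin (q + 1) → S) → K) where
  carrier := {f | (∀ (ρ : Equiv.Perm (Fin (q + 1))) (a : Fin (q + 1) → S),
      f (a ∘ ρ) = ((Equiv.Perm.sign ρ : ℤ) : K) * f a) ∧
    ∀ a : Fin (q + 1) → S, ¬ Function.Injective a → f a = 0}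
  zero_mem' := by simp
  add_mem' {f h} hf hh :=
    ⟨fun ρ a => by simp [hf.1 ρ a, hh.1 ρ a, mul_add],
      fun a ha => by simp [hf.2 a ha, hh.2 a ha]⟩
  smul_mem' c f hf :=
    ⟨fun ρ a => by simp [hf.1 ρ a, mul_left_comm], fun a ha => by simp [hf.2 a ha]⟩

variable {K S} in
def altDiff {q : ℕ} (f : (Fin (q + 1) → S) → K) (a : Fin (q + 2) → S) : K :=
  ∑ j : Fin (q + 2), (-1) ^ (j : ℕ) * f (a ∘ j.succAbove)

lemma exists_perm_succAbove {n : ℕ} (ρ : Equiv.Perm (Fin (n + 1))) (j : Fin (n + 1)) :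
    ∃ ρ' : Equiv.Perm (Fin n), (∀ k, ρ (j.succAbove k) = (ρ j).succAbove (ρ' k)) ∧
      (Equiv.Perm.sign ρ' : ℤ) * (-1) ^ (j : ℕ) = (Equiv.Perm.sign ρ : ℤ) * (-1) ^ (ρ j : ℕ) := by
  set π : Equiv.Perm (Fin (n + 1)) := (ρ j).cycleRange * ρ * j.cycleRange⁻¹ with hπ
  have hρ : ρ = (ρ j).cycleRange⁻¹ * π * j.cycleRange := by simp [hπ, mul_assoc]
  have h0 : π 0 = 0 := by simp [hπ, Equiv.Perm.inv_def]
  obtain ⟨⟨p, ρ'⟩, h⟩ : ∃ x, Equiv.Perm.decomposeFin.symm x = π :=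
    Equiv.Perm.decomposeFin.symm.surjective π
  have hp : p = 0 := by
    have := congrArg (fun e : Equiv.Perm (Fin (n + 1)) => e 0) h
    simpa [h0] using this
  subst hp
  have hsucc : ∀ k : Fin n, π k.succ = (ρ' k).succ := fun k => by
    rw [← h]; simp
  refine ⟨ρ', fun k => ?_, ?_⟩
  · have : ρ (j.succAbove k) = (ρ j).cycleRange.symm (π (j.cycleRange (j.succAbove k))) := by
      simp [hπ, Equiv.Perm.inv_def]
    rw [this, Fin.cycleRange_succAbove, hsucc, Fin.cycleRange_symm_succ]
  · have hs : Equiv.Perm.sign π = Equiv.Perm.sign ρ' := by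
      rw [← h]; simp
    have : Equiv.Perm.sign ρ' = (-1) ^ (ρ j : ℕ) * Equiv.Perm.sign ρ * (-1) ^ (j : ℕ) := by
      rw [← hs, hπ]; simp [Fin.sign_cycleRange]
    rw [this]
    push_cast
    have h1 : ((-1 : ℤ) ^ (j : ℕ)) * (-1) ^ (j : ℕ) = 1 := by
      rw [← mul_pow]; simp
    linear_combination ((-1 : ℤ) ^ (ρ j : ℕ) * (Equiv.Perm.sign ρ : ℤ)) * h1

lemma altDiff_altDiff {q : ℕ} (f : (Fin (q + 1) → S) → K) : altDiff (altDiff f) = 0 := by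
  funext a
  simp only [altDiff, Finset.mul_sum, Pi.zero_apply]
  rw [← Finset.sum_product']
  refine Finset.sum_involution (fun p _ => (p.1.succAbove p.2, p.2.predAbove p.1))
    ?_ ?_ (fun _ _ => Finset.mem_univ _) ?_
  · rintro ⟨i, j⟩ -
    have e : (a ∘ (i.succAbove j).succAbove) ∘ (j.predAbove i).succAbove =
        (a ∘ i.succAbove) ∘ j.succAbove := by
      funext k
      simp [Fin.succAbove_succAbove_succAbove_predAbove]
    have h := Fin.neg_one_pow_succAbove_add_predAbove (R := K) i j
    simp only [e]
    rw [← mul_assoc, ← mul_assoc, ← pow_add, ← pow_add, h]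
    ring
  · rintro ⟨i, j⟩ - - h
    exact Fin.succAbove_ne i j (congrArg Prod.fst h)
  · rintro ⟨i, j⟩ -
    simp [Fin.succAbove_succAbove_predAbove, Fin.predAbove_predAbove_succAbove]

variable {S} in
/-- `(u f)(a) = f (u⁻¹ a)`. -/
def cochainAction (q : ℕ) : Representation K G (altCochains K S q) where
  toFun u :=
    { toFun := fun f => ⟨fun a => f.1 (u⁻¹ • a),
        fun ρ a => f.2.1 ρ (u⁻¹ • a),
        fun a ha => f.2.2 _ fun h => ha fun i j hij => h (by simp [hij])⟩
      map_add' := fun _ _ => rfl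
      map_smul' := fun _ _ => rfl }
  map_one' := by ext f a; simp
  map_mul' u v := by ext f a; simp [mul_smul]

/-- The module of global sections of the sheaf of alternating Čech `q`-cochains, with its `G`-action. -/
def cechObj (q : ℕ) : Action (ModuleCat K) G where
  V := ModuleCat.of K (altCochains K S q)
  ρ := (ModuleCat.endRingEquiv _).symm.toMonoidHom.comp (cochainAction K G q)

variable [CharZero K]

lemma altDiff_mem {q : ℕ} {f : (Fin (q + 1) → S) → K} (hf : f ∈ altCochains K S q) :
    altDiff f ∈ altCochains K S (q + 1) := by
  have key : ∀ (ρ : Equiv.Perm (Fin (q + 2))) (a : Fin (q + 2) → S),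
      altDiff f (a ∘ ρ) = ((Equiv.Perm.sign ρ : ℤ) : K) * altDiff f a := by
    intro ρ a
    rw [altDiff, altDiff, Finset.mul_sum, ← Equiv.sum_comp ρ (fun j : Fin (q + 2) =>
      ((Equiv.Perm.sign ρ : ℤ) : K) * ((-1) ^ (j : ℕ) * f (a ∘ j.succAbove)))]
    refine Finset.sum_congr rfl fun j _ => ?_
    obtain ⟨ρ', h1, h2⟩ := exists_perm_succAbove ρ j
    have e : (a ∘ ρ) ∘ j.succAbove = (a ∘ (ρ j).succAbove) ∘ ρ' := by
      funext k; simp [h1]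
    rw [e, hf.1]
    have h3 : ((Equiv.Perm.sign ρ' : ℤ) : K) * (-1) ^ (j : ℕ) =
        ((Equiv.Perm.sign ρ : ℤ) : K) * (-1) ^ (ρ j : ℕ) := by exact_mod_cast congrArg (Int.cast (R := K)) h2
    linear_combination (f (a ∘ (ρ j).succAbove)) * h3
  refine ⟨key, fun a ha => ?_⟩
  simp only [Function.Injective, not_forall] at ha
  obtain ⟨i, j, hij, hne⟩ := ha
  have h := key (Equiv.swap i j) a
  have e : a ∘ Equiv.swap i j = a := by
    funext k
    simp only [Function.comp, Equiv.swap_apply_def]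
    split_ifs with h1 h2 <;> simp_all
  rw [e, Equiv.Perm.sign_swap hne] at h
  have h2 : (2 : K) * altDiff f a = 0 := by push_cast at h; linear_combination h
  simpa using h2

def cechDiff (q : ℕ) : cechObj K G S q ⟶ cechObj K G S (q + 1) where
  hom := ModuleCat.ofHom
    { toFun := fun f => ⟨altDiff f.1, altDiff_mem K S f.2⟩
      map_add' := fun f h => by
        ext a
        simp [altDiff, mul_add, Finset.sum_add_distrib]
      map_smul' := fun c f => by
        ext a
        simp [altDiff, Finset.mul_sum, mul_left_comm] }
  comm u := rfl

def cechComplex : CochainComplex (Action (ModuleCat K) G) ℕ :=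
  CochainComplex.of (cechObj K G S) (cechDiff K G S) fun q => by
    apply Action.hom_ext
    ext f
    exact Subtype.ext (altDiff_altDiff K S f.1)

end AlternatingCochains

section EquivariantCohomology

variable (K : Type) [Field K] (G : Type) [Group G]

/-- `M ↦ M^G`. -/
def invariants : Action (ModuleCat K) G ⥤ ModuleCat K where
  obj M := ModuleCat.of K
    ({ carrier := {x : M.V | ∀ u : G, (M.ρ u).hom x = x}
       zero_mem' := fun u => map_zero _
       add_mem' := fun hx hy u => by rw [map_add, hx u, hy u]
       smul_mem' := fun c x hx u => by rw [map_smul, hx u] } : Submodule K M.V)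
  map {M N} f := ModuleCat.ofHom (f.hom.hom.restrict fun x hx u => by
    have h := congrArg (fun φ => φ.hom x) (f.comm u)
    simp only [ModuleCat.hom_comp, LinearMap.comp_apply] at h
    rw [← h, hx u])

instance : (invariants K G).Additive where

/-- `G`-equivariant `𝒪`-modules on `Spec K` for the trivial action of `G`. Every `[u]` is the identity,
so an equivariant structure is a homomorphism `u ↦ ι_u` from `G` to the automorphisms of the
`𝒪`-module. -/
abbrev EquivariantModules : Type 1 := Action (Spec (.of K)).Modules G

/-- The structure sheaf with its natural (trivial) equivariant structure. -/
abbrev structureSheaf : EquivariantModules K G where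
  V := SheafOfModules.unit (Spec (.of K)).ringCatSheaf
  ρ := 1

lemma additive_Γ (R : CommRingCat.{0}) : (moduleSpecΓFunctor (R := R)).Additive :=
  (tilde.adjunction (R := R)).right_adjoint_additive

instance : (moduleSpecΓFunctor (R := .of K)).Additive := additive_Γ _

/-- `Γ(Spec K / G, M) = Γ(Spec K, M)^G`. -/
def equivariantSections : EquivariantModules K G ⥤ ModuleCat K :=
  (moduleSpecΓFunctor (R := .of K)).mapAction G ⋙ invariants K G

instance : (equivariantSections K G).Additive := by
  unfold equivariantSections; infer_instance

lemma isIso_unit_tilde (R : CommRingCat.{0}) : IsIso (tilde.adjunction (R := R)).unit := inferInstance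

lemma isLocalizing_of_field (M : (Spec (.of K)).Modules) :
    IsLocalizing (modulesSpecToSheaf.obj M) := by
  intro f
  by_cases hf : f = 0
  · subst hf
    have hbot : PrimeSpectrum.basicOpen (0 : K) = ⊥ := PrimeSpectrum.basicOpen_zero
    have hsub : Subsingleton ((modulesSpecToSheaf.obj M).obj.obj
        (.op (PrimeSpectrum.basicOpen (0 : K)))) := by
      refine ⟨fun x y => TopCat.Presheaf.IsSheaf.section_ext (modulesSpecToSheaf.obj M).2 ?_⟩
      intro p hp
      have hp' : p ∈ PrimeSpectrum.basicOpen (0 : K) := hp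
      rw [hbot] at hp'
      exact hp'.elim
    refine ⟨fun x => ?_, fun y => ⟨(0, 1), hsub.elim _ _⟩,
      fun {x y} _ => ⟨⟨0, 1, by simp⟩, ?_⟩⟩
    · rw [Module.End.isUnit_iff]
      exact ⟨fun a b _ => hsub.elim a b, fun b => ⟨b, hsub.elim _ _⟩⟩
    · simp [Submonoid.smul_def]
  · have htop : PrimeSpectrum.basicOpen f = ⊤ := by
      ext p
      simpa using fun h => p.2.ne_top (Ideal.eq_top_of_isUnit_mem _ h (IsUnit.mk0 f hf))
    have hgen : ∀ U : (Spec (.of K)).Opens, U = ⊤ →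
        IsIso ((modulesSpecToSheaf.obj M).obj.map U.leTop.op) := by
      rintro _ rfl
      exact inferInstanceAs (IsIso ((modulesSpecToSheaf.obj M).obj.map (𝟙 _)))
    have hiso := hgen _ htop
    have hbij : Function.Bijective ((modulesSpecToSheaf.obj M).obj.map
        (TopologicalSpace.Opens.leTop (X := Spec (.of K)) (PrimeSpectrum.basicOpen f)).op).hom :=
      (ConcreteCategory.isIso_iff_bijective _).1 hiso
    have hu : ∀ x : Submonoid.powers f, IsUnit (x : K) := by
      rintro ⟨_, n, rfl⟩
      exact (IsUnit.mk0 f hf).pow n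
    refine ⟨fun x => (hu x).map _, fun y => ?_, fun {x y} h => ⟨1, ?_⟩⟩
    · obtain ⟨m, hm⟩ := hbij.2 y
      exact ⟨(m, 1), by simp [hm]⟩
    · rw [hbij.1 h]

instance : (moduleSpecΓFunctor (R := .of K)).IsEquivalence := by
  have : ∀ M : (Spec (.of K)).Modules, IsIso ((tilde.adjunction (R := .of K)).counit.app M) :=
    fun M => (isIso_fromTildeΓ_iff_isLocalizing M).2 (isLocalizing_of_field K M)
  have : IsIso (tilde.adjunction (R := .of K)).unit := isIso_unit_tilde _
  have : IsIso (tilde.adjunction (R := .of K)).counit := NatIso.isIso_of_isIso_app _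
  exact (tilde.adjunction (R := .of K)).toEquivalence.isEquivalence_inverse

instance : EnoughInjectives (EquivariantModules K G) := by
  have : ((moduleSpecΓFunctor (R := .of K)).mapAction G).IsEquivalence :=
    ((moduleSpecΓFunctor (R := .of K)).asEquivalence.mapAction G).isEquivalence_functor
  exact EnoughInjectives.of_equivalence ((moduleSpecΓFunctor (R := .of K)).mapAction G ⋙
    Rep.ActionToRep K G ⋙ Rep.equivalenceModuleMonoidAlgebra.functor)

/-- `H^m(Spec K / G, M)`: the `m`-th right derived functor of `M ↦ Γ(Spec K, M)^G` on equivariant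
`𝒪`-modules. -/
def equivariantCohomology (m : ℕ) (M : EquivariantModules K G) : ModuleCat K :=
  ((equivariantSections K G).rightDerived m).obj M


lemma additive_tilde (R : CommRingCat.{0}) : (tilde.functor R).Additive := inferInstance

instance : (tilde.functor (.of K)).Additive := additive_tilde _

/-- The equivariant sheaf on `Spec K` with a given module (with `G`-action) of global sections. -/
abbrev associatedSheaf : Action (ModuleCat K) G ⥤ EquivariantModules K G :=
  (tilde.functor (.of K)).mapAction G

/-- The canonical map `M^G → Γ(Spec K, M~)^G`. -/
def sectionsOfAssociated : invariants K G ⟶ associatedSheaf K G ⋙ equivariantSections K G where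
  app M := (invariants K G).map
    ({ hom := (tilde.toTildeΓNatIso (R := .of K)).hom.app M.V
       comm := fun u => (tilde.toTildeΓNatIso (R := .of K)).hom.naturality (M.ρ u) } :
      M ⟶ ((moduleSpecΓFunctor (R := .of K)).mapAction G).obj ((associatedSheaf K G).obj M))
  naturality M N f := by
    dsimp only [Functor.comp_map, equivariantSections]
    rw [← Functor.map_comp, ← Functor.map_comp]
    congr 1
    apply Action.hom_ext
    exact (tilde.toTildeΓNatIso (R := .of K)).hom.naturality f.hom

/-- `K` with trivial action. -/
def trivialModule : Action (ModuleCat K) G where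
  V := ModuleCat.of K K
  ρ := 1

/-- The canonical identification of `𝒪` with `K~`. -/
def structureSheafToAssociated :
    structureSheaf K G ⟶ (associatedSheaf K G).obj (trivialModule K G) where
  hom := (tildeSelf (R := .of K)).inv
  comm u := by
    have h : ((associatedSheaf K G).obj (trivialModule K G)).ρ u = 𝟙 _ :=
      (tilde.functor (.of K)).map_id _
    have h' : (tildeSelf (R := .of K)).inv ≫
        ((associatedSheaf K G).obj (trivialModule K G)).ρ u = (tildeSelf (R := .of K)).inv :=
      (congrArg (fun x => (tildeSelf (R := .of K)).inv ≫ x) h).trans (Category.comp_id _)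
    exact (Category.id_comp _).trans h'.symm

variable [CharZero K] (S : Type) [MulAction G S]

/-- The complex of equivariant sheaves of alternating Čech cochains. -/
def cechSheafComplex : CochainComplex (EquivariantModules K G) ℕ :=
  ((associatedSheaf K G).mapHomologicalComplex _).obj (cechComplex K G S)

/-- Constants as `0`-cochains. -/
def cechUnit : trivialModule K G ⟶ cechObj K G S 0 where
  hom := ModuleCat.ofHom
    { toFun := fun c => ⟨fun _ => c, fun ρ a => by
        have : Subsingleton (Equiv.Perm (Fin (0 + 1))) :=
          inferInstanceAs (Subsingleton (Equiv.Perm (Fin 1)))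
        simp [Subsingleton.elim ρ 1],
        fun a ha => (ha fun i j _ => Subsingleton.elim (α := Fin 1) i j).elim⟩
      map_add' := fun _ _ => rfl
      map_smul' := fun _ _ => rfl }
  comm u := rfl

/-- The inclusion `𝒪 → 𝒞^0`. -/
def cechAugmentation : structureSheaf K G ⟶ (cechSheafComplex K G S).X 0 :=
  structureSheafToAssociated K G ≫ (associatedSheaf K G).map (cechUnit K G S)

/-- The complex of `G`-invariant alternating Čech cochains. -/
def cechSections : CochainComplex (ModuleCat K) ℕ :=
  ((invariants K G).mapHomologicalComplex _).obj (cechComplex K G S)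

/-- The identification of invariant cochains with invariant global sections of the sheaves `𝒞^q`. -/
def cechSectionsMap : cechSections K G S ⟶
    ((equivariantSections K G).mapHomologicalComplex _).obj (cechSheafComplex K G S) where
  f _ := (sectionsOfAssociated K G).app _
  comm' _ _ _ := ((sectionsOfAssociated K G).naturality _).symm

/-- The map from Čech cohomology to derived functor cohomology induced by a map from the Čech
resolution to an injective resolution of `𝒪`. -/
def cechComparison {I : InjectiveResolution (structureSheaf K G)}
    (φ : cechSheafComplex K G S ⟶ I.cocomplex) (m : ℕ) :
    (cechSections K G S).homology m ⟶ equivariantCohomology K G m (structureSheaf K G) :=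
  HomologicalComplex.homologyMap (cechSectionsMap K G S ≫
      ((equivariantSections K G).mapHomologicalComplex _).map φ) m ≫
    (I.isoRightDerivedObj (equivariantSections K G) m).inv

/-- `f` is the comparison map induced by some map of complexes `𝒞^• → I^•` under `𝒪`, for an
injective resolution `I^•` of `𝒪` in equivariant sheaves. -/
def IsCechComparison (m : ℕ)
    (f : (cechSections K G S).homology m ⟶ equivariantCohomology K G m (structureSheaf K G)) :
    Prop :=
  ∃ (I : InjectiveResolution (structureSheaf K G))
    (φ : cechSheafComplex K G S ⟶ I.cocomplex),
    cechAugmentation K G S ≫ φ.f 0 = I.ι.f 0 ∧ f = cechComparison K G S φ m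

end EquivariantCohomology


section NumberField

open NumberField

variable (F : Type) [Field F]

/-- `ℝ^I`, with `I` the set of real embeddings. -/
abbrev RealSpace : Type := (F →+* ℝ) → ℝ

variable {F} in
def realEmbedding (x : F) : RealSpace F := fun τ => τ x

variable {F} in
def TotallyPositive (x : F) : Prop := ∀ τ : F →+* ℝ, 0 < τ x

/-- The group `Δ`. -/
def totallyPositiveUnits : Subgroup (𝓞 F)ˣ where
  carrier := {u | TotallyPositive (u : F)}
  one_mem' := fun τ => by simp
  mul_mem' {u v} hu hv := fun τ => by simpa using mul_pos (hu τ) (hv τ)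
  inv_mem' {u} hu := fun τ => by simpa using hu τ

variable {F} in
/-- `x` is totally positive and `x / N` is not a totally positive integer for any `N > 1`. -/
def IsPrimitiveElement (x : 𝓞 F) : Prop :=
  TotallyPositive (x : F) ∧
    ∀ N : ℕ, 1 < N → ∀ y : 𝓞 F, TotallyPositive (y : F) → (N : 𝓞 F) * y ≠ x

variable {F} (ξ : AddChar (𝓞 F) ℂ)

/-- The group `Δ_ξ` of totally positive units `u` with `ξ (u x) = ξ x` for all `x`. -/
def stabilizer : Subgroup (𝓞 F)ˣ where
  carrier := {u | u ∈ totallyPositiveUnits F ∧ ∀ x : 𝓞 F, ξ ((u : 𝓞 F) * x) = ξ x}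
  one_mem' := ⟨one_mem _, fun x => by simp⟩
  mul_mem' {u v} hu hv := ⟨mul_mem hu.1 hv.1, fun x => by
    rw [Units.val_mul, mul_assoc, hu.2, hv.2]⟩
  inv_mem' {u} hu := ⟨inv_mem hu.1, fun x => by
    rw [← hu.2, Units.mul_inv_cancel_left]⟩

/-- The field `ℚ(ξ)`. -/
def valueField : IntermediateField ℚ ℂ := IntermediateField.adjoin ℚ (Set.range ξ)

/-- The set `A_ξ` of primitive elements `x` with `ξ x ≠ 1`. -/
def PrimitiveSet : Type := {x : 𝓞 F // IsPrimitiveElement x ∧ ξ x ≠ 1}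

lemma IsPrimitiveElement.unit_mul {x : 𝓞 F} (hx : IsPrimitiveElement x) {u : (𝓞 F)ˣ}
    (hu : u ∈ totallyPositiveUnits F) : IsPrimitiveElement ((u : 𝓞 F) * x) := by
  refine ⟨fun τ => by simpa using mul_pos (hu τ) (hx.1 τ), fun N hN y hy h => ?_⟩
  refine hx.2 N hN (((u⁻¹ : (𝓞 F)ˣ) : 𝓞 F) * y)
    (fun τ => by simpa using mul_pos (inv_mem hu τ) (hy τ)) ?_
  rw [mul_left_comm, h, Units.inv_mul_cancel_left]

instance : MulAction (stabilizer ξ) (PrimitiveSet ξ) where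
  smul u x := ⟨((u : (𝓞 F)ˣ) : 𝓞 F) * x.1, x.2.1.unit_mul u.2.1, by
    rw [u.2.2]; exact x.2.2⟩
  one_smul x := Subtype.ext (one_mul x.1)
  mul_smul u v x := Subtype.ext (mul_assoc _ _ x.1)

/-- The closed cone generated by a finite family. -/
def generatedCone {ι : Type} [Fintype ι] (a : ι → 𝓞 F) : Set (RealSpace F) :=
  {v | ∃ x : ι → ℝ, (∀ i, 0 ≤ x i) ∧ v = ∑ i, x i • realEmbedding (a i : F)}

def IsSimplicialGenerator {m : ℕ} (a : Fin m → 𝓞 F) (σ : Set (RealSpace F)) : Prop :=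
  (∀ i, TotallyPositive (a i : F)) ∧
    LinearIndependent ℝ (fun i => realEmbedding (a i : F)) ∧ generatedCone a = σ

def IsFace (ρ σ : Set (RealSpace F)) : Prop :=
  ∃ (m : ℕ) (a : Fin m → 𝓞 F), IsSimplicialGenerator a σ ∧
    ∃ s : Finset (Fin m), ρ = generatedCone (fun i : s => a i)

structure IsSimplicialFan (Φ : Set (Set (RealSpace F))) : Prop where
  simplicial : ∀ σ ∈ Φ, ∃ (m : ℕ) (a : Fin m → 𝓞 F), IsSimplicialGenerator a σ
  face_mem : ∀ σ ∈ Φ, ∀ ρ, IsFace ρ σ → ρ ∈ Φ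
  inter_isFace : ∀ σ ∈ Φ, ∀ σ' ∈ Φ, IsFace (σ ∩ σ') σ ∧ IsFace (σ ∩ σ') σ'

def unitScale (u : (𝓞 F)ˣ) (σ : Set (RealSpace F)) : Set (RealSpace F) :=
  (fun v τ => τ (u : F) * v τ) '' σ

/-- A Shintani decomposition for a group `Γ` of units. -/
structure IsShintaniDecomposition (Γ : Subgroup (𝓞 F)ˣ) (Φ : Set (Set (RealSpace F))) : Prop
    extends IsSimplicialFan Φ where
  iUnion_interior : ⋃ σ ∈ Φ, intrinsicInterior ℝ σ = {v | ∀ τ, 0 < v τ} ∪ {0}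
  disjoint_interior : Φ.PairwiseDisjoint (intrinsicInterior ℝ)
  unitScale_mem : ∀ σ ∈ Φ, ∀ u ∈ Γ, unitScale u σ ∈ Φ
  finite_orbits : ∃ T ⊆ Φ, T.Finite ∧ ∀ σ ∈ Φ, ∃ ρ ∈ T, ∃ u ∈ Γ, unitScale u ρ = σ

def coneDim (σ : Set (RealSpace F)) : ℕ := Module.finrank ℝ (Submodule.span ℝ σ)

/-- Every `σ ∈ Φ` of dimension `d` is generated by some tuple in `A_ξ^d`. -/
def HasGeneratorsIn (Φ : Set (Set (RealSpace F))) : Prop :=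
  ∀ σ ∈ Φ, ∃ a : Fin (coneDim σ) → PrimitiveSet ξ, generatedCone (fun i => (a i).1) = σ

/-- The set `Φ_m`. -/
def ConesOfDim (Φ : Set (Set (RealSpace F))) (m : ℕ) : Type :=
  {σ : Set (RealSpace F) // σ ∈ Φ ∧ coneDim σ = m}

lemma unitScale_one (σ : Set (RealSpace F)) : unitScale 1 σ = σ := by
  simp [unitScale]

lemma unitScale_mul (u v : (𝓞 F)ˣ) (σ : Set (RealSpace F)) :
    unitScale (u * v) σ = unitScale u (unitScale v σ) := by
  simp [unitScale, Set.image_image, mul_assoc]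

def orbitSetoid (Φ : Set (Set (RealSpace F))) (m : ℕ) : Setoid (ConesOfDim Φ m) where
  r σ σ' := ∃ u ∈ stabilizer ξ, unitScale u σ.1 = σ'.1
  iseqv :=
    { refl := fun σ => ⟨1, one_mem _, unitScale_one _⟩
      symm := fun {σ σ'} ⟨u, hu, h⟩ => ⟨u⁻¹, inv_mem hu, by
        rw [← h, ← unitScale_mul, inv_mul_cancel, unitScale_one]⟩
      trans := fun {σ σ' σ''} ⟨u, hu, h⟩ ⟨v, hv, h'⟩ => ⟨v * u, mul_mem hv hu, by
        rw [unitScale_mul, h, h']⟩ }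

/-- The quotient `Δ_ξ \ Φ_m`. -/
def ConeOrbits (Φ : Set (Set (RealSpace F))) (m : ℕ) : Type := Quotient (orbitSetoid ξ Φ m)

/-- A choice, for each orbit, of a generator in `A_ξ^m` of some cone in that orbit. -/
def IsGeneratorSystem (Φ : Set (Set (RealSpace F))) (m : ℕ)
    (a : ConeOrbits ξ Φ m → Fin m → PrimitiveSet ξ) : Prop :=
  ∀ c, ∃ σ : ConesOfDim Φ m, Quotient.mk (orbitSetoid ξ Φ m) σ = c ∧
    generatedCone (fun i => (a c i).1) = σ.1

/-- The sign of the determinant of the matrix with `(i, j)` entry `τ_i (a_j)`. -/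
def orientation {m : ℕ} (τ : Fin m ≃ (F →+* ℝ)) (a : Fin m → 𝓞 F) : ℤ :=
  SignType.sign (Matrix.det (Matrix.of fun i j => τ i (a j : F)))

/-- `C^•(𝔙 / Δ_ξ, 𝒪_ξ)`, the `Δ_ξ`-invariant alternating `ℚ(ξ)`-valued functions on `A_ξ^(q+1)`. -/
abbrev CechComplex : CochainComplex (ModuleCat (valueField ξ)) ℕ :=
  cechSections (valueField ξ) (stabilizer ξ) (PrimitiveSet ξ)

/-- `H^m(ξ / Δ_ξ, 𝒪_ξ)` for `ξ = Spec ℚ(ξ)`. -/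
abbrev PointCohomology (m : ℕ) : ModuleCat (valueField ξ) :=
  equivariantCohomology (valueField ξ) (stabilizer ξ) m
    (structureSheaf (valueField ξ) (stabilizer ξ))

/-- The component `η_a` of a cocycle `η`. -/
def component {q : ℕ} (z : (CechComplex ξ).cycles q) (a : Fin (q + 1) → PrimitiveSet ξ) :
    valueField ξ :=
  ((CechComplex ξ).iCycles q z).1.1 a

/-- The sum over `Δ_ξ \ Φ_g` of `sgn(a) η_a`. -/
def orbitSum (Φ : Set (Set (RealSpace F))) {n : ℕ} (τ : Fin (n + 1) ≃ (F →+* ℝ))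
    (a : ConeOrbits ξ Φ (n + 1) → Fin (n + 1) → PrimitiveSet ξ)
    (z : (CechComplex ξ).cycles n) : valueField ξ :=
  ∑ᶠ c : ConeOrbits ξ Φ (n + 1), (orientation τ fun i => (a c i).1) • component ξ z (a c)

end NumberField

end

end ShintaniEcc

/-! Write g = n + 1. The cohomology is shown to be at most one-dimensional, and the orbit sum is
shown to be a well-defined functional on it that takes the value 1 on a class chosen independently
of Γ and Φ.

Over a field, equivariant modules are vector spaces with an action of Δ_ξ. Since Δ_ξ acts freely on
A_ξ, the alternating cochains are injective objects: a linear extension of a map becomes equivariant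
after averaging suitable conjugates over the q + 1 entries of the tuple (`cechObj_injective`).
Fixing an element of A_ξ contracts the Čech complex. It is therefore itself an injective resolution
of the structure sheaf, and all comparison maps coincide with one isomorphism κ
(`exists_cechComparison_iso`).

By Dirichlet's unit theorem Δ_ξ is free abelian of rank at most g - 1. Imposing invariance under one
basis element t at a time gives, because t - 1 is surjective on cochains, a short exact sequence of
complexes, and each such step raises the bound on the top degree by one (`CohomologyBound.insert`).
Hence the degree g - 1 cohomology has dimension at most one (`exists_homology_generator`).

The top cones modulo Δ_ξ form a cycle: across every facet there is exactly one neighbour, and it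
induces the opposite orientation on the facet (`IsTopTuple.exists_flip`, `IsTopTuple.eq_of_eqOn`).
So orbit sums of coboundaries cancel in pairs (`sum_signedValue_altDiff`).

A totally positive point x in general position defines a cochain that counts, with the sign of the
tuple, the points of the orbit Δ_ξ x in its cone (`pointCocycle`). It is a cocycle because a line
meets the positive orthant in nothing or in a segment, whose two ends carry opposite signs
(`sum_sign_mem_vectorCone`). For every Φ, the point x lies in exactly one top cone, so the orbit sum
is 1 (`sum_orbits_pointCocycle`). The class of this one cocycle spans the cohomology, and its value
1 for all Γ and Φ gives the isomorphism and its canonicity. -/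

namespace ShintaniEcc
noncomputable section

/-! ### Contraction of the alternating complex -/

section Exactness

variable {K : Type} [Field K] {S : Type}

/-- The contracting homotopy `f ↦ f (s, -)` of the alternating cochain complex. -/
def coneOff (s : S) {q : ℕ} (f : (Fin (q + 2) → S) → K) (a : Fin (q + 1) → S) : K :=
  f (Fin.cons s a)

lemma coneOff_mem (s : S) {q : ℕ} {f : (Fin (q + 2) → S) → K}
    (hf : f ∈ altCochains K S (q + 1)) : coneOff s f ∈ altCochains K S q := by
  refine ⟨fun ρ a => ?_, fun a ha => hf.2 _ fun h => ha fun i j hij => ?_⟩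
  · have e : (Fin.cons s (a ∘ ρ) : Fin (q + 2) → S) =
        Fin.cons s a ∘ Equiv.Perm.decomposeFin.symm (0, ρ) := by
      funext k
      refine Fin.cases ?_ (fun k => ?_) k <;> simp
    rw [coneOff, e, hf.1, coneOff]
    simp
  · exact Fin.succ_injective _ (h (by simpa using hij))

/-- The homotopy identity dh + hd = 1: omitting the new entry returns `f a`, and every other
omission moves one place to the right, whence the minus sign. -/
lemma altDiff_cons (s : S) {q : ℕ} (f : (Fin (q + 2) → S) → K) (a : Fin (q + 2) → S) :
    altDiff f (Fin.cons s a) = f a - altDiff (coneOff s f) a := by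
  rw [altDiff, Fin.sum_univ_succ, altDiff, sub_eq_add_neg, ← Finset.sum_neg_distrib]
  congr 1
  · simp only [Fin.val_zero, pow_zero, one_mul]
    congr 1
  · refine Finset.sum_congr rfl fun j _ => ?_
    have e : (Fin.cons s a : Fin (q + 3) → S) ∘ j.succ.succAbove = Fin.cons s (a ∘ j.succAbove) := by
      funext k
      refine Fin.cases ?_ (fun k => ?_) k <;> simp
    rw [e, coneOff, Fin.val_succ, pow_succ]
    ring

lemma altDiff_coneOff (s : S) {q : ℕ} {f : (Fin (q + 2) → S) → K} (hf : altDiff f = 0) :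
    altDiff (coneOff s f) = f := by
  funext a
  have := altDiff_cons s f a
  rw [hf, Pi.zero_apply] at this
  linear_combination this

lemma eq_const_of_altDiff_eq_zero (s : S) {f : (Fin (0 + 1) → S) → K} (hf : altDiff f = 0)
    (a : Fin (0 + 1) → S) : f a = f fun _ => s := by
  have h := congrFun hf (Fin.cons s a)
  rw [altDiff, Fin.sum_univ_two] at h
  have e0 : (Fin.cons s a : Fin 2 → S) ∘ (0 : Fin 2).succAbove = a := by
    funext k; simp
  have e1 : (Fin.cons s a : Fin 2 → S) ∘ (1 : Fin 2).succAbove = fun _ => s := by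
    funext k
    have hk : k = 0 := Subsingleton.elim (α := Fin 1) _ _
    subst hk
    rfl
  rw [e0, e1] at h
  simp only [Fin.val_zero, pow_zero, one_mul, Fin.val_one, pow_one, Pi.zero_apply] at h
  linear_combination h

end Exactness

/-! ### Free actions -/

section Translation

variable {G S : Type} [Group G] [MulAction G S]

/-- A free action admits an equivariant map to the group. -/
lemma exists_equivariant_map (hfree : ∀ (u : G) (s : S), u • s = s → u = 1) :
    ∃ ν : S → G, ∀ (u : G) (s : S), ν (u • s) = u * ν s := by
  classical
  have h : ∀ s : S, ∃ u : G, u • (Quotient.out (Quotient.mk (MulAction.orbitRel G S) s)) = s :=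
    fun s => by
      have h1 : (MulAction.orbitRel G S) (Quotient.out (Quotient.mk (MulAction.orbitRel G S) s)) s :=
        Quotient.mk_out s
      obtain ⟨u, hu⟩ := (MulAction.orbitRel G S).symm h1
      exact ⟨u, hu⟩
  choose ν hν using h
  refine ⟨ν, fun u s => ?_⟩
  have hq : Quotient.mk (MulAction.orbitRel G S) (u • s) = Quotient.mk (MulAction.orbitRel G S) s :=
    Quotient.sound ⟨u, rfl⟩
  have h1 := hν (u • s)
  rw [hq] at h1
  have h2 := hν s
  refine eq_of_inv_mul_eq_one ?_
  refine hfree _ (Quotient.out (Quotient.mk (MulAction.orbitRel G S) s)) ?_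
  rw [mul_smul, mul_smul, h2, inv_smul_eq_iff, h1]

end Translation

/-! ### Injectivity of the cochain modules -/

section Injectivity

variable (K : Type) [Field K] (G : Type) [Group G] (S : Type) [MulAction G S]

/-- A construction that depends on the choice of an element of `S` becomes canonical on tuples when
the entries themselves are used as choices. Averaging over all of them keeps the sign rule, since
the sum ignores their order. -/
lemma average_mem {q : ℕ} (c : S → (Fin (q + 1) → S) → K)
    (hc : ∀ s, c s ∈ altCochains K S q) :
    (fun a => ((q : K) + 1)⁻¹ * ∑ i, c (a i) a) ∈ altCochains K S q := by
  refine ⟨fun ρ a => ?_, fun a ha => ?_⟩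
  · simp only [Function.comp_apply, (hc _).1]
    rw [← Finset.mul_sum, Equiv.sum_comp ρ fun i => c (a i) a]
    ring
  · simp [(hc _).2 a ha]

variable {K G} in
lemma action_hom_apply {X Y : Action (ModuleCat K) G} (f : X ⟶ Y) (u : G) (x : X.V) :
    f.hom.hom ((X.ρ u).hom x) = (Y.ρ u).hom (f.hom.hom x) :=
  congrArg (fun φ => φ.hom x) (f.comm u)

variable {K G} in
lemma action_ρ_mul_apply {X : Action (ModuleCat K) G} (u v : G) (x : X.V) :
    (X.ρ (u * v)).hom x = (X.ρ u).hom ((X.ρ v).hom x) := by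
  rw [map_mul]; rfl

/-- The group may be infinite, so a linear extension cannot be averaged over it. The entries of a
tuple, carried into the group by `ν`, supply q + 1 conjugates to average instead; on the subobject
each conjugate already equals the given map. -/
theorem cechObj_injective [CharZero K] (hfree : ∀ (u : G) (s : S), u • s = s → u = 1) (q : ℕ) :
    Injective (cechObj K G S q) := by
  obtain ⟨ν, hν⟩ := exists_equivariant_map hfree
  refine ⟨fun {X Y} g f _ => ?_⟩
  have hf : Function.Injective f.hom.hom := by
    have : Mono ((Action.forget (ModuleCat K) G).map f) := inferInstance
    exact (ModuleCat.mono_iff_injective _).1 this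
  obtain ⟨r, hr⟩ := f.hom.hom.exists_leftInverse_of_injective (LinearMap.ker_eq_bot.2 hf)
  -- The map `g ∘ r` is a linear extension of `g`, not an equivariant one. `c y s` is its conjugate
  -- by `ν s`, evaluated at `y`; as `ν` is equivariant, `c` is invariant under moving `y`, `s` and
  -- the tuple together.
  let γ : Y.V → S → altCochains K S q := fun y s =>
    g.hom.hom (r ((Y.ρ (ν s)⁻¹).hom y))
  let c : Y.V → S → (Fin (q + 1) → S) → K := fun y s a => (γ y s).1 ((ν s)⁻¹ • a)
  have hc : ∀ y s, c y s ∈ altCochains K S q := fun y s =>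
    (((cechObj K G S q).ρ (ν s)).hom (γ y s) : altCochains K S q).2
  have hq : ((q : K) + 1) ≠ 0 := by exact_mod_cast Nat.succ_ne_zero q
  have hcadd : ∀ y y' s a, c (y + y') s a = c y s a + c y' s a := fun y y' s a => by
    simp only [c, γ, map_add]; rfl
  have hcsmul : ∀ (k : K) y s a, c (k • y) s a = k * c y s a := fun k y s a => by
    simp only [c, γ, map_smul]; rfl
  let E : Y.V →ₗ[K] altCochains K S q :=
    { toFun := fun y => ⟨_, average_mem K S (c y) (hc y)⟩
      map_add' := fun y y' => by
        ext a
        simp [hcadd, Finset.sum_add_distrib, mul_add]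
      map_smul' := fun k y => by
        ext a
        simp only [hcsmul, ← Finset.mul_sum, RingHom.id_apply, SetLike.val_smul, Pi.smul_apply,
          smul_eq_mul]
        ring }
  have hE : ∀ y (a : Fin (q + 1) → S), (E y).1 a = ((q : K) + 1)⁻¹ * ∑ i, c y (a i) a :=
    fun _ _ => rfl
  refine ⟨{ hom := ModuleCat.ofHom E, comm := fun u => ?_ }, ?_⟩
  · ext y
    refine Subtype.ext (funext fun a => ?_)
    change (E ((Y.ρ u).hom y)).1 a = (E y).1 (u⁻¹ • a)
    rw [hE, hE]
    congr 1
    refine Finset.sum_congr rfl fun i _ => ?_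
    simp only [c, γ, Pi.smul_apply, hν, mul_inv_rev, inv_inv, ← action_ρ_mul_apply, mul_smul,
      smul_inv_smul]
  · apply Action.hom_ext
    ext x
    refine Subtype.ext (funext fun a => ?_)
    change (E (f.hom.hom x)).1 a = (g.hom.hom x : altCochains K S q).1 a
    rw [hE]
    have : ∀ i, c (f.hom.hom x) (a i) a = (g.hom.hom x : altCochains K S q).1 a := fun i => by
      simp only [c, γ]
      rw [← action_hom_apply]
      have h1 : r (f.hom.hom ((X.ρ (ν (a i))⁻¹).hom x)) = (X.ρ (ν (a i))⁻¹).hom x :=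
        LinearMap.congr_fun hr _
      rw [h1, action_hom_apply]
      change (g.hom.hom x : altCochains K S q).1 (((ν (a i))⁻¹)⁻¹ • (ν (a i))⁻¹ • a) = _
      rw [inv_smul_smul]
    simp only [this, Finset.sum_const, Finset.card_univ, Fintype.card_fin, nsmul_eq_mul]
    push_cast
    rw [← mul_assoc, inv_mul_cancel₀ hq, one_mul]

end Injectivity

/-! ### Injective resolutions and derived functors -/

section InjectiveResolutions

variable {C : Type*} [Category* C] [Abelian C]

/-- A coaugmented exact complex of injectives as an injective resolution. -/
def resolutionOfExact {Z : C} (L : CochainComplex C ℕ) (hL : ∀ q, Injective (L.X q))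
    (ε : Z ⟶ L.X 0) [Mono ε] (hε : ε ≫ L.d 0 1 = 0) (hex : (ShortComplex.mk _ _ hε).Exact)
    (hex' : ∀ q, (ShortComplex.mk _ _ (L.d_comp_d q (q + 1) (q + 2))).Exact) :
    InjectiveResolution Z where
  cocomplex := L
  injective := hL
  ι := (CochainComplex.fromSingle₀Equiv _ _).symm ⟨ε, hε⟩
  quasiIso := ⟨fun n => by
    cases n with
    | zero =>
      rw [CochainComplex.quasiIsoAt₀_iff, ShortComplex.quasiIso_iff_of_zeros]
      · refine (ShortComplex.exact_and_mono_f_iff_of_iso ?_).2 ⟨hex, ‹Mono ε›⟩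
        refine ShortComplex.isoMk (Iso.refl _) (Iso.refl _) (Iso.refl _) ?_ ?_
        · refine (Category.id_comp _).trans (Eq.trans ?_ (Category.comp_id _).symm)
          exact (CochainComplex.fromSingle₀Equiv_symm_apply_f_zero _ _).symm
        · exact (Category.id_comp _).trans (Category.comp_id _).symm
      · rfl
      · rfl
      · exact L.shape _ _ (by simp)
    | succ n =>
      rw [quasiIsoAt_iff_exactAt]
      · exact (HomologicalComplex.exactAt_iff' _ n (n + 1) (n + 2) (by simp)
          (by simp only [CochainComplex.next]; rfl)).2 (hex' n)
      · apply CochainComplex.exactAt_succ_single_obj⟩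

lemma resolutionOfExact_ι {Z : C} (L : CochainComplex C ℕ) (hL : ∀ q, Injective (L.X q))
    (ε : Z ⟶ L.X 0) [Mono ε] (hε : ε ≫ L.d 0 1 = 0) (hex : (ShortComplex.mk _ _ hε).Exact)
    (hex' : ∀ q, (ShortComplex.mk _ _ (L.d_comp_d q (q + 1) (q + 2))).Exact) :
    (resolutionOfExact L hL ε hε hex hex').ι.f 0 = ε :=
  CochainComplex.fromSingle₀Equiv_symm_apply_f_zero _ _

variable {D : Type*} [Category* D] [Abelian D]

/-- A map of resolutions over the identity of `Z` induces the identity on derived functors, so the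
comparison depends neither on `I` nor on `φ`. -/
lemma homologyMap_comp_isoRightDerivedObj_inv [HasInjectiveResolutions C]
    (F : C ⥤ D) [F.Additive] {Z : C}
    (J I : InjectiveResolution Z) (φ : J.cocomplex ⟶ I.cocomplex)
    (hφ : J.ι.f 0 ≫ φ.f 0 = I.ι.f 0) {B : CochainComplex D ℕ}
    (σ : B ⟶ (F.mapHomologicalComplex _).obj J.cocomplex) (m : ℕ) :
    HomologicalComplex.homologyMap (σ ≫ (F.mapHomologicalComplex _).map φ) m ≫
        (I.isoRightDerivedObj F m).inv =
      HomologicalComplex.homologyMap σ m ≫ (J.isoRightDerivedObj F m).inv := by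
  have h := InjectiveResolution.isoRightDerivedObj_inv_naturality (𝟙 Z) J I φ
    (hφ.trans (Category.id_comp (I.ι.f 0)).symm) F m
  rw [CategoryTheory.Functor.map_id, Category.comp_id] at h
  rw [HomologicalComplex.homologyMap_comp, h]
  exact Category.assoc _ _ _

lemma exact_comp_iso {X Y Z W : C} (e : W ⟶ X) [IsIso e] (f : X ⟶ Y) (g : Y ⟶ Z) (w : f ≫ g = 0)
    (w' : (e ≫ f) ≫ g = 0) (h : (ShortComplex.mk f g w).Exact) :
    (ShortComplex.mk (e ≫ f) g w').Exact := by
  have i : ShortComplex.mk (e ≫ f) g w' ≅ ShortComplex.mk f g w :=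
    ShortComplex.isoMk (asIso e) (Iso.refl _) (Iso.refl _) (by simp) (by simp)
  exact (ShortComplex.exact_iff_of_iso i).2 h

end InjectiveResolutions

/-! ### The Čech complex as an injective resolution -/

section Resolution

variable (K : Type) [Field K] (G : Type) [Group G]

instance : (tilde.functor (.of K)).IsEquivalence :=
  (tilde.adjunction (R := .of K)).isEquivalence_left_of_isEquivalence_right

/-- This transports injectivity and exactness from modules with an action to equivariant sheaves. -/
instance : (associatedSheaf K G).IsEquivalence :=
  ((tilde.functor (.of K)).asEquivalence.mapAction G).isEquivalence_functor

instance : IsIso (structureSheafToAssociated K G) := by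
  have : IsIso (structureSheafToAssociated K G).hom :=
    (tildeSelf (R := .of K)).isIso_inv
  exact Action.isIso_of_hom_isIso _

instance (M : Action (ModuleCat K) G) : IsIso ((sectionsOfAssociated K G).app M) := by
  have h : IsIso ((tilde.toTildeΓNatIso (R := .of K)).hom.app M.V) :=
    NatIso.hom_app_isIso (tilde.toTildeΓNatIso (R := .of K)) M.V
  let φ : M ⟶ ((moduleSpecΓFunctor (R := .of K)).mapAction G).obj ((associatedSheaf K G).obj M) :=
    { hom := (tilde.toTildeΓNatIso (R := .of K)).hom.app M.V
      comm := fun u => (tilde.toTildeΓNatIso (R := .of K)).hom.naturality (M.ρ u) }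
  have : IsIso φ.hom := h
  have : IsIso φ := Action.isIso_of_hom_isIso φ
  exact Functor.map_isIso (invariants K G) φ

lemma action_exact_iff (T : ShortComplex (Action (ModuleCat K) G)) :
    T.Exact ↔ ∀ y : T.X₂.V, T.g.hom.hom y = 0 → ∃ x : T.X₁.V, T.f.hom.hom x = y := by
  rw [← ShortComplex.exact_map_iff_of_faithful T (Action.forget (ModuleCat K) G),
    ShortComplex.moduleCat_exact_iff]
  rfl

lemma cechUnit_mono {S : Type} [MulAction G S] (s : S) : Mono (cechUnit K G S) := by
  have : Mono ((Action.forget (ModuleCat K) G).map (cechUnit K G S)) := by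
    rw [ModuleCat.mono_iff_injective]
    intro c c' h
    exact congrFun (congrArg Subtype.val h) fun _ => s
  exact (Action.forget (ModuleCat K) G).mono_of_mono_map this

variable [CharZero K] (S : Type) [MulAction G S]

instance : IsIso (cechSectionsMap K G S) := by
  have : ∀ q, IsIso ((cechSectionsMap K G S).f q) := fun q =>
    inferInstanceAs (IsIso ((sectionsOfAssociated K G).app _))
  exact HomologicalComplex.Hom.isIso_of_components _

lemma cechComplex_d (q : ℕ) : (cechComplex K G S).d q (q + 1) = cechDiff K G S q :=
  CochainComplex.of_d _ _ _

lemma cechComplex_d_apply (q : ℕ) (f : altCochains K S q) :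
    (((cechComplex K G S).d q (q + 1)).hom.hom f : altCochains K S (q + 1)).1 = altDiff f.1 := by
  rw [cechComplex_d]; rfl

lemma cechUnit_comp_d :
    (cechUnit K G S ≫ (cechComplex K G S).d 0 1 : trivialModule K G ⟶ (cechComplex K G S).X 1) =
      0 := by
  apply Action.hom_ext
  refine ModuleCat.hom_ext (LinearMap.ext fun (c : K) => Subtype.ext (funext fun a => ?_))
  refine (congrFun (cechComplex_d_apply K G S 0 _) a).trans ?_
  rw [altDiff, Fin.sum_univ_two]
  change (-1) ^ 0 * c + (-1) ^ 1 * c = 0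
  ring

variable {S} in
lemma cechUnit_exact (s : S) :
    (ShortComplex.mk (cechUnit K G S : trivialModule K G ⟶ (cechComplex K G S).X 0) _
      (cechUnit_comp_d K G S)).Exact := by
  rw [action_exact_iff]
  intro (f : altCochains K S 0) hf
  have hf' : altDiff f.1 = 0 :=
    (cechComplex_d_apply K G S 0 f).symm.trans (congrArg Subtype.val hf)
  refine ⟨(f.1 fun _ => s : K), Subtype.ext (funext fun a => ?_)⟩
  exact (eq_const_of_altDiff_eq_zero s hf' a).symm

variable {S} in
lemma cechComplex_exact (s : S) (q : ℕ) :
    (ShortComplex.mk _ _ ((cechComplex K G S).d_comp_d q (q + 1) (q + 2))).Exact := by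
  rw [action_exact_iff]
  intro (f : altCochains K S (q + 1)) hf
  have hf' : altDiff f.1 = 0 :=
    (cechComplex_d_apply K G S (q + 1) f).symm.trans (congrArg Subtype.val hf)
  refine ⟨(⟨_, coneOff_mem s f.2⟩ : altCochains K S q), Subtype.ext ?_⟩
  exact (cechComplex_d_apply K G S q _).trans (altDiff_coneOff s hf')

lemma associatedSheaf_map_cechUnit_comp_d :
    (associatedSheaf K G).map (cechUnit K G S : trivialModule K G ⟶ (cechComplex K G S).X 0) ≫
      (cechSheafComplex K G S).d 0 1 = 0 :=
  ((associatedSheaf K G).map_comp _ _).symm.trans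
    ((congrArg (associatedSheaf K G).map (cechUnit_comp_d K G S)).trans
      (Functor.map_zero _ _ _))

lemma cechAugmentation_comp_d :
    cechAugmentation K G S ≫ (cechSheafComplex K G S).d 0 1 = 0 :=
  (Category.assoc _ _ _).trans ((congrArg (fun f => structureSheafToAssociated K G ≫ f)
    (associatedSheaf_map_cechUnit_comp_d K G S)).trans Limits.comp_zero)

variable {S} in
lemma cechAugmentation_exact (s : S) :
    (ShortComplex.mk _ _ (cechAugmentation_comp_d K G S)).Exact :=
  exact_comp_iso (structureSheafToAssociated K G) _ _ (associatedSheaf_map_cechUnit_comp_d K G S)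
    (cechAugmentation_comp_d K G S) ((cechUnit_exact K G s).map (associatedSheaf K G))

variable {S} in
lemma cechAugmentation_mono (s : S) : Mono (cechAugmentation K G S) := by
  have := cechUnit_mono K G s
  have h : Mono ((associatedSheaf K G).map (cechUnit K G S)) := inferInstance
  exact mono_comp (structureSheafToAssociated K G) ((associatedSheaf K G).map (cechUnit K G S))

variable {S} in
-- The Čech complex is itself an injective resolution `J`, so its identity map is an admissible
-- comparison, and every other one agrees with it by `homologyMap_comp_isoRightDerivedObj_inv`.
theorem exists_cechComparison_iso (hfree : ∀ (u : G) (s : S), u • s = s → u = 1) (s : S) (m : ℕ) :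
    ∃ κ : (cechSections K G S).homology m ≅ equivariantCohomology K G m (structureSheaf K G),
      ∀ f, IsCechComparison K G S m f ↔ f = κ.hom := by
  have hinj : ∀ q, Injective ((cechSheafComplex K G S).X q) := fun q =>
    ((associatedSheaf K G).asEquivalence.map_injective_iff (cechObj K G S q)).2
      (cechObj_injective K G S hfree q)
  have := cechAugmentation_mono K G s
  have hex' : ∀ q, (ShortComplex.mk _ _
      ((cechSheafComplex K G S).d_comp_d q (q + 1) (q + 2))).Exact := fun q =>
    (cechComplex_exact K G s q).map (associatedSheaf K G)
  let J := resolutionOfExact (cechSheafComplex K G S) hinj (cechAugmentation K G S)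
    (cechAugmentation_comp_d K G S) (cechAugmentation_exact K G s) hex'
  have hJ : J.ι.f 0 = cechAugmentation K G S := resolutionOfExact_ι _ _ _ _ _ _
  have key : ∀ (I : InjectiveResolution (structureSheaf K G))
      (φ : cechSheafComplex K G S ⟶ I.cocomplex), cechAugmentation K G S ≫ φ.f 0 = I.ι.f 0 →
      cechComparison K G S φ m = HomologicalComplex.homologyMap (cechSectionsMap K G S) m ≫
        (J.isoRightDerivedObj (equivariantSections K G) m).inv := fun I φ hφ =>
    homologyMap_comp_isoRightDerivedObj_inv (equivariantSections K G) J I φ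
      ((congrArg (fun f => f ≫ φ.f 0) hJ).trans hφ) (cechSectionsMap K G S) m
  have hid : cechAugmentation K G S ≫
      HomologicalComplex.Hom.f (𝟙 (cechSheafComplex K G S)) 0 = J.ι.f 0 :=
    (Category.comp_id _).trans hJ.symm
  refine ⟨asIso (HomologicalComplex.homologyMap (cechSectionsMap K G S) m) ≪≫
    (J.isoRightDerivedObj (equivariantSections K G) m).symm, fun f => ⟨?_, fun hf => ?_⟩⟩
  · rintro ⟨I, φ, hφ, rfl⟩
    exact key I φ hφ
  · exact ⟨J, 𝟙 _, hid, hf.trans (key J (𝟙 _) hid).symm⟩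

end Resolution

/-! ### Cohomology of invariant cochains, one translation at a time -/

section InvariantCochains

variable (K : Type) [Field K] {S : Type}

/-- `altDiff` as a linear map. -/
def altDiffLinear (q : ℕ) : ((Fin (q + 1) → S) → K) →ₗ[K] ((Fin (q + 2) → S) → K) where
  toFun := altDiff
  map_add' f h := by
    funext a
    simp [altDiff, mul_add, Finset.sum_add_distrib]
  map_smul' c f := by
    funext a
    simp [altDiff, Finset.mul_sum, mul_left_comm]

/-- Alternating cochains invariant under a set of permutations of `S`. -/
def invCochains (T : Set (Equiv.Perm S)) (q : ℕ) : Submodule K ((Fin (q + 1) → S) → K) where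
  carrier := {f | f ∈ altCochains K S q ∧ ∀ t ∈ T, ∀ a : Fin (q + 1) → S, f (t ∘ a) = f a}
  zero_mem' := ⟨zero_mem _, by simp⟩
  add_mem' {f h} hf hh := ⟨add_mem hf.1 hh.1, fun t ht a => by simp [hf.2 t ht, hh.2 t ht]⟩
  smul_mem' c f hf := ⟨Submodule.smul_mem _ _ hf.1, fun t ht a => by simp [hf.2 t ht]⟩

def invCocycles (T : Set (Equiv.Perm S)) (q : ℕ) : Submodule K ((Fin (q + 1) → S) → K) :=
  invCochains K T q ⊓ LinearMap.ker (altDiffLinear K q)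

def invCoboundaries (T : Set (Equiv.Perm S)) : (q : ℕ) → Submodule K ((Fin (q + 1) → S) → K)
  | 0 => ⊥
  | q + 1 => (invCochains K T q).map (altDiffLinear K q)

/-- The cohomology of the `T`-invariant cochains vanishes above degree `r` and is at most
one-dimensional in degree `r`. -/
def CohomologyBound (T : Set (Equiv.Perm S)) (r : ℕ) : Prop :=
  (∀ q, r < q → invCocycles K T q ≤ invCoboundaries K T q) ∧
    ∃ f ∈ invCocycles K T r, invCocycles K T r ≤ Submodule.span K {f} ⊔ invCoboundaries K T r

variable {K}

/-- With no invariance imposed, `coneOff s` contracts the complex onto the constants. -/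
lemma cohomologyBound_empty (s : S) : CohomologyBound K (∅ : Set (Equiv.Perm S)) 0 := by
  refine ⟨fun q hq f hf => ?_, ⟨fun _ => 1, ⟨⟨⟨fun ρ a => ?_, fun a ha => ?_⟩, by simp⟩, ?_⟩,
    fun f hf => ?_⟩⟩
  · obtain ⟨q, rfl⟩ := Nat.exists_eq_succ_of_ne_zero hq.ne'
    exact ⟨coneOff s f, ⟨coneOff_mem s hf.1.1, by simp⟩, altDiff_coneOff s hf.2⟩
  · have : Subsingleton (Equiv.Perm (Fin (0 + 1))) :=
      inferInstanceAs (Subsingleton (Equiv.Perm (Fin 1)))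
    simp [Subsingleton.elim ρ 1]
  · exact (ha fun i j _ => Subsingleton.elim (α := Fin 1) i j).elim
  · refine LinearMap.mem_ker.2 (funext fun a => ?_)
    change altDiff (fun _ => (1 : K)) a = 0
    simp [altDiff, Fin.sum_univ_two]
  · refine Submodule.mem_sup_left (Submodule.mem_span_singleton.2 ⟨f fun _ => s, funext fun a => ?_⟩)
    rw [eq_const_of_altDiff_eq_zero s hf.2 a]
    simp

/-- The indefinite sum of a function on `ℤ` vanishing at `0`. -/
def indefSum (g : ℤ → K) (k : ℤ) : K :=
  ∑ j ∈ Finset.Ico 0 k, g j - ∑ j ∈ Finset.Ico k 0, g j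

/-- The subtracted sum in `indefSum` covers negative `k`, so that one recursion holds on all of ℤ.
-/
lemma indefSum_add_one (g : ℤ → K) (k : ℤ) : indefSum g (k + 1) = indefSum g k + g k := by
  rcases le_or_gt 0 k with hk | hk
  · have e1 : Finset.Ico 0 (k + 1) = insert k (Finset.Ico 0 k) := by
      ext; simp only [Finset.mem_Ico, Finset.mem_insert]; omega
    have e2 : Finset.Ico (k + 1) 0 = ∅ := Finset.Ico_eq_empty (by omega)
    have e3 : Finset.Ico k 0 = ∅ := Finset.Ico_eq_empty (by omega)
    rw [indefSum, indefSum, e1, e2, e3, Finset.sum_insert (by simp)]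
    ring
  · have e1 : Finset.Ico k 0 = insert k (Finset.Ico (k + 1) 0) := by
      ext; simp only [Finset.mem_Ico, Finset.mem_insert]; omega
    have e2 : Finset.Ico 0 (k + 1) = ∅ := Finset.Ico_eq_empty (by omega)
    have e3 : Finset.Ico 0 k = ∅ := Finset.Ico_eq_empty (by omega)
    rw [indefSum, indefSum, e1, e2, e3, Finset.sum_insert (by simp)]
    ring

lemma altDiff_invariant {T : Set (Equiv.Perm S)} {q : ℕ} {f : (Fin (q + 1) → S) → K}
    (hf : ∀ t ∈ T, ∀ a : Fin (q + 1) → S, f (t ∘ a) = f a) :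
    ∀ t ∈ T, ∀ a : Fin (q + 2) → S, altDiff f (t ∘ a) = altDiff f a := fun t ht a =>
  Finset.sum_congr rfl fun j _ => congrArg _ (hf t ht (a ∘ j.succAbove))

lemma comp_mem_invCochains {T : Set (Equiv.Perm S)} {t : Equiv.Perm S}
    (hcomm : ∀ t' ∈ T, Commute t' t) {q : ℕ} {f : (Fin (q + 1) → S) → K}
    (hf : f ∈ invCochains K T q) : (fun a => f (t ∘ a)) ∈ invCochains K T q := by
  refine ⟨⟨fun ρ a => hf.1.1 ρ (t ∘ a), fun a ha => hf.1.2 _ fun hi => ha hi.of_comp⟩,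
    fun t' ht' a => ?_⟩
  change f (t ∘ t' ∘ a) = f (t ∘ a)
  rw [← Function.comp_assoc, ← Equiv.Perm.coe_mul, ← (hcomm t' ht').eq, Equiv.Perm.coe_mul,
    Function.comp_assoc, hf.2 t' ht']

variable [CharZero K]

/-- Surjectivity of t - 1 on `T`-invariant cochains. One sums `f` along the `t`-orbit of the tuple;
the height `h` of an entry tells where to start, which keeps the sum finite, and averaging over the
entries removes the choice of entry. -/
lemma exists_antidifference {T : Set (Equiv.Perm S)} {t : Equiv.Perm S} (hcomm : ∀ t' ∈ T, Commute t' t)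
    {h : S → ℤ} (ht : ∀ s, h (t s) = h s + 1) (hT : ∀ t' ∈ T, ∀ s, h (t' s) = h s)
    {q : ℕ} {f : (Fin (q + 1) → S) → K} (hf : f ∈ invCochains K T q) :
    ∃ χ ∈ invCochains K T q, ∀ a : Fin (q + 1) → S, χ (t ∘ a) - χ a = f a := by
  let c : S → (Fin (q + 1) → S) → K := fun s a =>
    indefSum (fun j => f (⇑(t ^ (j - h s)) ∘ a)) (h s)
  have hc : ∀ s, c s ∈ altCochains K S q := by
    refine fun s => ⟨fun ρ a => ?_, fun a ha => ?_⟩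
    · simp only [c, indefSum, ← Function.comp_assoc, hf.1.1]
      rw [mul_sub, Finset.mul_sum, Finset.mul_sum]
    · have : ∀ m : ℤ, f (⇑(t ^ m) ∘ a) = 0 := fun m => hf.1.2 _ fun hi => ha hi.of_comp
      simp [c, indefSum, this]
  -- Moving `s` and `a` by `t` preserves the summands and lengthens the range by the index j = h s,
  -- whose summand is `f a`.
  have hct : ∀ s a, c (t s) (t ∘ a) = c s a + f a := fun s a => by
    have e : ∀ j : ℤ, ⇑(t ^ (j - (h s + 1))) ∘ t ∘ a = ⇑(t ^ (j - h s)) ∘ a := fun j => by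
      rw [← Function.comp_assoc, ← Equiv.Perm.coe_mul, ← zpow_add_one]
      congr 3
      ring
    simp only [c, ht, e]
    rw [indefSum_add_one]
    simp
  have hcT : ∀ t' ∈ T, ∀ s a, c (t' s) (t' ∘ a) = c s a := fun t' ht' s a => by
    have e : ∀ j : ℤ, f (⇑(t ^ (j - h s)) ∘ t' ∘ a) = f (⇑(t ^ (j - h s)) ∘ a) := fun j => by
      rw [← Function.comp_assoc, ← Equiv.Perm.coe_mul, ← ((hcomm t' ht').zpow_right _).eq,
        Equiv.Perm.coe_mul, Function.comp_assoc, hf.2 t' ht']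
    simp only [c, hT t' ht', e]
  have hq : ((q : K) + 1) ≠ 0 := by exact_mod_cast Nat.succ_ne_zero q
  refine ⟨_, ⟨average_mem K S c hc, fun t' ht' a => ?_⟩, fun a => ?_⟩
  · simp only [Function.comp_apply, hcT t' ht']
  · simp only [Function.comp_apply, hct, Finset.sum_add_distrib, Finset.sum_const,
      Finset.card_univ, Fintype.card_fin, nsmul_eq_mul]
    push_cast
    field_simp
    ring

/-- By `exists_antidifference` the invariants under `insert t T` are the kernel of a surjection t -
1 of the `T`-invariant complex onto itself. In the long exact sequence, degree q + 1 for the larger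
set is caught between degrees q and q + 1 for `T`. The argument below is that diagram chase. -/
theorem CohomologyBound.insert {T : Set (Equiv.Perm S)} {r : ℕ} (hb : CohomologyBound K T r)
    {t : Equiv.Perm S} (hcomm : ∀ t' ∈ T, Commute t' t)
    {h : S → ℤ} (ht : ∀ s, h (t s) = h s + 1) (hT : ∀ t' ∈ T, ∀ s, h (t' s) = h s) :
    CohomologyBound K (insert t T) (r + 1) := by
  let δ : ∀ q, ((Fin (q + 1) → S) → K) →ₗ[K] ((Fin (q + 1) → S) → K) := fun q =>
    { toFun := fun f a => f (t ∘ a) - f a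
      map_add' := fun f g => by funext a; simp only [Pi.add_apply]; ring
      map_smul' := fun c f => by
        funext a; simp only [Pi.smul_apply, smul_eq_mul, RingHom.id_apply]; ring }
  have hδd : ∀ q (f : (Fin (q + 1) → S) → K),
      δ (q + 1) (altDiffLinear K q f) = altDiffLinear K q (δ q f) := fun q f => by
    have : δ q f = (fun a => f (t ∘ a)) - f := rfl
    rw [this, map_sub]
    rfl
  have hmem : ∀ q (f : (Fin (q + 1) → S) → K), f ∈ invCochains K T q → δ q f = 0 →
      f ∈ invCochains K (Insert.insert t T) q := fun q f hf h0 => by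
    refine ⟨hf.1, fun t' ht' a => ?_⟩
    rcases ht' with rfl | ht'
    · exact sub_eq_zero.1 (congrFun h0 a)
    · exact hf.2 t' ht' a
  have hmem' : ∀ q (f : (Fin (q + 1) → S) → K), f ∈ invCochains K (Insert.insert t T) q →
      f ∈ invCochains K T q ∧ δ q f = 0 := fun q f hf =>
    ⟨⟨hf.1, fun t' ht' => hf.2 t' (Set.mem_insert_of_mem _ ht')⟩,
      funext fun a => sub_eq_zero.2 (hf.2 t (Set.mem_insert _ _) a)⟩
  -- If δθ = dψ and δχ = ψ, then θ - dχ is `t`-invariant and has the same differential as θ. In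
  -- degree 0 there are no coboundaries, so θ is already invariant.
  have descend : ∀ q (θ : (Fin (q + 1) → S) → K), θ ∈ invCochains K T q →
      δ q θ ∈ invCoboundaries K T q →
      altDiffLinear K q θ ∈ invCoboundaries K (Insert.insert t T) (q + 1) := by
    intro q θ hθ hc
    cases q with
    | zero => exact ⟨θ, hmem _ _ hθ hc, rfl⟩
    | succ q =>
      obtain ⟨ψ, hψ, hψ'⟩ := hc
      obtain ⟨χ, hχ, hχ'⟩ := exists_antidifference hcomm ht hT hψ
      have hχ'' : δ q χ = ψ := funext hχ'
      have hdχ : altDiffLinear K q χ ∈ invCochains K T (q + 1) :=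
        ⟨altDiff_mem K S hχ.1, altDiff_invariant hχ.2⟩
      refine ⟨θ - altDiffLinear K q χ, hmem _ _ (sub_mem hθ hdχ) ?_, ?_⟩
      · rw [map_sub, hδd, hχ'', hψ', sub_self]
      · rw [map_sub, sub_eq_self]
        exact altDiff_altDiff K S χ
  -- As q + 1 > r, a cocycle is the differential of some `T`-invariant θ. Its own `t`-invariance
  -- makes δθ closed.
  have lift : ∀ q, r ≤ q → ∀ f ∈ invCocycles K (Insert.insert t T) (q + 1),
      ∃ θ ∈ invCochains K T q, altDiffLinear K q θ = f ∧ δ q θ ∈ invCocycles K T q := by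
    intro q hq f hf
    obtain ⟨hf1, hf2⟩ := hmem' _ _ hf.1
    obtain ⟨θ, hθ, rfl⟩ := hb.1 (q + 1) (by omega) ⟨hf1, hf.2⟩
    refine ⟨θ, hθ, rfl, sub_mem (comp_mem_invCochains hcomm hθ) hθ, ?_⟩
    exact (hδd q θ).symm.trans hf2
  refine ⟨fun q hq f hf => ?_, ?_⟩
  · obtain ⟨q, rfl⟩ := Nat.exists_eq_succ_of_ne_zero (by omega : q ≠ 0)
    obtain ⟨θ, hθ, rfl, hδ⟩ := lift q (by omega) f hf
    exact descend q θ hθ (hb.1 q (by omega) hδ)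
  · obtain ⟨f₀, hf₀, hspan⟩ := hb.2
    have split : ∀ θ, δ r θ ∈ invCocycles K T r →
        ∃ c : K, δ r θ - c • f₀ ∈ invCoboundaries K T r := fun θ hδ => by
      obtain ⟨y, hy, w, hw, hyw⟩ := Submodule.mem_sup.1 (hspan hδ)
      obtain ⟨c, rfl⟩ := Submodule.mem_span_singleton.1 hy
      exact ⟨c, by rwa [← hyw, add_sub_cancel_left]⟩
    -- If every cocycle is a coboundary, 0 is a generator. Otherwise any cocycle that is not one
    -- generates, because by `descend` its coefficient `c₁` along `f₀` cannot vanish.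
    by_cases hall : invCocycles K (Insert.insert t T) (r + 1) ≤
        invCoboundaries K (Insert.insert t T) (r + 1)
    · exact ⟨0, zero_mem _, hall.trans le_sup_right⟩
    obtain ⟨f₁, hf₁, hf₁'⟩ := Set.not_subset.1 hall
    obtain ⟨θ₁, hθ₁, rfl, hδ₁⟩ := lift r le_rfl f₁ hf₁
    obtain ⟨c₁, hc₁⟩ := split θ₁ hδ₁
    have hc₁' : c₁ ≠ 0 := by
      rintro rfl
      rw [zero_smul, sub_zero] at hc₁
      exact hf₁' (descend r θ₁ hθ₁ hc₁)
    refine ⟨_, hf₁, fun f hf => ?_⟩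
    obtain ⟨θ, hθ, rfl, hδ⟩ := lift r le_rfl f hf
    obtain ⟨c, hc⟩ := split θ hδ
    have key := descend r (θ - (c / c₁) • θ₁) (sub_mem hθ (Submodule.smul_mem _ _ hθ₁)) (by
      have e : δ r (θ - (c / c₁) • θ₁) =
          (δ r θ - c • f₀) - (c / c₁) • (δ r θ₁ - c₁ • f₀) := by
        rw [map_sub, map_smul, smul_sub, smul_smul, div_mul_cancel₀ _ hc₁']
        abel
      rw [e]
      exact sub_mem hc (Submodule.smul_mem _ _ hc₁))
    rw [map_sub, map_smul] at key
    exact Submodule.mem_sup.2 ⟨(c / c₁) • altDiffLinear K r θ₁,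
      Submodule.smul_mem _ _ (Submodule.mem_span_singleton_self _), _, key, by abel⟩

/-- `h i` is the coordinate along the i-th translation; the others preserve it, so the translations
can be inserted one by one. -/
theorem cohomologyBound_range {r : ℕ} (t : Fin r → Equiv.Perm S) (hcomm : ∀ i j, Commute (t i) (t j))
    (h : Fin r → S → ℤ) (h_self : ∀ i s, h i (t i s) = h i s + 1)
    (h_ne : ∀ i j, i ≠ j → ∀ s, h i (t j s) = h i s) (s₀ : S) :
    CohomologyBound K (Set.range t) r := by
  have aux : ∀ m ≤ r, CohomologyBound K (t '' {i | (i : ℕ) < m}) m := by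
    intro m
    induction m with
    | zero => intro _; simpa using cohomologyBound_empty s₀
    | succ m ih =>
      intro hm
      have e : t '' {i | (i : ℕ) < m + 1} = Insert.insert (t ⟨m, hm⟩) (t '' {i | (i : ℕ) < m}) := by
        rw [← Set.image_insert_eq]
        congr 1
        ext i
        simp only [Set.mem_ofPred_eq, Set.mem_insert_iff, Fin.ext_iff]
        omega
      rw [e]
      refine (ih (by omega)).insert (h := h ⟨m, hm⟩) ?_ (h_self _) ?_
      · rintro _ ⟨i, -, rfl⟩; exact hcomm _ _
      · rintro _ ⟨i, hi, rfl⟩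
        refine h_ne _ _ fun hh => ?_
        subst hh
        simp at hi
  have := aux r le_rfl
  rwa [show {i : Fin r | (i : ℕ) < r} = Set.univ by ext i; simp, Set.image_univ] at this

end InvariantCochains

/-! ### Elements of cycles and homology -/

section ModuleComplexes

variable {R : Type} [Ring R] (L : CochainComplex (ModuleCat.{0} R) ℕ)

lemma iCycles_injective (q : ℕ) : Function.Injective (L.iCycles q) :=
  (ModuleCat.mono_iff_injective _).1 inferInstance

lemma homologyπ_surjective (q : ℕ) : Function.Surjective (L.homologyπ q) :=
  (ModuleCat.epi_iff_surjective _).1 inferInstance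

lemma d_iCycles_apply (q : ℕ) (z : L.cycles q) : L.d q (q + 1) (L.iCycles q z) = 0 := by
  rw [← ModuleCat.comp_apply, HomologicalComplex.iCycles_d]; rfl

lemma exists_iCycles_eq (q : ℕ) (x : L.X q) (hx : L.d q (q + 1) x = 0) :
    ∃ z : L.cycles q, L.iCycles q z = x := by
  let k : ModuleCat.of R R ⟶ L.X q := ModuleCat.ofHom (LinearMap.toSpanSingleton R (L.X q) x)
  have hk : k ≫ L.d q (q + 1) = 0 := by
    ext
    change L.d q (q + 1) ((1 : R) • x) = 0
    rw [one_smul, hx]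
  refine ⟨L.liftCycles k (q + 1) (by simp) hk (1 : R), ?_⟩
  rw [← ModuleCat.comp_apply, HomologicalComplex.liftCycles_i]
  exact one_smul R x

lemma homologyπ_eq_zero_iff (q : ℕ) (z : L.cycles q) :
    L.homologyπ q z = 0 ↔ ∃ w : L.X ((ComplexShape.up ℕ).prev q), L.toCycles _ q w = z := by
  have h : (ShortComplex.mk (L.toCycles ((ComplexShape.up ℕ).prev q) q) (L.homologyπ q)
      (by simp)).Exact :=
    ShortComplex.exact_of_g_is_cokernel _ (L.homologyIsCokernel _ q rfl)
  constructor
  · exact (ShortComplex.moduleCat_exact_iff _).1 h z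
  · rintro ⟨w, rfl⟩
    rw [← ModuleCat.comp_apply, HomologicalComplex.toCycles_comp_homologyπ]; rfl

lemma homologyπ_zero_eq_zero {z : L.cycles 0} (hz : L.homologyπ 0 z = 0) : L.iCycles 0 z = 0 := by
  obtain ⟨w, rfl⟩ := (homologyπ_eq_zero_iff L 0 z).1 hz
  rw [← ModuleCat.comp_apply, HomologicalComplex.toCycles_i, L.shape _ _ (by simp)]; rfl

lemma homologyπ_succ_eq_zero_iff (q : ℕ) (z : L.cycles (q + 1)) :
    L.homologyπ (q + 1) z = 0 ↔ ∃ w : L.X q, L.d q (q + 1) w = L.iCycles (q + 1) z := by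
  rw [homologyπ_eq_zero_iff, CochainComplex.prev_nat_succ]
  refine exists_congr fun w => ⟨?_, fun h => iCycles_injective L _ ?_⟩
  · rintro rfl
    rw [← ModuleCat.comp_apply, HomologicalComplex.toCycles_i]
  · rw [← h, ← ModuleCat.comp_apply, HomologicalComplex.toCycles_i]

end ModuleComplexes

/-! ### Čech cocycles as functions; the bound on top cohomology -/

section Cocycles

variable {K : Type} [Field K] [CharZero K] {G : Type} [Group G] {S : Type} [MulAction G S]

/-- The function on `S^(q+1)` underlying an invariant cochain. -/
def cochainFun {q : ℕ} : (cechSections K G S).X q →ₗ[K] ((Fin (q + 1) → S) → K) where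
  toFun x := (x.1 : altCochains K S q).1
  map_add' _ _ := rfl
  map_smul' _ _ := rfl

lemma cochainFun_injective {q : ℕ} :
    Function.Injective (cochainFun (K := K) (G := G) (S := S) (q := q)) :=
  fun _ _ h => Subtype.ext (Subtype.ext h)

lemma cochainFun_mem {q : ℕ} (x : (cechSections K G S).X q) :
    cochainFun x ∈ altCochains K S q := (x.1 : altCochains K S q).2

lemma cochainFun_smul {q : ℕ} (x : (cechSections K G S).X q) (u : G) (a : Fin (q + 1) → S) :
    cochainFun x (u • a) = cochainFun x a := by
  have h : (((cechObj K G S q).ρ u⁻¹).hom x.1 : altCochains K S q) = x.1 := x.2 u⁻¹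
  have h' : (x.1 : altCochains K S q).1 ((u⁻¹)⁻¹ • a) = (x.1 : altCochains K S q).1 a :=
    congrFun (congrArg Subtype.val h) a
  rwa [inv_inv] at h'

lemma exists_cochainFun_eq {q : ℕ} {f : (Fin (q + 1) → S) → K} (hf : f ∈ altCochains K S q)
    (hinv : ∀ (u : G) a, f (u • a) = f a) :
    ∃ x : (cechSections K G S).X q, cochainFun x = f := by
  let x : altCochains K S q := ⟨f, hf⟩
  have hx : ∀ u : G, (((cechObj K G S q).ρ u).hom x : altCochains K S q) = x := fun u =>
    Subtype.ext (funext fun a => hinv u⁻¹ a)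
  exact ⟨⟨x, hx⟩, rfl⟩

lemma cochainFun_d {q : ℕ} (x : (cechSections K G S).X q) :
    cochainFun ((cechSections K G S).d q (q + 1) x) = altDiff (cochainFun x) :=
  cechComplex_d_apply K G S q x.1

/-- The function on `S^(q+1)` underlying a cocycle. -/
def cocycleFun {q : ℕ} : (cechSections K G S).cycles q →ₗ[K] ((Fin (q + 1) → S) → K) :=
  cochainFun ∘ₗ ((cechSections K G S).iCycles q).hom

lemma altDiff_cocycleFun {q : ℕ} (z : (cechSections K G S).cycles q) :
    altDiff (cocycleFun z) = 0 := by
  refine (cochainFun_d _).symm.trans ?_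
  exact (congrArg cochainFun (d_iCycles_apply _ q z)).trans (map_zero _)

lemma exists_cocycleFun_eq {q : ℕ} {f : (Fin (q + 1) → S) → K} (hf : f ∈ altCochains K S q)
    (hinv : ∀ (u : G) a, f (u • a) = f a) (hd : altDiff f = 0) :
    ∃ z : (cechSections K G S).cycles q, cocycleFun z = f := by
  obtain ⟨x, rfl⟩ := exists_cochainFun_eq hf hinv
  obtain ⟨z, hz⟩ := exists_iCycles_eq (cechSections K G S) q x
    (cochainFun_injective ((cochainFun_d x).trans (hd.trans (map_zero _).symm)))
  exact ⟨z, congrArg cochainFun hz⟩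

lemma cocycleFun_eq_zero_of_homologyπ {z : (cechSections K G S).cycles 0}
    (hz : (cechSections K G S).homologyπ 0 z = 0) : cocycleFun z = 0 :=
  (congrArg cochainFun (homologyπ_zero_eq_zero _ hz)).trans (map_zero _)

lemma homologyπ_eq_zero_iff_exists {q : ℕ} {z : (cechSections K G S).cycles (q + 1)} :
    (cechSections K G S).homologyπ (q + 1) z = 0 ↔
      ∃ θ ∈ altCochains K S q, (∀ (u : G) a, θ (u • a) = θ a) ∧ cocycleFun z = altDiff θ := by
  rw [homologyπ_succ_eq_zero_iff]
  constructor
  · rintro ⟨w, hw⟩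
    exact ⟨cochainFun w, cochainFun_mem w, cochainFun_smul w,
      (congrArg cochainFun hw).symm.trans (cochainFun_d w)⟩
  · rintro ⟨θ, hθ, hinv, h⟩
    obtain ⟨w, rfl⟩ := exists_cochainFun_eq hθ hinv
    exact ⟨w, cochainFun_injective ((cochainFun_d w).trans h.symm)⟩

variable (K) in
/-- The top cohomology of a free action of a free abelian group of rank at most `m`. -/
theorem exists_homology_generator (hfree : ∀ (u : G) (s : S), u • s = s → u = 1) (s₀ : S) {r : ℕ}
    (b : Fin r → G) (hcomm : ∀ i j, Commute (b i) (b j)) (hb : Subgroup.closure (Set.range b) = ⊤)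
    (χ : Fin r → G →* Multiplicative ℤ)
    (hχ : ∀ i j, χ i (b j) = Multiplicative.ofAdd (if i = j then 1 else 0)) {m : ℕ} (hm : r ≤ m) :
    ∃ z₀ : (cechSections K G S).cycles m, ∀ z, ∃ c : K,
      (cechSections K G S).homologyπ m z = c • (cechSections K G S).homologyπ m z₀ := by
  obtain ⟨ν, hν⟩ := exists_equivariant_map hfree
  let t : Fin r → Equiv.Perm S := fun i => MulAction.toPermHom G S (b i)
  -- The i-th coordinate of `ν s`: acting by `b i` raises it by one, and acting by the other basis
  -- elements leaves it fixed.
  let h : Fin r → S → ℤ := fun i s => (χ i (ν s)).toAdd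
  have hb' : CohomologyBound K (Set.range t) r := by
    refine cohomologyBound_range t (fun i j => (hcomm i j).map _) h (fun i s => ?_)
      (fun i j hij s => ?_) s₀
    · change (χ i (ν (b i • s))).toAdd = _
      rw [hν, map_mul, hχ, toAdd_mul]
      simp [h, add_comm]
    · change (χ i (ν (b j • s))).toAdd = _
      rw [hν, map_mul, hχ, toAdd_mul]
      simp [h, hij]
  have hinv : ∀ {q} {f : (Fin (q + 1) → S) → K}, f ∈ invCochains K (Set.range t) q →
      ∀ (u : G) a, f (u • a) = f a := by
    intro q f hf u
    have hu : u ∈ Subgroup.closure (Set.range b) := hb ▸ Subgroup.mem_top u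
    induction hu using Subgroup.closure_induction with
    | mem x hx =>
      obtain ⟨i, rfl⟩ := hx
      exact hf.2 (t i) ⟨i, rfl⟩
    | one => simp
    | mul x y _ _ hx hy => intro a; rw [mul_smul, hx, hy]
    | inv x _ hx => intro a; rw [← hx (x⁻¹ • a), smul_inv_smul]
  have hcyc : ∀ {q} (z : (cechSections K G S).cycles q),
      cocycleFun z ∈ invCocycles K (Set.range t) q := fun {q} z =>
    ⟨⟨cochainFun_mem _, by rintro _ ⟨i, rfl⟩; exact cochainFun_smul _ (b i)⟩, altDiff_cocycleFun z⟩
  have hcob : ∀ {q} (z : (cechSections K G S).cycles q),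
      cocycleFun z ∈ invCoboundaries K (Set.range t) q →
      (cechSections K G S).homologyπ q z = 0 := by
    intro q z hz
    cases q with
    | zero =>
      have : z = 0 := iCycles_injective _ _ (cochainFun_injective (by
        rw [map_zero, map_zero]; exact hz))
      rw [this, map_zero]
    | succ q =>
      obtain ⟨θ, hθ, h⟩ := hz
      exact homologyπ_eq_zero_iff_exists.2 ⟨θ, hθ.1, hinv hθ, h.symm⟩
  have hspan : ∃ f ∈ invCocycles K (Set.range t) m,
      invCocycles K (Set.range t) m ≤ Submodule.span K {f} ⊔ invCoboundaries K (Set.range t) m := by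
    -- For r < m the cohomology in degree m vanishes and 0 serves as generator. An upper bound on
    -- the rank is therefore enough.
    rcases hm.eq_or_lt with rfl | hm
    · exact hb'.2
    · exact ⟨0, zero_mem _, (hb'.1 m hm).trans le_sup_right⟩
  obtain ⟨f, hf, hf'⟩ := hspan
  obtain ⟨z₀, rfl⟩ := exists_cocycleFun_eq hf.1.1 (hinv hf.1) hf.2
  refine ⟨z₀, fun z => ?_⟩
  obtain ⟨y, hy, w, hw, hyw⟩ := Submodule.mem_sup.1 (hf' (hcyc z))
  obtain ⟨c, rfl⟩ := Submodule.mem_span_singleton.1 hy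
  refine ⟨c, ?_⟩
  rw [← map_smul, ← sub_eq_zero, ← map_sub]
  refine hcob _ ?_
  rw [map_sub, map_smul, ← hyw, add_sub_cancel_left]
  exact hw

end Cocycles

/-! ### Units: finiteness and rank -/

section Arithmetic

open NumberField

variable {F : Type} [Field F]

/-- The only positive real root of unity is 1. -/
lemma eq_one_of_pow_eq_one (τ : F →+* ℝ) {u : (𝓞 F)ˣ} (hu : u ∈ totallyPositiveUnits F) {k : ℕ}
    (hk : k ≠ 0) (h : u ^ k = 1) : u = 1 := by
  have h1 : τ (u : F) ^ k = 1 := by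
    rw [← map_pow]
    have : (u : F) ^ k = 1 := by
      simpa using congrArg (fun v : (𝓞 F)ˣ => (v : F)) h
    rw [this, map_one]
  have h2 : τ (u : F) = 1 := (pow_eq_one_iff_of_nonneg (hu τ).le hk).1 h1
  have h3 : (u : F) = 1 := τ.injective (h2.trans (map_one τ).symm)
  exact Units.ext (RingOfIntegers.ext (by simpa using h3))

lemma primitiveSet_ne_zero (ξ : AddChar (𝓞 F) ℂ) (τ : F →+* ℝ) (s : PrimitiveSet ξ) : s.1 ≠ 0 := by
  intro h
  have := s.2.1.1 τ
  simp [h] at this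

lemma stabilizer_free (ξ : AddChar (𝓞 F) ℂ) (τ : F →+* ℝ) (u : stabilizer ξ) (s : PrimitiveSet ξ)
    (h : u • s = s) : u = 1 := by
  have h1 : ((u : (𝓞 F)ˣ) : 𝓞 F) * s.1 = s.1 := congrArg Subtype.val h
  have h2 : ((u : (𝓞 F)ˣ) : 𝓞 F) = 1 :=
    mul_right_cancel₀ (primitiveSet_ne_zero ξ τ s) (h1.trans (one_mul _).symm)
  exact Subtype.ext (Units.ext h2)

lemma exists_real_embedding [NumberField.IsTotallyReal F] (φ : F →+* ℂ) : ∃ τ : F →+* ℝ, ∀ x, φ x = (τ x : ℂ) :=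
  ⟨(IsTotallyReal.complexEmbedding_isReal φ).embedding, fun x =>
    (ComplexEmbedding.IsReal.coe_embedding_apply _ x).symm⟩

variable [NumberField F]

/-- Finitely many vectors of the open orthant have comparable coordinates, and the same constant
works on the cone they generate. -/
lemma exists_ratio_bound {ι : Type} [Finite ι] {b : ι → 𝓞 F} (hb : ∀ i, TotallyPositive (b i : F)) :
    ∃ R : ℝ, 0 < R ∧ ∀ i (τ τ' : F →+* ℝ), τ (b i) ≤ R * τ' (b i) := by
  obtain ⟨R, hR⟩ := (Set.finite_range fun x : ι × (F →+* ℝ) × (F →+* ℝ) =>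
    x.2.1 (b x.1 : F) / x.2.2 (b x.1 : F)).bddAbove
  refine ⟨max R 1, by positivity, fun i τ τ' => ?_⟩
  rw [← div_le_iff₀ (hb i τ')]
  exact (hR ⟨(i, τ, τ'), rfl⟩).trans (le_max_left _ _)

/-- If ξ^N = 1, then ξ factors through the finite ring 𝓞 F / N, and totally positive units congruent
modulo N act on ξ in the same way. -/
lemma finite_quotient_stabilizer {ξ : AddChar (𝓞 F) ℂ} (htors : IsOfFinOrder ξ) :
    ∃ (Q : Type) (_ : Finite Q) (π : (𝓞 F)ˣ → Q), ∀ u ∈ totallyPositiveUnits F,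
      ∀ v ∈ totallyPositiveUnits F, π u = π v → v * u⁻¹ ∈ stabilizer ξ := by
  obtain ⟨N, hN, hξ⟩ := isOfFinOrder_iff_pow_eq_one.1 htors
  have hne : Ideal.span {(N : 𝓞 F)} ≠ ⊥ := by
    rw [Ne, Ideal.span_singleton_eq_bot]
    exact_mod_cast hN.ne'
  refine ⟨𝓞 F ⧸ Ideal.span {(N : 𝓞 F)}, Ideal.finiteQuotientOfFreeOfNeBot _ hne,
    fun u => Ideal.Quotient.mk _ (u : 𝓞 F), fun u hu v hv huv => ⟨mul_mem hv (inv_mem hu), fun x => ?_⟩⟩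
  have hN' : ∀ y : 𝓞 F, ξ ((N : 𝓞 F) * y) = 1 := fun y => by
    rw [← nsmul_eq_mul, AddChar.map_nsmul_eq_pow]
    have := DFunLike.congr_fun hξ y
    simpa using this
  rw [eq_comm, Ideal.Quotient.eq, Ideal.mem_span_singleton] at huv
  obtain ⟨y, hy⟩ := huv
  have e : ((v * u⁻¹ : (𝓞 F)ˣ) : 𝓞 F) * x =
      x + (N : 𝓞 F) * (y * ((u⁻¹ : (𝓞 F)ˣ) : 𝓞 F) * x) := by
    rw [← mul_assoc, ← mul_assoc, ← hy, Units.val_mul, sub_mul, sub_mul, Units.mul_inv]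
    ring
  rw [e, AddChar.map_add_eq_mul, hN', mul_one]

/-- A cone is a unit multiple of one of finitely many representatives; the representative and the
residue of the unit determine the Δ_ξ-orbit. -/
theorem finite_coneOrbits {ξ : AddChar (𝓞 F) ℂ} (htors : IsOfFinOrder ξ) {Γ : Subgroup (𝓞 F)ˣ}
    (hΓ' : Γ ≤ totallyPositiveUnits F) {Φ : Set (Set (RealSpace F))}
    (hΦ : IsShintaniDecomposition Γ Φ) (m : ℕ) : Finite (ConeOrbits ξ Φ m) := by
  obtain ⟨Q, _, π, hπ⟩ := finite_quotient_stabilizer htors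
  obtain ⟨T, -, hTfin, hT⟩ := hΦ.finite_orbits
  have := hTfin.to_subtype
  choose ρ hρ u hu hσ using fun c : ConeOrbits ξ Φ m => hT _ c.out.2.1
  refine Finite.of_injective (fun c => ((⟨ρ c, hρ c⟩, π (u c)) : T × Q)) fun c c' h => ?_
  simp only [Prod.mk.injEq, Subtype.mk.injEq] at h
  rw [← Quotient.out_eq c, ← Quotient.out_eq c']
  refine Quotient.sound ⟨_, hπ _ (hΓ' (hu c)) _ (hΓ' (hu c')) h.2, ?_⟩
  rw [← hσ c, ← hσ c', ← unitScale_mul, inv_mul_cancel_right, h.1]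

variable [NumberField.IsTotallyReal F]

/-- The stabilizer of a character is free abelian of rank at most `[F : ℚ] - 1`. -/
lemma exists_stabilizer_basis (ξ : AddChar (𝓞 F) ℂ) {n : ℕ} (hn : Module.finrank ℚ F = n + 1)
    (τ : F →+* ℝ) :
    ∃ (r : ℕ) (b : Fin r → stabilizer ξ) (χ : Fin r → stabilizer ξ →* Multiplicative ℤ), r ≤ n ∧
      Subgroup.closure (Set.range b) = ⊤ ∧
      ∀ i j, χ i (b j) = Multiplicative.ofAdd (if i = j then 1 else 0) := by
  let G := stabilizer ξ
  let ι : Additive G →ₗ[ℤ] Additive (𝓞 F)ˣ := (MonoidHom.toAdditive G.subtype).toIntLinearMap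
  have hι : Function.Injective ι := fun x y h => by
    apply Additive.toMul.injective
    exact G.subtype_injective (Additive.ofMul.injective h)
  have hfin : Module.Finite ℤ (Additive G) := Module.Finite.of_injective ι hι
  have htf : Module.IsTorsionFree ℤ (Additive G) := by
    refine Module.IsTorsionFree.of_smul_eq_zero fun k x hkx => ?_
    by_contra hcon
    push Not at hcon
    have h1 : x.toMul ^ k = 1 := hkx
    have h2 : x.toMul ^ k.natAbs = 1 := by
      rcases Int.natAbs_eq k with h | h
      · rw [h] at h1; simpa using h1
      · rw [h] at h1; simpa using h1
    have h3 : x.toMul = 1 := Subtype.ext (eq_one_of_pow_eq_one τ x.toMul.2.1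
      (Int.natAbs_ne_zero.2 hcon.1) (congrArg Subtype.val h2))
    exact hcon.2 h3
  have hfree : Module.Free ℤ (Additive G) := inferInstance
  let B := Module.finBasis ℤ (Additive G)
  refine ⟨Module.finrank ℤ (Additive G), fun i => (B i).toMul,
    fun i => AddMonoidHom.toMultiplicativeRight (B.coord i).toAddMonoidHom, ?_, ?_, fun i j => ?_⟩
  -- Dirichlet's unit theorem: without complex places the unit rank is [F : ℚ] - 1.
  · have h1 := LinearMap.finrank_le_finrank_of_injective hι
    rw [Units.finrank_eq, Units.rank, InfinitePlace.card_eq_nrRealPlaces_add_nrComplexPlaces,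
      IsTotallyReal.nrComplexPlaces_eq_zero, add_zero, ← IsTotallyReal.finrank, hn] at h1
    simpa using h1
  · rw [eq_top_iff]
    intro u _
    have hu := B.mem_span (Additive.ofMul u)
    have : ∀ x : Additive G, x ∈ Submodule.span ℤ (Set.range B) →
        x.toMul ∈ Subgroup.closure (Set.range fun i => (B i).toMul) := fun x hx => by
      induction hx using Submodule.span_induction with
      | mem x hx =>
        obtain ⟨i, rfl⟩ := hx
        exact Subgroup.subset_closure ⟨i, rfl⟩
      | zero => exact one_mem _
      | add x y _ _ hx hy => exact mul_mem hx hy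
      | smul k x _ hx => exact Subgroup.zpow_mem _ hx k
    exact this _ hu
  · change Multiplicative.ofAdd (B.coord i (B j)) = _
    rw [Module.Basis.coord_apply, Module.Basis.repr_self, Finsupp.single_apply]
    simp only [eq_comm]

/-- Otherwise all absolute values of the nonzero integer u⁻¹ would be less than 1. -/
lemma exists_embedding_le_one (u : (𝓞 F)ˣ) : ∃ τ : F →+* ℝ, τ (u : F) ≤ 1 := by
  by_contra! hcon
  have h : ∀ w : InfinitePlace F, w ((u⁻¹ : (𝓞 F)ˣ) : F) < 1 := fun w => by
    obtain ⟨τ, hτ⟩ := exists_real_embedding w.embedding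
    have h0 := hcon τ
    have hw : w ((u⁻¹ : (𝓞 F)ˣ) : F) = ‖w.embedding ((u⁻¹ : (𝓞 F)ˣ) : F)‖ :=
      (InfinitePlace.norm_embedding_eq w _).symm
    rw [hw, hτ, Complex.norm_real, Real.norm_eq_abs]
    have : τ ((u⁻¹ : (𝓞 F)ˣ) : F) = (τ (u : F))⁻¹ := by simp
    rw [this, abs_inv]
    exact inv_lt_one_of_one_lt₀ (lt_of_lt_of_le h0 (le_abs_self _))
  obtain ⟨w⟩ := (inferInstance : Nonempty (InfinitePlace F))
  have := InfinitePlace.one_le_of_lt_one (w := w) (a := ((u⁻¹ : (𝓞 F)ˣ) : 𝓞 F))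
    (Units.ne_zero _) (fun z _ => h z)
  exact absurd (h w) (not_lt.2 this)

/-- All conjugates are real and positive, so they are bounded in absolute value, and a number field
has only finitely many such integers. -/
lemma finite_units_of_le (R : ℝ) :
    {u : (𝓞 F)ˣ | u ∈ totallyPositiveUnits F ∧ ∀ τ : F →+* ℝ, τ (u : F) ≤ R}.Finite := by
  have h := Embeddings.finite_of_norm_le F ℂ R
  refine Set.Finite.of_finite_image (f := fun u : (𝓞 F)ˣ => (u : F)) (h.subset ?_) ?_
  · rintro _ ⟨u, ⟨hu, hR⟩, rfl⟩
    refine ⟨RingOfIntegers.isIntegral_coe _, fun φ => ?_⟩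
    obtain ⟨τ, hτ⟩ := exists_real_embedding φ
    rw [hτ, Complex.norm_real, Real.norm_eq_abs, abs_of_pos (hu τ)]
    exact hR τ
  · intro u _ v _ h
    exact Units.ext (RingOfIntegers.ext h)

/-- Only finitely many translates of a cone meet a given box in the open positive orthant. -/
lemma finite_units_meeting {ι : Type} [Fintype ι] {b : ι → 𝓞 F} (hb : ∀ i, TotallyPositive (b i : F))
    {lo hi : ℝ} (hlo : 0 < lo) :
    {u : (𝓞 F)ˣ | u ∈ totallyPositiveUnits F ∧ ∃ p ∈ generatedCone b,
      ∀ τ : F →+* ℝ, lo ≤ τ (u : F) * p τ ∧ τ (u : F) * p τ ≤ hi}.Finite := by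
  obtain ⟨R, hR, hbR⟩ := exists_ratio_bound hb
  refine (finite_units_of_le (hi / lo * R)).subset ?_
  rintro u ⟨hu, p, ⟨x, hx, rfl⟩, hp⟩
  refine ⟨hu, fun τ => ?_⟩
  -- Where `u` is at most 1, the lower bound of the box is one for `p` itself. Comparability of
  -- coordinates spreads it, up to `R`, to every embedding, and the upper bound of the box then
  -- bounds `u`.
  obtain ⟨τ', hτ'⟩ := exists_embedding_le_one u
  set p := ∑ i, x i • realEmbedding (b i : F) with hpdef
  have hpR : p τ' ≤ R * p τ := by
    simp only [hpdef, Finset.sum_apply, Pi.smul_apply, smul_eq_mul, realEmbedding, Finset.mul_sum]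
    refine Finset.sum_le_sum fun i _ => ?_
    calc x i * τ' (b i) ≤ x i * (R * τ (b i)) := mul_le_mul_of_nonneg_left (hbR i _ _) (hx i)
      _ = _ := by ring
  have h1 := hp τ
  have h2 := hp τ'
  have hpτ : 0 < p τ := pos_of_mul_pos_right (hlo.trans_le h1.1) (hu τ).le
  have hpτ' : 0 < p τ' := pos_of_mul_pos_right (hlo.trans_le h2.1) (hu τ').le
  have hlo' : lo ≤ R * p τ := h2.1.trans
    ((mul_le_of_le_one_left hpτ'.le hτ').trans hpR)
  rw [div_mul_eq_mul_div, le_div_iff₀ hlo]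
  calc τ (u : F) * lo ≤ τ (u : F) * (R * p τ) := mul_le_mul_of_nonneg_left hlo' (hu τ).le
    _ = (τ (u : F) * p τ) * R := by ring
    _ ≤ hi * R := mul_le_mul_of_nonneg_right h1.2 hR.le

end Arithmetic

/-! ### Simplicial cones in a real vector space -/

section Cones

variable {E : Type*} [AddCommGroup E] [Module ℝ E]

/-- The closed cone generated by a finite family of vectors. -/
def vectorCone {ι : Type*} [Fintype ι] (v : ι → E) : Set E :=
  {w | ∃ x : ι → ℝ, (∀ i, 0 ≤ x i) ∧ w = ∑ i, x i • v i}

variable {ι κ : Type*} [Fintype ι] [Fintype κ]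

lemma mem_vectorCone_self (v : ι → E) (i : ι) : v i ∈ vectorCone v := by
  classical
  refine ⟨Pi.single i 1, fun j => ?_, ?_⟩
  · rcases eq_or_ne j i with rfl | h <;> simp [*]
  · simp [Pi.single_apply]

lemma vectorCone_comp_equiv (v : ι → E) (e : κ ≃ ι) : vectorCone (v ∘ e) = vectorCone v := by
  ext w
  constructor
  · rintro ⟨x, hx, rfl⟩
    exact ⟨x ∘ e.symm, fun i => hx _, (Equiv.sum_comp e.symm fun j => x j • v (e j)).symm.trans
      (by simp)⟩
  · rintro ⟨x, hx, rfl⟩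
    exact ⟨x ∘ e, fun i => hx _, (Equiv.sum_comp e fun i => x i • v i).symm⟩

lemma vectorCone_image (v : ι → E) (L : E →ₗ[ℝ] E) : L '' vectorCone v = vectorCone (L ∘ v) := by
  ext w
  constructor
  · rintro ⟨_, ⟨x, hx, rfl⟩, rfl⟩
    exact ⟨x, hx, by simp⟩
  · rintro ⟨x, hx, rfl⟩
    exact ⟨_, ⟨x, hx, rfl⟩, by simp⟩

lemma span_vectorCone (v : ι → E) :
    Submodule.span ℝ (vectorCone v) = Submodule.span ℝ (Set.range v) := by
  refine le_antisymm (Submodule.span_le.2 ?_) (Submodule.span_mono ?_)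
  · rintro _ ⟨x, -, rfl⟩
    exact Submodule.sum_mem _ fun i _ => Submodule.smul_mem _ _ (Submodule.subset_span ⟨i, rfl⟩)
  · rintro _ ⟨i, rfl⟩
    exact mem_vectorCone_self v i

lemma coeff_eq_of_linearIndependent {v : ι → E} (hv : LinearIndependent ℝ v) {x y : ι → ℝ}
    (h : ∑ i, x i • v i = ∑ i, y i • v i) : x = y := by
  have h0 : ∑ i, (x i - y i) • v i = 0 := by
    simp only [sub_smul, Finset.sum_sub_distrib, h, sub_self]
  funext i
  exact sub_eq_zero.1 (Fintype.linearIndependent_iff.1 hv _ h0 i)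

/-- The generators of a simplicial cone are determined up to scaling. -/
lemma exists_smul_of_vectorCone_eq {v : ι → E} {w : κ → E} (hv : LinearIndependent ℝ v)
    (hw : ∀ k, w k ≠ 0) (h : vectorCone v = vectorCone w) (i : ι) :
    ∃ k, ∃ c : ℝ, 0 < c ∧ v i = c • w k := by
  classical
  obtain ⟨x, hx, hxi⟩ : v i ∈ vectorCone w := h ▸ mem_vectorCone_self v i
  have hw' : ∀ k, ∃ y : ι → ℝ, (∀ l, 0 ≤ y l) ∧ w k = ∑ l, y l • v l := fun k =>
    h.ge (mem_vectorCone_self w k)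
  choose y hy hyw using hw'
  have hvi : v i ≠ 0 := hv.ne_zero i
  have hsum : ∑ l, (∑ k, x k * y k l) • v l = ∑ l, (Pi.single i (1 : ℝ) : ι → ℝ) l • v l := by
    have e : ∑ l, (Pi.single i (1 : ℝ) : ι → ℝ) l • v l = v i := by
      simp [Pi.single_apply]
    rw [e, hxi]
    simp only [Finset.sum_smul, mul_smul]
    rw [Finset.sum_comm]
    refine Finset.sum_congr rfl fun k _ => ?_
    rw [← Finset.smul_sum, ← hyw]
  have hcoef := coeff_eq_of_linearIndependent hv hsum
  -- Extremality of the ray: the coefficients of `v i` along the other generators are sums of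
  -- nonnegative terms, so each term is zero. Any `w k` with `x k ≠ 0` then lies on the ray of `v
  -- i`.
  have hzero : ∀ k l, l ≠ i → x k * y k l = 0 := fun k l hl => by
    have h1 : ∑ k, x k * y k l = 0 := by
      have := congrFun hcoef l
      simpa [hl] using this
    exact (Finset.sum_eq_zero_iff_of_nonneg fun k _ => mul_nonneg (hx k) (hy k l)).1 h1 k
      (Finset.mem_univ k)
  obtain ⟨k, hk⟩ : ∃ k, x k ≠ 0 := by
    by_contra! hcon
    exact hvi (by simp [hxi, hcon])
  have hwk : w k = y k i • v i := by
    conv_lhs => rw [hyw k]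
    refine Finset.sum_eq_single i (fun l _ hl => ?_) (by simp)
    rw [(mul_eq_zero.1 (hzero k l hl)).resolve_left hk, zero_smul]
  have hpos : 0 < y k i := (hy k i).lt_of_ne fun h0 => hw k (by rw [hwk, ← h0, zero_smul])
  exact ⟨k, (y k i)⁻¹, inv_pos.2 hpos, by rw [hwk, smul_smul, inv_mul_cancel₀ hpos.ne', one_smul]⟩

/-- A face of a cone that contains the sum of the generators is the whole cone. -/
lemma subset_of_sum_mem_face {v : ι → E} {w : κ → E} (hw : LinearIndependent ℝ w)
    (h : vectorCone v = vectorCone w) (s : Finset κ)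
    (hs : ∑ i, v i ∈ vectorCone fun k : s => w k) : vectorCone v ⊆ vectorCone fun k : s => w k := by
  classical
  have hv' : ∀ i, ∃ y : κ → ℝ, (∀ l, 0 ≤ y l) ∧ v i = ∑ l, y l • w l := fun i =>
    h.le (mem_vectorCone_self v i)
  choose y hy hyv using hv'
  obtain ⟨x, hx, hxs⟩ := hs
  have e1 : ∑ k : s, x k • w k = ∑ k, (if hk : k ∈ s then x ⟨k, hk⟩ else 0) • w k := by
    rw [← Finset.sum_subset (Finset.subset_univ s) fun k _ hk => by simp [hk],
      ← Finset.sum_coe_sort s]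
    exact Finset.sum_congr rfl fun k _ => by simp
  have e2 : ∑ i, v i = ∑ k, (∑ i, y i k) • w k := by
    simp only [Finset.sum_smul]
    rw [Finset.sum_comm]
    exact Finset.sum_congr rfl fun i _ => hyv i
  have hcoef := coeff_eq_of_linearIndependent hw (e2.symm.trans (hxs.trans e1))
  -- Outside `s` the coordinate of the sum of the generators is zero, and it is a sum of nonnegative
  -- coordinates.
  have hzero : ∀ i k, k ∉ s → y i k = 0 := fun i k hk => by
    have h1 : ∑ i, y i k = 0 := by simpa [hk] using congrFun hcoef k
    exact (Finset.sum_eq_zero_iff_of_nonneg fun i _ => hy i k).1 h1 i (Finset.mem_univ i)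
  rintro _ ⟨c, hc, rfl⟩
  refine ⟨fun k => ∑ i, c i * y i k, fun k => Finset.sum_nonneg fun i _ =>
    mul_nonneg (hc i) (hy i k), ?_⟩
  simp only [Finset.sum_smul, mul_smul]
  rw [Finset.sum_comm]
  refine Finset.sum_congr rfl fun i _ => ?_
  rw [← Finset.smul_sum, Finset.sum_coe_sort s fun k => y i k • w k,
    Finset.sum_subset (Finset.subset_univ s) fun k _ hk => by simp [hzero i k hk], ← hyv]

/-- The generators form a basis, and positivity of all coordinates is an open condition. -/
lemma mem_interior_vectorCone [TopologicalSpace E] [IsTopologicalAddGroup E]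
    [ContinuousSMul ℝ E] [T2Space E] [FiniteDimensional ℝ E] {v : ι → E}
    (hv : LinearIndependent ℝ v) (hcard : Fintype.card ι = Module.finrank ℝ E)
    {x : ι → ℝ} (hx : ∀ i, 0 < x i) : ∑ i, x i • v i ∈ interior (vectorCone v) := by
  let b : Module.Basis ι ℝ E := Module.Basis.mk hv
    (hv.span_eq_top_of_card_eq_finrank' hcard).ge
  have hb : ∀ i, b i = v i := fun i => Module.Basis.mk_apply _ _ i
  rw [mem_interior]
  refine ⟨⋂ i, {w | 0 < b.coord i w}, fun w hw => ?_, ?_, ?_⟩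
  · rw [Set.mem_iInter] at hw
    refine ⟨fun i => b.coord i w, fun i => (hw i).le, ?_⟩
    conv_lhs => rw [← b.sum_repr w]
    simp [hb]
  · refine isOpen_iInter_of_finite fun i => isOpen_lt continuous_const ?_
    exact LinearMap.continuous_of_finiteDimensional (b.coord i)
  · rw [Set.mem_iInter]
    intro i
    change 0 < b.repr (∑ i, x i • v i) i
    have : ∑ i, x i • v i = ∑ i, x i • b i := by simp [hb]
    rw [this, b.repr_sum_self]
    exact hx i

lemma isClosed_vectorCone [TopologicalSpace E] [IsTopologicalAddGroup E]
    [ContinuousSMul ℝ E] [T2Space E] [FiniteDimensional ℝ E] {v : ι → E}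
    (hv : LinearIndependent ℝ v) : IsClosed (vectorCone v) := by
  have hL : Topology.IsClosedEmbedding (Fintype.linearCombination ℝ v) :=
    LinearMap.isClosedEmbedding_of_injective (LinearMap.ker_eq_bot.2
      hv.fintypeLinearCombination_injective)
  have e : vectorCone v = Fintype.linearCombination ℝ v '' {x | ∀ i, 0 ≤ x i} := by
    ext w
    constructor
    · rintro ⟨x, hx, rfl⟩
      exact ⟨x, hx, by simp [Fintype.linearCombination_apply]⟩
    · rintro ⟨x, hx, rfl⟩
      exact ⟨x, hx, by simp [Fintype.linearCombination_apply]⟩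
  rw [e]
  refine hL.isClosedMap _ ?_
  have : {x : ι → ℝ | ∀ i, 0 ≤ x i} = ⋂ i, {x | 0 ≤ x i} := by ext; simp
  rw [this]
  exact isClosed_iInter fun i => isClosed_le continuous_const (continuous_apply i)

end Cones

/-! ### Orientation and multiplication by units -/

section Determinant

open NumberField

variable {F : Type} [Field F] {n : ℕ} (τ : Fin n ≃ (F →+* ℝ))

/-- The standard basis of `ℝ^I` for a numbering of `I`. -/
def spaceBasis : Module.Basis (Fin n) ℝ (RealSpace F) :=
  Module.Basis.ofEquivFun (LinearEquiv.funCongrLeft ℝ ℝ τ)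

lemma spaceBasis_det_apply (v : Fin n → RealSpace F) :
    (spaceBasis τ).det v = Matrix.det (Matrix.of fun i j => v j (τ i)) := by
  rw [Module.Basis.det_apply]
  congr 1

lemma orientation_eq (a : Fin n → 𝓞 F) :
    orientation τ a = SignType.sign ((spaceBasis τ).det fun j => realEmbedding (a j : F)) := by
  rw [orientation, spaceBasis_det_apply]
  rfl

lemma det_ne_zero_iff (v : Fin n → RealSpace F) :
    (spaceBasis τ).det v ≠ 0 ↔ LinearIndependent ℝ v := by
  rw [← isUnit_iff_ne_zero, ← Module.Basis.is_basis_iff_det]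
  refine ⟨fun h => h.1, fun h => ⟨h, ?_⟩⟩
  have : FiniteDimensional ℝ (RealSpace F) := (spaceBasis τ).finiteDimensional_of_finite
  exact h.span_eq_top_of_card_eq_finrank' (Module.finrank_eq_card_basis (spaceBasis τ)).symm

/-- Cramer's rule; it converts the sign of a coordinate into a comparison of orientations. -/
lemma det_update_sum (v : Fin n → RealSpace F) (j : Fin n) (x : Fin n → ℝ) :
    (spaceBasis τ).det (Function.update v j (∑ i, x i • v i)) = x j * (spaceBasis τ).det v := by
  rw [AlternatingMap.map_update_sum]
  rw [Finset.sum_eq_single j]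
  · rw [AlternatingMap.map_update_smul, Function.update_eq_self, smul_eq_mul]
  · intro i _ hij
    rw [AlternatingMap.map_update_smul, AlternatingMap.map_update_self _ _ hij.symm, smul_zero]
  · simp

/-- Multiplication by a unit on `ℝ^I`. -/
def unitMul (u : (𝓞 F)ˣ) : RealSpace F →ₗ[ℝ] RealSpace F where
  toFun v τ := τ (u : F) * v τ
  map_add' v w := by funext τ; simp [mul_add]
  map_smul' c v := by funext τ; simp [mul_left_comm]

lemma unitMul_apply (u : (𝓞 F)ˣ) (v : RealSpace F) (σ : F →+* ℝ) :
    unitMul u v σ = σ (u : F) * v σ := rfl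

lemma unitScale_eq_image (u : (𝓞 F)ˣ) (σ : Set (RealSpace F)) : unitScale u σ = unitMul u '' σ :=
  rfl

lemma unitMul_realEmbedding (u : (𝓞 F)ˣ) (x : 𝓞 F) :
    unitMul u (realEmbedding (x : F)) = realEmbedding (((u : 𝓞 F) * x : 𝓞 F) : F) := by
  funext σ
  simp [unitMul_apply, realEmbedding]

lemma unitMul_mul (u v : (𝓞 F)ˣ) (w : RealSpace F) :
    unitMul (u * v) w = unitMul u (unitMul v w) := by
  funext σ
  simp [unitMul_apply, mul_assoc]

lemma unitMul_one (w : RealSpace F) : unitMul 1 w = w := by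
  funext σ
  simp [unitMul_apply]

lemma unitMul_inv_cancel (u : (𝓞 F)ˣ) (w : RealSpace F) : unitMul u⁻¹ (unitMul u w) = w := by
  rw [← unitMul_mul, inv_mul_cancel, unitMul_one]

lemma unitScale_generatedCone {ι : Type} [Fintype ι] (u : (𝓞 F)ˣ) (a : ι → 𝓞 F) :
    unitScale u (generatedCone a) = generatedCone fun i => (u : 𝓞 F) * a i := by
  refine (vectorCone_image (fun i => realEmbedding (a i : F)) (unitMul u)).trans ?_
  change vectorCone _ = vectorCone _
  congr 1
  funext i
  exact unitMul_realEmbedding u (a i)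

lemma det_unitMul (u : (𝓞 F)ˣ) (v : Fin n → RealSpace F) :
    (spaceBasis τ).det (fun j => unitMul u (v j)) =
      (∏ i, τ i (u : F)) * (spaceBasis τ).det v := by
  rw [spaceBasis_det_apply, spaceBasis_det_apply, ← Matrix.det_mul_column]
  rfl

lemma orientation_unit_mul {u : (𝓞 F)ˣ} (hu : u ∈ totallyPositiveUnits F) (a : Fin n → 𝓞 F) :
    orientation τ (fun i => (u : 𝓞 F) * a i) = orientation τ a := by
  rw [orientation_eq, orientation_eq]
  simp only [← unitMul_realEmbedding]
  rw [det_unitMul τ u fun j => realEmbedding (a j : F), sign_mul,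
    sign_pos (Finset.prod_pos fun i _ => hu (τ i)), one_mul]

lemma orientation_comp_perm (a : Fin n → 𝓞 F) (ρ : Equiv.Perm (Fin n)) :
    orientation τ (a ∘ ρ) = Equiv.Perm.sign ρ * orientation τ a := by
  rw [orientation_eq, orientation_eq]
  have h := (spaceBasis τ).det.map_perm (fun j => realEmbedding (a j : F)) ρ
  have e : (fun j => realEmbedding ((a ∘ ρ) j : F)) = (fun j => realEmbedding (a j : F)) ∘ ρ := rfl
  rw [e, h]
  rcases Int.units_eq_one_or (Equiv.Perm.sign ρ) with h1 | h1 <;> rw [h1] <;>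
    simp [Left.sign_neg]

end Determinant

/-! ### Primitive elements on a ray -/

section Primitive

open NumberField

variable {F : Type} [Field F]

/-- A Bézout relation r p + s d = 1 gives x = p (r x + s y), and this quotient is again totally
positive. -/
lemma IsPrimitiveElement.eq_one_of_coprime {x y : 𝓞 F} (hx : IsPrimitiveElement x)
    {p d : ℕ} (hp : 0 < p) (hpd : Nat.Coprime p d) (h : (d : 𝓞 F) * x = (p : 𝓞 F) * y) : p = 1 := by
  obtain ⟨r, s, hrs⟩ := Nat.isCoprime_iff_coprime.2 hpd
  have hrs' : (r : 𝓞 F) * p + (s : 𝓞 F) * d = 1 := by exact_mod_cast congrArg (Int.cast (R := 𝓞 F)) hrs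
  have e : (p : 𝓞 F) * (r * x + s * y) = x := by
    linear_combination x * hrs' - s * h
  by_contra hp1
  refine hx.2 p (by omega) (r * x + s * y) (fun τ => ?_) e
  have h1 : τ ((p : F) * ((r * x + s * y : 𝓞 F) : F)) = τ (x : F) := by
    congr 1
    exact_mod_cast congrArg (fun z : 𝓞 F => (z : F)) e
  rw [map_mul, map_natCast] at h1
  exact pos_of_mul_pos_right (h1 ▸ hx.1 τ) (Nat.cast_nonneg p)

variable [NumberField F] [NumberField.IsTotallyReal F]

/-- The trace is [F : ℚ] c, so every embedding sends x and the rational number Tr(x) / [F : ℚ] to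
the same value. -/
lemma exists_rat_of_embeddings_eq {x : F} {c : ℝ} (h : ∀ τ : F →+* ℝ, τ x = c) :
    ∃ r : ℚ, x = r := by
  have h1 := trace_eq_sum_embeddings ℂ (K := ℚ) (x := x)
  have h2 : ∀ σ : F →ₐ[ℚ] ℂ, σ x = (c : ℂ) := fun σ => by
    obtain ⟨τ, hτ⟩ := exists_real_embedding (σ : F →+* ℂ)
    exact (hτ x).trans (by rw [h τ])
  simp only [h2, Finset.sum_const, Finset.card_univ, AlgHom.card, nsmul_eq_mul] at h1
  have hd : (Module.finrank ℚ F : ℂ) ≠ 0 := by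
    exact_mod_cast (Module.finrank_pos (R := ℚ) (M := F)).ne'
  refine ⟨Algebra.trace ℚ F x / Module.finrank ℚ F, ?_⟩
  have σ : F →ₐ[ℚ] ℂ := IsAlgClosed.lift
  apply (σ : F →+* ℂ).injective
  change σ x = (σ : F →+* ℂ) _
  rw [map_ratCast, h2 σ]
  push_cast
  rw [eq_div_iff hd, mul_comm, ← h1]
  simp

/-- Two primitive elements on the same ray coincide. -/
lemma IsPrimitiveElement.eq_of_smul {x y : 𝓞 F} (hx : IsPrimitiveElement x)
    (hy : IsPrimitiveElement y) {c : ℝ}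
    (h : realEmbedding (x : F) = c • realEmbedding (y : F)) : x = y := by
  obtain ⟨w⟩ := (inferInstance : Nonempty (F →+* ℂ))
  obtain ⟨τ₀, -⟩ := exists_real_embedding w
  have hy0 : (y : F) ≠ 0 := fun h0 => by
    have := hy.1 τ₀
    rw [h0, map_zero] at this
    exact this.false
  -- The ratio x / y has the same value `c` under all embeddings, hence is a positive rational.
  -- Primitivity of `x` forces its numerator to be 1, and primitivity of `y` its denominator.
  obtain ⟨r, hr⟩ := exists_rat_of_embeddings_eq (x := (x : F) / (y : F)) (c := c) fun τ => by
    rw [map_div₀, div_eq_iff ((map_ne_zero τ).2 hy0)]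
    exact congrFun h τ
  have hr0 : 0 < r := by
    have h1 : τ₀ ((x : F) / (y : F)) = r := by rw [hr, map_ratCast]
    rw [map_div₀] at h1
    have := div_pos (hx.1 τ₀) (hy.1 τ₀)
    rw [h1] at this
    exact_mod_cast this
  have hxy : (x : F) = r * y := by rw [← hr, div_mul_cancel₀ _ hy0]
  have hnum : (r.num.natAbs : ℤ) = r.num := Int.natAbs_of_nonneg (Rat.num_nonneg.2 hr0.le)
  have key : (r.den : 𝓞 F) * x = (r.num.natAbs : 𝓞 F) * y := by
    apply FaithfulSMul.algebraMap_injective (𝓞 F) F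
    rw [map_mul, map_mul, map_natCast, map_natCast]
    change (r.den : F) * (x : F) = (r.num.natAbs : F) * (y : F)
    rw [hxy, ← mul_assoc]
    congr 1
    have h1 : (r.den : ℚ) * r = r.num.natAbs := by
      rw [mul_comm, Rat.mul_den_eq_num, ← hnum]; simp
    exact_mod_cast congrArg (Rat.cast (K := F)) h1
  have hpos : 0 < r.num.natAbs := Int.natAbs_pos.2 (Rat.num_pos.2 hr0).ne'
  have e1 := hx.eq_one_of_coprime hpos r.reduced key
  have e2 := hy.eq_one_of_coprime r.den_pos r.reduced.symm key.symm
  rw [e1, e2] at key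
  simpa using key

end Primitive

/-! ### Generating tuples and local finiteness of the fan -/

section Fans

open NumberField

variable {F : Type} [Field F] {ξ : AddChar (𝓞 F) ℂ}

/-- The images in `ℝ^I` of a tuple in `A_ξ`. -/
def tupleVec {ι : Type} (a : ι → PrimitiveSet ξ) (i : ι) : RealSpace F :=
  realEmbedding ((a i).1 : F)

def tupleCone {ι : Type} [Fintype ι] (a : ι → PrimitiveSet ξ) : Set (RealSpace F) :=
  generatedCone fun i => (a i).1

lemma tupleCone_eq {ι : Type} [Fintype ι] (a : ι → PrimitiveSet ξ) :
    tupleCone a = vectorCone (tupleVec a) := rfl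

lemma tupleVec_pos {ι : Type} (a : ι → PrimitiveSet ξ) (i : ι) (τ : F →+* ℝ) :
    0 < tupleVec a i τ := (a i).2.1.1 τ

lemma tupleVec_ne_zero (τ : F →+* ℝ) {ι : Type} (a : ι → PrimitiveSet ξ) (i : ι) :
    tupleVec a i ≠ 0 := fun h => by
  have := tupleVec_pos a i τ
  rw [h] at this
  exact this.false

/-- `a` generates a full-dimensional cone of `Φ`. -/
def IsTopTuple (Φ : Set (Set (RealSpace F))) {m : ℕ} (a : Fin m → PrimitiveSet ξ) : Prop :=
  tupleCone a ∈ Φ ∧ LinearIndependent ℝ (tupleVec a)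

lemma injective_of_linearIndependent {ι : Type} {a : ι → PrimitiveSet ξ}
    (ha : LinearIndependent ℝ (tupleVec a)) : Function.Injective a := fun i j hij =>
  ha.injective (by simp [tupleVec, hij])

lemma coneDim_vectorCone {m : ℕ} {v : Fin m → RealSpace F} (hv : LinearIndependent ℝ v) :
    coneDim (vectorCone v) = m := by
  rw [coneDim, span_vectorCone, finrank_span_eq_card hv, Fintype.card_fin]

lemma linearIndependent_of_coneDim {m : ℕ} {v : Fin m → RealSpace F}
    (h : coneDim (vectorCone v) = m) : LinearIndependent ℝ v := by
  rw [linearIndependent_iff_card_eq_finrank_span, Fintype.card_fin, Set.finrank, ← span_vectorCone]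
  exact h.symm

lemma HasGeneratorsIn.exists_tuple {Φ : Set (Set (RealSpace F))} (hgen : HasGeneratorsIn ξ Φ)
    {σ : Set (RealSpace F)} (hσ : σ ∈ Φ) {m : ℕ} (hm : coneDim σ = m) :
    ∃ a : Fin m → PrimitiveSet ξ, tupleCone a = σ := by
  subst hm
  exact hgen σ hσ

lemma IsTopTuple.comp_perm {Φ : Set (Set (RealSpace F))} {m : ℕ} {a : Fin m → PrimitiveSet ξ}
    (ha : IsTopTuple Φ a) (ρ : Equiv.Perm (Fin m)) : IsTopTuple Φ (a ∘ ρ) := by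
  refine ⟨?_, ha.2.comp _ ρ.injective⟩
  have : tupleCone (a ∘ ρ) = tupleCone a := vectorCone_comp_equiv (tupleVec a) ρ
  rw [this]
  exact ha.1

lemma finiteDimensional_realSpace {n : ℕ} (τ : Fin n ≃ (F →+* ℝ)) :
    FiniteDimensional ℝ (RealSpace F) :=
  (spaceBasis τ).finiteDimensional_of_finite

lemma finrank_realSpace {n : ℕ} (τ : Fin n ≃ (F →+* ℝ)) :
    Module.finrank ℝ (RealSpace F) = n := by
  rw [Module.finrank_eq_card_basis (spaceBasis τ), Fintype.card_fin]

variable {Φ : Set (Set (RealSpace F))} {Γ : Subgroup (𝓞 F)ˣ}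

lemma IsShintaniDecomposition.exists_mem (hΦ : IsShintaniDecomposition Γ Φ) {v : RealSpace F}
    (hv : ∀ τ, 0 < v τ) : ∃ σ ∈ Φ, v ∈ intrinsicInterior ℝ σ := by
  have : v ∈ ⋃ σ ∈ Φ, intrinsicInterior ℝ σ := by rw [hΦ.iUnion_interior]; exact Or.inl hv
  simpa using this

variable [NumberField F] [NumberField.IsTotallyReal F]

lemma primitiveSet_eq_of_smul {s s' : PrimitiveSet ξ} {c : ℝ}
    (h : realEmbedding (s.1 : F) = c • realEmbedding (s'.1 : F)) : s = s' :=
  Subtype.ext (s.2.1.eq_of_smul s'.2.1 h)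

lemma exists_real (F : Type) [Field F] [NumberField F] [NumberField.IsTotallyReal F] :
    Nonempty (F →+* ℝ) := by
  obtain ⟨w⟩ := (inferInstance : Nonempty (F →+* ℂ))
  obtain ⟨τ, -⟩ := exists_real_embedding w
  exact ⟨τ⟩

lemma mem_range_of_tupleCone_eq {ι κ : Type} [Fintype ι] [Fintype κ] {a : ι → PrimitiveSet ξ}
    {c : κ → PrimitiveSet ξ} (ha : LinearIndependent ℝ (tupleVec a)) (h : tupleCone a = tupleCone c)
    (i : ι) : ∃ k, a i = c k := by
  obtain ⟨τ⟩ := exists_real F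
  obtain ⟨k, r, -, hk⟩ := exists_smul_of_vectorCone_eq ha (tupleVec_ne_zero τ c) h i
  exact ⟨k, primitiveSet_eq_of_smul hk⟩

/-- Generators in `A_ξ` of a simplicial cone are unique up to order. -/
lemma exists_perm_of_tupleCone_eq {m : ℕ} {a c : Fin m → PrimitiveSet ξ}
    (ha : LinearIndependent ℝ (tupleVec a)) (h : tupleCone a = tupleCone c) :
    ∃ ρ : Equiv.Perm (Fin m), a = c ∘ ρ := by
  choose k hk using mem_range_of_tupleCone_eq ha h
  have hinj : Function.Injective k := fun i j hij =>
    injective_of_linearIndependent ha (by rw [hk i, hk j, hij])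
  exact ⟨Equiv.ofBijective k (Finite.injective_iff_bijective.1 hinj), funext hk⟩

/-- `IsFace` is witnessed by some auxiliary generators `b`, on the same rays as `c`. The rays of the
face are among them, and a ray holds at most one primitive element. -/
lemma mem_range_of_isFace {ι κ : Type} [Fintype ι] [Fintype κ] {a : ι → PrimitiveSet ξ}
    {c : κ → PrimitiveSet ξ} (ha : LinearIndependent ℝ (tupleVec a))
    (h : IsFace (tupleCone a) (tupleCone c)) (i : ι) : ∃ k, a i = c k := by
  obtain ⟨τ⟩ := exists_real F
  obtain ⟨m, b, ⟨hbpos, hbli, hbc⟩, s, hs⟩ := h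
  have hb0 : ∀ l, realEmbedding (b l : F) ≠ 0 := fun l h0 => by
    have h1 := hbpos l τ
    have h2 : τ (b l : F) = 0 := congrFun h0 τ
    exact h1.ne' h2
  obtain ⟨l, r, -, hl⟩ := exists_smul_of_vectorCone_eq
    (w := fun l : s => realEmbedding (b l : F)) ha (fun l => hb0 l) hs i
  obtain ⟨k, r', -, hk⟩ := exists_smul_of_vectorCone_eq hbli (tupleVec_ne_zero τ c) hbc l
  refine ⟨k, primitiveSet_eq_of_smul (c := r * r') ?_⟩
  rw [mul_smul]
  exact hl.trans (congrArg _ hk)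

/-- There are finitely many cones up to Γ, and only finitely many totally positive unit multiples of
each representative meet the box. -/
lemma finite_cones_meeting (hΦ : IsShintaniDecomposition Γ Φ) (hΓ' : Γ ≤ totallyPositiveUnits F)
    {lo hi : ℝ} (hlo : 0 < lo) :
    {σ ∈ Φ | ∃ p ∈ σ, ∀ τ : F →+* ℝ, lo ≤ p τ ∧ p τ ≤ hi}.Finite := by
  obtain ⟨T, hTΦ, hTfin, hT⟩ := hΦ.finite_orbits
  have hfin : ∀ ρ ∈ T, {u : (𝓞 F)ˣ | u ∈ totallyPositiveUnits F ∧ ∃ p ∈ ρ,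
      ∀ τ : F →+* ℝ, lo ≤ τ (u : F) * p τ ∧ τ (u : F) * p τ ≤ hi}.Finite := fun ρ hρ => by
    obtain ⟨m, b, hb, -, rfl⟩ := hΦ.simplicial ρ (hTΦ hρ)
    exact finite_units_meeting hb hlo
  refine (hTfin.biUnion fun ρ hρ => (hfin ρ hρ).image fun u => unitScale u ρ).subset ?_
  rintro σ ⟨hσ, p, hp, hpb⟩
  obtain ⟨ρ, hρ, u, hu, rfl⟩ := hT σ hσ
  obtain ⟨p, hp', rfl⟩ := hp
  exact Set.mem_biUnion hρ ⟨u, ⟨hΓ' hu, p, hp', hpb⟩, rfl⟩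

end Fans

/-! ### Neighbours across a facet -/

section Facets

open NumberField

variable {F : Type} [Field F] {ξ : AddChar (𝓞 F) ℂ}

/-- The sign of `det (τ_i (a_j))`. -/
def tupleSign {n : ℕ} (τ : Fin n ≃ (F →+* ℝ)) (a : Fin n → PrimitiveSet ξ) : ℤ :=
  orientation τ fun i => (a i).1

lemma tupleSign_eq {n : ℕ} (τ : Fin n ≃ (F →+* ℝ)) (a : Fin n → PrimitiveSet ξ) :
    tupleSign τ a = SignType.sign ((spaceBasis τ).det (tupleVec a)) := orientation_eq τ _

lemma tupleSign_comp_perm {n : ℕ} (τ : Fin n ≃ (F →+* ℝ)) (a : Fin n → PrimitiveSet ξ)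
    (ρ : Equiv.Perm (Fin n)) : tupleSign τ (a ∘ ρ) = Equiv.Perm.sign ρ * tupleSign τ a :=
  orientation_comp_perm τ (fun i => (a i).1) ρ

lemma tupleSign_smul {n : ℕ} (τ : Fin n ≃ (F →+* ℝ)) (u : stabilizer ξ)
    (a : Fin n → PrimitiveSet ξ) : tupleSign τ (u • a) = tupleSign τ a :=
  orientation_unit_mul τ u.2.1 fun i => (a i).1

lemma unitScale_tupleCone {ι : Type} [Fintype ι] (u : stabilizer ξ) (a : ι → PrimitiveSet ξ) :
    unitScale (u : (𝓞 F)ˣ) (tupleCone a) = tupleCone (u • a) :=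
  unitScale_generatedCone (u : (𝓞 F)ˣ) fun i => (a i).1

lemma tupleVec_smul {ι : Type} (u : stabilizer ξ) (a : ι → PrimitiveSet ξ) (i : ι) :
    tupleVec (u • a) i = unitMul (u : (𝓞 F)ˣ) (tupleVec a i) :=
  (unitMul_realEmbedding (u : (𝓞 F)ˣ) (a i).1).symm

lemma unitMul_injective (u : (𝓞 F)ˣ) : Function.Injective (unitMul u) :=
  Function.LeftInverse.injective (unitMul_inv_cancel u)

lemma linearIndependent_smul {ι : Type} (u : stabilizer ξ) {a : ι → PrimitiveSet ξ}
    (ha : LinearIndependent ℝ (tupleVec a)) : LinearIndependent ℝ (tupleVec (u • a)) := by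
  have e : tupleVec (u • a) = unitMul (u : (𝓞 F)ˣ) ∘ tupleVec a := funext (tupleVec_smul u a)
  rw [e]
  exact ha.map' _ (LinearMap.ker_eq_bot.2 (unitMul_injective _))

lemma tupleSign_sq {n : ℕ} (τ : Fin n ≃ (F →+* ℝ)) {a : Fin n → PrimitiveSet ξ}
    (ha : LinearIndependent ℝ (tupleVec a)) : tupleSign τ a * tupleSign τ a = 1 := by
  rw [tupleSign_eq]
  rcases lt_or_gt_of_ne ((det_ne_zero_iff τ _).2 ha) with h | h
  · simp [sign_neg h]
  · simp [sign_pos h]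

variable {Φ : Set (Set (RealSpace F))} {Γ : Subgroup (𝓞 F)ˣ}

lemma IsTopTuple.smul (hΦ : IsShintaniDecomposition Γ Φ) (hΓ : stabilizer ξ ≤ Γ) {m : ℕ}
    {a : Fin m → PrimitiveSet ξ} (ha : IsTopTuple Φ a) (u : stabilizer ξ) :
    IsTopTuple Φ (u • a) :=
  ⟨unitScale_tupleCone u a ▸ hΦ.unitScale_mem _ ha.1 _ (hΓ u.2), linearIndependent_smul u ha.2⟩

lemma facet_isFace {n : ℕ} {a : Fin (n + 1) → PrimitiveSet ξ}
    (ha : LinearIndependent ℝ (tupleVec a)) (j : Fin (n + 1)) :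
    IsFace (tupleCone (a ∘ j.succAbove)) (tupleCone a) := by
  refine ⟨n + 1, fun i => (a i).1, ⟨fun i => (a i).2.1.1, ha, rfl⟩,
    Finset.univ.filter (· ≠ j), ?_⟩
  have hb : Function.Bijective (fun k : Fin n =>
      (⟨j.succAbove k, by simp⟩ : {i // i ∈ Finset.univ.filter (· ≠ j)})) := by
    constructor
    · intro k l h
      exact Fin.succAbove_right_injective (congrArg Subtype.val h)
    · rintro ⟨i, hi⟩
      obtain ⟨k, rfl⟩ := Fin.exists_succAbove_eq (Finset.mem_filter.1 hi).2
      exact ⟨k, rfl⟩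
  exact vectorCone_comp_equiv
    (fun i : {i // i ∈ Finset.univ.filter (· ≠ j)} => tupleVec a i) (Equiv.ofBijective _ hb)

variable [NumberField F] [NumberField.IsTotallyReal F]

/-- Equal signs put `a' j` and `a j` on the same side of the common facet. The two cones then share
interior points near that facet, so they coincide, and so do their generators. -/
lemma IsTopTuple.eq_of_eqOn {n : ℕ} (hΦ : IsShintaniDecomposition Γ Φ)
    (τ : Fin n ≃ (F →+* ℝ)) {a a' : Fin n → PrimitiveSet ξ}
    (ha : IsTopTuple Φ a) (ha' : IsTopTuple Φ a') (j : Fin n) (hj : ∀ k, k ≠ j → a' k = a k)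
    (hs : tupleSign τ a = tupleSign τ a') : a = a' := by
  classical
  have hfd := finiteDimensional_realSpace τ
  have hcard : Fintype.card (Fin n) = Module.finrank ℝ (RealSpace F) := by
    rw [finrank_realSpace τ, Fintype.card_fin]
  obtain ⟨x, hx⟩ : ∃ x : Fin n → ℝ, tupleVec a' j = ∑ i, x i • tupleVec a i := by
    have : tupleVec a' j ∈ Submodule.span ℝ (Set.range (tupleVec a)) := by
      rw [ha.2.span_eq_top_of_card_eq_finrank' hcard]; trivial
    obtain ⟨x, hx⟩ := (Submodule.mem_span_range_iff_exists_fun ℝ).1 this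
    exact ⟨x, hx.symm⟩
  have hupd : tupleVec a' = Function.update (tupleVec a) j (∑ i, x i • tupleVec a i) := by
    funext k
    rcases eq_or_ne k j with rfl | hk
    · rw [Function.update_self, hx]
    · rw [Function.update_of_ne hk]; simp [tupleVec, hj k hk]
  have hdet : (spaceBasis τ).det (tupleVec a') = x j * (spaceBasis τ).det (tupleVec a) := by
    rw [hupd, det_update_sum]
  have hd0 := (det_ne_zero_iff τ _).2 ha.2
  have hxj : 0 < x j := by
    rw [tupleSign_eq, tupleSign_eq, hdet, sign_mul] at hs
    have hs' : SignType.sign ((spaceBasis τ).det (tupleVec a)) =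
        SignType.sign (x j) * SignType.sign ((spaceBasis τ).det (tupleVec a)) := by
      generalize SignType.sign ((spaceBasis τ).det (tupleVec a)) = s at hs ⊢
      generalize SignType.sign (x j) = s' at hs ⊢
      revert s s'
      decide
    have h1 := mul_right_cancel₀ (sign_ne_zero.2 hd0) ((one_mul _).trans hs')
    exact sign_eq_one_iff.1 h1.symm
  -- `M` exceeds every |x i|, so the point a'_j + M ∑_{k ≠ j} a_k has positive coordinates in both
  -- bases.
  let M : ℝ := 1 + ∑ i, |x i|
  have hM : ∀ k, 0 < M + x k := fun k => by
    have h1 : |x k| ≤ ∑ i, |x i| :=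
      Finset.single_le_sum (f := fun i => |x i|) (fun i _ => abs_nonneg _) (Finset.mem_univ k)
    have h2 := neg_abs_le (x k)
    simp only [M]
    linarith
  have hM0 : 0 < M := by
    have : 0 ≤ ∑ i, |x i| := Finset.sum_nonneg fun i _ => abs_nonneg _
    simp only [M]; linarith
  have e : ∑ i, (if i = j then 1 else M) • tupleVec a' i =
      ∑ i, (x i + if i = j then 0 else M) • tupleVec a i := by
    simp only [add_smul, Finset.sum_add_distrib, ← hx]
    rw [← Finset.add_sum_erase _ _ (Finset.mem_univ j),
      ← Finset.add_sum_erase _ (fun i => (if i = j then 0 else M) • tupleVec a i)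
        (Finset.mem_univ j)]
    simp only [if_true, one_smul, zero_smul, zero_add]
    congr 1
    refine Finset.sum_congr rfl fun k hk => ?_
    have hk := Finset.ne_of_mem_erase hk
    simp [hk, tupleVec, hj k hk]
  have h1 : ∑ i, (if i = j then 1 else M) • tupleVec a' i ∈ intrinsicInterior ℝ (tupleCone a') :=
    interior_subset_intrinsicInterior (mem_interior_vectorCone ha'.2 hcard fun i => by
      split_ifs <;> positivity)
  have h2 : ∑ i, (if i = j then 1 else M) • tupleVec a' i ∈ intrinsicInterior ℝ (tupleCone a) := by
    rw [e]
    refine interior_subset_intrinsicInterior (mem_interior_vectorCone ha.2 hcard fun i => ?_)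
    split_ifs with h
    · subst h; simpa using hxj
    · linarith [hM i]
  have hcone : tupleCone a' = tupleCone a := hΦ.disjoint_interior.elim_set ha'.1 ha.1 _ h1 h2
  obtain ⟨l, hl⟩ := mem_range_of_tupleCone_eq ha'.2 hcone j
  have hlj : l = j := by
    by_contra hne
    have := hj l hne
    rw [← hl] at this
    exact hne (injective_of_linearIndependent ha'.2 this)
  subst hlj
  funext k
  rcases eq_or_ne k l with rfl | hk
  · exact hl.symm
  · exact (hj k hk).symm

/-- A full-dimensional cone has a neighbour across each facet. -/
lemma IsTopTuple.exists_flip {n : ℕ} (hΦ : IsShintaniDecomposition Γ Φ)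
    (hΓ' : Γ ≤ totallyPositiveUnits F) (hgen : HasGeneratorsIn ξ Φ)
    (τ : Fin (n + 2) ≃ (F →+* ℝ)) {a : Fin (n + 2) → PrimitiveSet ξ}
    (ha : IsTopTuple Φ a) (j : Fin (n + 2)) :
    ∃ a' : Fin (n + 2) → PrimitiveSet ξ, IsTopTuple Φ a' ∧ (∀ k, k ≠ j → a' k = a k) ∧
      tupleSign τ a' = - tupleSign τ a := by
  classical
  have hfd := finiteDimensional_realSpace τ
  have := exists_real F
  set b : Fin (n + 1) → PrimitiveSet ξ := a ∘ j.succAbove with hbdef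
  have hbli : LinearIndependent ℝ (tupleVec b) := ha.2.comp _ Fin.succAbove_right_injective
  have hbΦ : tupleCone b ∈ Φ := hΦ.face_mem _ ha.1 _ (facet_isFace ha.2 j)
  -- The point `y` lies in the relative interior of the facet. The neighbour is found by moving from
  -- `y` slightly away from `a j`, to p = y - t a_j.
  set y : RealSpace F := ∑ k, tupleVec b k with hy
  have hypos : ∀ σ, 0 < y σ := fun σ => by
    rw [hy, Finset.sum_apply]
    exact Finset.sum_pos (fun k _ => tupleVec_pos b k σ) Finset.univ_nonempty
  obtain ⟨σ₀, hσ₀⟩ := Finite.exists_min y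
  obtain ⟨M, hM⟩ := (Set.finite_range fun σ : F →+* ℝ => max (y σ) (tupleVec a j σ)).bddAbove
  have hM1 : ∀ σ, y σ ≤ M := fun σ => (le_max_left _ _).trans (hM ⟨σ, rfl⟩)
  have hM2 : ∀ σ, tupleVec a j σ ≤ M := fun σ => (le_max_right _ _).trans (hM ⟨σ, rfl⟩)
  have hM0 : 0 < M := (hypos σ₀).trans_le (hM1 σ₀)
  -- Half the least coordinate of `y`: for t < lo / M the point `p` stays in the box [lo, M], which
  -- only finitely many cones meet. Those missing `y` have closed union, so a small `t` avoids them
  -- all, and the cone found for `p` must contain `y`.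
  set lo := y σ₀ / 2 with hlo
  have hlo0 : 0 < lo := half_pos (hypos σ₀)
  let W : Set (Set (RealSpace F)) :=
    {σ ∈ Φ | ∃ p ∈ σ, ∀ τ : F →+* ℝ, lo ≤ p τ ∧ p τ ≤ M}
  have hW : W.Finite := finite_cones_meeting hΦ hΓ' hlo0
  have hclosed : IsClosed (⋃ σ ∈ {σ ∈ W | y ∉ σ}, σ) := by
    refine (hW.subset (Set.sep_subset _ _)).isClosed_biUnion fun σ hσ => ?_
    obtain ⟨m, b', -, hb', rfl⟩ := hΦ.simplicial σ hσ.1.1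
    exact isClosed_vectorCone hb'
  have hyn : y ∉ ⋃ σ ∈ {σ ∈ W | y ∉ σ}, σ := by
    simp only [Set.mem_iUnion, not_exists]
    exact fun σ hσ => hσ.2
  have htend : Filter.Tendsto (fun t : ℝ => y - t • tupleVec a j)
      (nhdsWithin 0 (Set.Ioi 0)) (nhds y) := by
    have hc : Continuous fun t : ℝ => y - t • tupleVec a j := by fun_prop
    have := hc.tendsto 0
    simp only [zero_smul, sub_zero] at this
    exact this.mono_left nhdsWithin_le_nhds
  have hev := htend.eventually (hclosed.isOpen_compl.mem_nhds hyn)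
  have hev2 : ∀ᶠ t : ℝ in nhdsWithin 0 (Set.Ioi 0), t < lo / M :=
    Filter.Eventually.filter_mono nhdsWithin_le_nhds (eventually_lt_nhds (div_pos hlo0 hM0))
  obtain ⟨t, ⟨ht1, ht2⟩, ht0⟩ := ((hev.and hev2).and self_mem_nhdsWithin).exists
  have ht0 : 0 < t := ht0
  set p := y - t • tupleVec a j with hp
  have hpb : ∀ σ, lo ≤ p σ ∧ p σ ≤ M := fun σ => by
    have h1 : t * tupleVec a j σ ≤ lo := by
      calc t * tupleVec a j σ ≤ lo / M * M :=
            mul_le_mul ht2.le (hM2 σ) (tupleVec_pos a j σ).le (div_pos hlo0 hM0).le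
        _ = lo := div_mul_cancel₀ _ hM0.ne'
    have h2 : p σ = y σ - t * tupleVec a j σ := rfl
    have h3 := hσ₀ σ
    have h4 := mul_pos ht0 (tupleVec_pos a j σ)
    have h5 := hM1 σ
    constructor
    · rw [h2]; rw [hlo] at h1 ⊢; linarith
    · rw [h2]; linarith
  obtain ⟨σ, hσ, hpσ⟩ := hΦ.exists_mem (v := p) fun ρ => hlo0.trans_le (hpb ρ).1
  have hpσ := intrinsicInterior_subset hpσ
  have hyσ : y ∈ σ := by
    by_contra hcon
    exact ht1 (Set.mem_biUnion (show σ ∈ {σ ∈ W | y ∉ σ} from ⟨⟨hσ, p, hpσ, hpb⟩, hcon⟩) hpσ)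
  obtain ⟨hface1, hface2⟩ := hΦ.inter_isFace _ hbΦ σ hσ
  have hycone : y ∈ tupleCone b := ⟨fun _ => 1, fun _ => zero_le_one, by simp [hy, tupleVec]⟩
  have hsub : tupleCone b ⊆ σ := by
    obtain ⟨m, b', ⟨-, hb', hbc⟩, s, hs⟩ := hface1
    have h1 : y ∈ generatedCone fun i : s => b' i := hs ▸ ⟨hycone, hyσ⟩
    have h2 : tupleCone b ⊆ generatedCone fun i : s => b' i :=
      subset_of_sum_mem_face (v := tupleVec b) (w := fun i => realEmbedding (b' i : F)) hb'
        hbc.symm s h1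
    rw [← hs] at h2
    exact h2.trans Set.inter_subset_right
  rw [Set.inter_eq_left.2 hsub] at hface2
  -- The span of `σ` contains the facet, and also `a j`, because t a_j = y - p.
  have hdim : coneDim σ = n + 2 := by
    have hbs : ∀ k, tupleVec b k ∈ Submodule.span ℝ σ := fun k =>
      Submodule.subset_span (hsub (mem_vectorCone_self (tupleVec b) k))
    have haj : tupleVec a j ∈ Submodule.span ℝ σ := by
      have h1 : t • tupleVec a j = y - p := by rw [hp]; abel
      have h2 : t • tupleVec a j ∈ Submodule.span ℝ σ := h1 ▸
        sub_mem (Submodule.subset_span hyσ) (Submodule.subset_span hpσ)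
      exact (Submodule.smul_mem_iff _ ht0.ne').1 h2
    have htop : Submodule.span ℝ σ = ⊤ := by
      rw [eq_top_iff, ← ha.2.span_eq_top_of_card_eq_finrank'
        (by rw [finrank_realSpace τ, Fintype.card_fin]), Submodule.span_le]
      rintro _ ⟨k, rfl⟩
      rcases eq_or_ne k j with rfl | hk
      · exact haj
      · obtain ⟨k, rfl⟩ := Fin.exists_succAbove_eq hk
        exact hbs k
    rw [coneDim, htop, finrank_top, finrank_realSpace τ]
  obtain ⟨c, hc⟩ := hgen.exists_tuple hσ hdim
  have hcli : LinearIndependent ℝ (tupleVec c) :=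
    linearIndependent_of_coneDim (by rw [← tupleCone_eq, hc, hdim])
  rw [← hc] at hface2
  choose l hl using mem_range_of_isFace hbli hface2
  have hlinj : Function.Injective l := fun i k hik =>
    injective_of_linearIndependent hbli (by rw [hl i, hl k, hik])
  -- The generators of the facet take n + 1 of the n + 2 places of `c`; the one left over goes to
  -- position `j`.
  obtain ⟨l₀, hl₀⟩ : ∃ l₀, ∀ k, l k ≠ l₀ := by
    by_contra! hcon
    have := Fintype.card_le_of_surjective l hcon
    simp at this
  have hρ : Function.Injective (j.insertNth l₀ l : Fin (n + 2) → Fin (n + 2)) := by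
    intro i k hik
    rcases Fin.eq_self_or_eq_succAbove j i with hi | ⟨i, rfl⟩ <;>
    rcases Fin.eq_self_or_eq_succAbove j k with hk | ⟨k, rfl⟩
    · rw [hi, hk]
    · rw [hi, Fin.insertNth_apply_same, Fin.insertNth_apply_succAbove] at hik
      exact (hl₀ k hik.symm).elim
    · rw [hk, Fin.insertNth_apply_same, Fin.insertNth_apply_succAbove] at hik
      exact (hl₀ i hik).elim
    · rw [Fin.insertNth_apply_succAbove, Fin.insertNth_apply_succAbove] at hik
      rw [hlinj hik]
  let ρ : Equiv.Perm (Fin (n + 2)) := Equiv.ofBijective _ (Finite.injective_iff_bijective.1 hρ)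
  have hctop : IsTopTuple Φ c := ⟨hc ▸ hσ, hcli⟩
  have hagree : ∀ k, k ≠ j → (c ∘ ρ) k = a k := fun k hk => by
    obtain ⟨k, rfl⟩ := Fin.exists_succAbove_eq hk
    have : ρ (j.succAbove k) = l k := by simp [ρ]
    rw [Function.comp_apply, this, ← hl]
    rfl
  refine ⟨c ∘ ρ, hctop.comp_perm ρ, hagree, ?_⟩
  have hpc : p ∈ vectorCone (tupleVec (c ∘ ρ)) := by
    have : vectorCone (tupleVec (c ∘ ρ)) = tupleCone c := vectorCone_comp_equiv (tupleVec c) ρ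
    rw [this, hc]; exact hpσ
  obtain ⟨x, hx, hpx⟩ := hpc
  have hpa : p = ∑ i, (if i = j then -t else 1) • tupleVec a i := by
    rw [Fin.sum_univ_succAbove _ j, hp, hy]
    simp only [if_true, Fin.succAbove_ne, if_false, one_smul, neg_smul]
    rw [sub_eq_add_neg, add_comm]
    rfl
  have hupd : Function.update (tupleVec (c ∘ ρ)) j p = Function.update (tupleVec a) j p := by
    funext k
    rcases eq_or_ne k j with rfl | hk
    · simp
    · rw [Function.update_of_ne hk, Function.update_of_ne hk]
      simp only [tupleVec, hagree k hk]
  -- Replacing entry `j` by `p` yields the same tuple from either side. Its determinant is read off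
  -- from the coefficient of `p` in each: `x j` ≥ 0 in the new cone, -t in the old.
  have hdet : x j * (spaceBasis τ).det (tupleVec (c ∘ ρ)) =
      -t * (spaceBasis τ).det (tupleVec a) := by
    have h1 := det_update_sum τ (tupleVec (c ∘ ρ)) j x
    have h2 := det_update_sum τ (tupleVec a) j fun i => if i = j then -t else 1
    rw [← hpx] at h1
    rw [← hpa] at h2
    rw [← h1, hupd, h2]
    simp
  have hd0 := (det_ne_zero_iff τ _).2 ha.2
  have hxj : 0 < x j := (hx j).lt_of_ne fun h0 => by
    rw [← h0, zero_mul] at hdet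
    exact mul_ne_zero (neg_ne_zero.2 ht0.ne') hd0 hdet.symm
  have hsign := congrArg SignType.sign hdet
  rw [sign_mul, sign_pos hxj, one_mul, sign_mul, Left.sign_neg, sign_pos ht0] at hsign
  rw [tupleSign_eq, tupleSign_eq, hsign]
  simp

end Facets

/-! ### Orbit sums over ordered tuples; vanishing on coboundaries -/

section OrbitSums

open NumberField

variable {F : Type} [Field F] {ξ : AddChar (𝓞 F) ℂ}

lemma smul_comp_perm {ι : Type} (u : stabilizer ξ) (a : ι → PrimitiveSet ξ) (ρ : ι → ι) :
    u • (a ∘ ρ) = (u • a) ∘ ρ := rfl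

/-- The power of `u` to the order of `ρ` fixes the tuple, hence is 1, and totally positive units
have no torsion. -/
lemma stabilizer_eq_one_of_smul_eq_comp (τ : F →+* ℝ) {ι : Type} [Finite ι] [Nonempty ι]
    {u : stabilizer ξ} {a : ι → PrimitiveSet ξ} {ρ : Equiv.Perm ι} (h : u • a = a ∘ ρ) : u = 1 := by
  have hk : ∀ k : ℕ, u ^ k • a = a ∘ ⇑(ρ ^ k) := fun k => by
    induction k with
    | zero => simp
    | succ k ih => rw [pow_succ', mul_smul, ih, smul_comp_perm, h, pow_succ']; rfl
  have h1 := hk (orderOf ρ)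
  rw [pow_orderOf_eq_one] at h1
  have i := Classical.arbitrary ι
  have h2 : u ^ orderOf ρ = 1 := stabilizer_free ξ τ _ (a i) (congrFun h1 i)
  exact Subtype.ext (eq_one_of_pow_eq_one τ u.2.1 (orderOf_pos ρ).ne' (congrArg Subtype.val h2))

variable (ξ) in
/-- Ordered generators in `A_ξ` of the full-dimensional cones of `Φ`. -/
abbrev TopTuple (Φ : Set (Set (RealSpace F))) (m : ℕ) : Type :=
  {a : Fin m → PrimitiveSet ξ // IsTopTuple Φ a}

variable (ξ) in
def topTupleSetoid (Φ : Set (Set (RealSpace F))) (m : ℕ) : Setoid (TopTuple ξ Φ m) where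
  r a b := ∃ u : stabilizer ξ, u • a.1 = b.1
  iseqv :=
    { refl := fun a => ⟨1, one_smul _ _⟩
      symm := fun {a b} ⟨u, h⟩ => ⟨u⁻¹, by rw [← h, inv_smul_smul]⟩
      trans := fun {a b c} ⟨u, h⟩ ⟨v, h'⟩ => ⟨v * u, by rw [mul_smul, h, h']⟩ }

variable (ξ) in
abbrev TopTupleOrbits (Φ : Set (Set (RealSpace F))) (m : ℕ) : Type := Quotient (topTupleSetoid ξ Φ m)

lemma topTuple_out_rel {Φ : Set (Set (RealSpace F))} {m : ℕ} (a : TopTuple ξ Φ m) :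
    ∃ u : stabilizer ξ, u • a.1 = (Quotient.mk (topTupleSetoid ξ Φ m) a).out.1 :=
  (topTupleSetoid ξ Φ m).symm (Quotient.mk_out a)

lemma IsGeneratorSystem.isTopTuple {Φ : Set (Set (RealSpace F))} {m : ℕ}
    {a : ConeOrbits ξ Φ m → Fin m → PrimitiveSet ξ} (ha : IsGeneratorSystem ξ Φ m a)
    (c : ConeOrbits ξ Φ m) : IsTopTuple Φ (a c) := by
  obtain ⟨σ, -, h⟩ := ha c
  have h' : tupleCone (a c) = σ.1 := h
  refine ⟨h' ▸ σ.2.1, linearIndependent_of_coneDim ?_⟩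
  rw [← tupleCone_eq, h', σ.2.2]

lemma HasGeneratorsIn.exists_isGeneratorSystem {Φ : Set (Set (RealSpace F))}
    (hgen : HasGeneratorsIn ξ Φ) (m : ℕ) : ∃ a, IsGeneratorSystem ξ Φ m a := by
  choose a ha using fun c : ConeOrbits ξ Φ m => hgen.exists_tuple c.out.2.1 c.out.2.2
  exact ⟨a, fun c => ⟨c.out, Quotient.out_eq c, ha c⟩⟩

variable {Φ : Set (Set (RealSpace F))} {Γ : Subgroup (𝓞 F)ˣ}

/-- The signed value of an invariant cochain on an orbit of tuples. -/
def signedValue {K : Type} [Field K] {m : ℕ} (τ : Fin m ≃ (F →+* ℝ)) (f : (Fin m → PrimitiveSet ξ) → K)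
    (q : TopTupleOrbits ξ Φ m) : K := tupleSign τ q.out.1 • f q.out.1

lemma signedValue_mk {K : Type} [Field K] {m : ℕ} (τ : Fin m ≃ (F →+* ℝ)) {f : (Fin m → PrimitiveSet ξ) → K}
    (hf : ∀ (u : stabilizer ξ) a, f (u • a) = f a) (a : TopTuple ξ Φ m) :
    signedValue τ f (Quotient.mk (topTupleSetoid ξ Φ m) a) = tupleSign τ a.1 • f a.1 := by
  obtain ⟨u, hu⟩ := topTuple_out_rel a
  rw [signedValue, ← hu, tupleSign_smul, hf]

variable [NumberField F] [NumberField.IsTotallyReal F]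

lemma IsGeneratorSystem.exists_smul_eq_comp {m : ℕ}
    {a : ConeOrbits ξ Φ m → Fin m → PrimitiveSet ξ} (ha : IsGeneratorSystem ξ Φ m a)
    {b : Fin m → PrimitiveSet ξ} (hb : IsTopTuple Φ b) :
    ∃ (c : ConeOrbits ξ Φ m) (u : stabilizer ξ) (ρ : Equiv.Perm (Fin m)), u • b = a c ∘ ρ := by
  let σ : ConesOfDim Φ m := ⟨tupleCone b, hb.1, coneDim_vectorCone hb.2⟩
  obtain ⟨σ', hσ', h⟩ := ha (Quotient.mk _ σ)
  obtain ⟨u, hu, huσ⟩ := Quotient.exact hσ'.symm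
  have h1 : tupleCone ((⟨u, hu⟩ : stabilizer ξ) • b) = tupleCone (a (Quotient.mk _ σ)) := by
    rw [← unitScale_tupleCone]
    exact huσ.trans h.symm
  obtain ⟨ρ, hρ⟩ := exists_perm_of_tupleCone_eq (linearIndependent_smul _ hb.2) h1
  exact ⟨_, _, ρ, hρ⟩

/-- Each cone has (m + 1)! orderings of its generators, and none of them are identified, because no
unit of Δ_ξ except 1 permutes the generators of a cone. -/
lemma generatorSystem_bijective {m : ℕ} {a : ConeOrbits ξ Φ (m + 1) → Fin (m + 1) → PrimitiveSet ξ}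
    (ha : IsGeneratorSystem ξ Φ (m + 1) a) :
    Function.Bijective fun x : ConeOrbits ξ Φ (m + 1) × Equiv.Perm (Fin (m + 1)) =>
      (Quotient.mk (topTupleSetoid ξ Φ (m + 1)) ⟨a x.1 ∘ x.2, (ha.isTopTuple x.1).comp_perm x.2⟩ :
        TopTupleOrbits ξ Φ (m + 1)) := by
  obtain ⟨τ⟩ := exists_real F
  constructor
  · rintro ⟨c, ρ⟩ ⟨c', ρ'⟩ h
    obtain ⟨u, hu⟩ := Quotient.exact h
    have hu : u • (a c ∘ ρ) = a c' ∘ ρ' := hu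
    have hcone : unitScale (u : (𝓞 F)ˣ) (tupleCone (a c)) = tupleCone (a c') := by
      have e1 : tupleCone (a c ∘ ρ) = tupleCone (a c) := vectorCone_comp_equiv (tupleVec (a c)) ρ
      have e2 : tupleCone (a c' ∘ ρ') = tupleCone (a c') :=
        vectorCone_comp_equiv (tupleVec (a c')) ρ'
      rw [← e1, unitScale_tupleCone, hu, e2]
    obtain ⟨σ, hσ, h1⟩ := ha c
    obtain ⟨σ', hσ', h1'⟩ := ha c'
    have hcc : c = c' := by
      rw [← hσ, ← hσ']
      exact Quotient.sound ⟨u, u.2, by rw [← h1, ← h1']; exact hcone⟩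
    subst hcc
    have hu1 : u • a c = a c ∘ (ρ' * ρ⁻¹ : Equiv.Perm _) := by
      have := congrArg (fun f => f ∘ ⇑ρ⁻¹) hu
      simp only [smul_comp_perm, Function.comp_assoc] at this
      have e : (⇑ρ ∘ ⇑ρ⁻¹ : Fin (m + 1) → Fin (m + 1)) = id := by funext i; simp
      rw [e, Function.comp_id] at this
      exact this
    have hu2 := stabilizer_eq_one_of_smul_eq_comp τ hu1
    rw [hu2, one_smul] at hu
    have hρ : ρ = ρ' := Equiv.ext fun i =>
      injective_of_linearIndependent (ha.isTopTuple c).2 (congrFun hu i)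
    rw [hρ]
  · intro q
    obtain ⟨⟨b, hb⟩, rfl⟩ := Quotient.exists_rep q
    obtain ⟨c, u, ρ, h⟩ := ha.exists_smul_eq_comp hb
    refine ⟨(c, ρ), Quotient.sound ⟨u⁻¹, ?_⟩⟩
    change u⁻¹ • (a c ∘ ρ) = b
    rw [← h, inv_smul_smul]

lemma finite_topTupleOrbits {m : ℕ} (hgen : HasGeneratorsIn ξ Φ)
    (hfin : Finite (ConeOrbits ξ Φ (m + 1))) : Finite (TopTupleOrbits ξ Φ (m + 1)) := by
  obtain ⟨a, ha⟩ := hgen.exists_isGeneratorSystem (m + 1)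
  exact Finite.of_surjective _ (generatorSystem_bijective ha).2

variable {K : Type} [Field K]

/-- Sign and cochain change by the same factor under reordering. The factorial is the price of
working with ordered tuples, in which the j-th facet has a meaning on orbits. -/
lemma sum_signedValue {m : ℕ} (τ : Fin (m + 1) ≃ (F →+* ℝ)) [Fintype (ConeOrbits ξ Φ (m + 1))]
    [Fintype (TopTupleOrbits ξ Φ (m + 1))]
    {a : ConeOrbits ξ Φ (m + 1) → Fin (m + 1) → PrimitiveSet ξ}
    (ha : IsGeneratorSystem ξ Φ (m + 1) a)
    {f : (Fin (m + 1) → PrimitiveSet ξ) → K} (hf : f ∈ altCochains K (PrimitiveSet ξ) m)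
    (hinv : ∀ (u : stabilizer ξ) a, f (u • a) = f a) :
    ∑ q : TopTupleOrbits ξ Φ (m + 1), signedValue τ f q =
      ((m + 1).factorial : K) * ∑ c, tupleSign τ (a c) • f (a c) := by
  rw [← (generatorSystem_bijective ha).sum_comp, Fintype.sum_prod_type, Finset.mul_sum]
  refine Finset.sum_congr rfl fun c _ => ?_
  have : ∀ ρ : Equiv.Perm (Fin (m + 1)), signedValue τ f
      (Quotient.mk (topTupleSetoid ξ Φ (m + 1)) ⟨a c ∘ ρ, (ha.isTopTuple c).comp_perm ρ⟩) =
      tupleSign τ (a c) • f (a c) := fun ρ => by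
    rw [signedValue_mk τ hinv, tupleSign_comp_perm, hf.1 ρ, zsmul_eq_mul, zsmul_eq_mul]
    rcases Int.units_eq_one_or (Equiv.Perm.sign ρ) with h1 | h1 <;> rw [h1] <;> push_cast <;> ring
  simp only [this, Finset.sum_const, Finset.card_univ, Fintype.card_perm, Fintype.card_fin,
    nsmul_eq_mul]

/-- Uniqueness of the neighbour, `IsTopTuple.eq_of_eqOn`, makes the flip an involution that commutes
with Δ_ξ. -/
lemma exists_flip_involution {n : ℕ} (hΦ : IsShintaniDecomposition Γ Φ) (hΓ : stabilizer ξ ≤ Γ)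
    (hΓ' : Γ ≤ totallyPositiveUnits F) (hgen : HasGeneratorsIn ξ Φ)
    (τ : Fin (n + 2) ≃ (F →+* ℝ)) (j : Fin (n + 2)) :
    ∃ φ : TopTupleOrbits ξ Φ (n + 2) → TopTupleOrbits ξ Φ (n + 2), Function.Involutive φ ∧
      ∀ q, ∃ a a' : TopTuple ξ Φ (n + 2), Quotient.mk (topTupleSetoid ξ Φ (n + 2)) a = q ∧
        Quotient.mk (topTupleSetoid ξ Φ (n + 2)) a' = φ q ∧
        a'.1 ∘ j.succAbove = a.1 ∘ j.succAbove ∧ tupleSign τ a'.1 = - tupleSign τ a.1 := by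
  choose fl hfl1 hfl2 hfl3 using fun a : TopTuple ξ Φ (n + 2) =>
    a.2.exists_flip hΦ hΓ' hgen τ j
  let fl' : TopTuple ξ Φ (n + 2) → TopTuple ξ Φ (n + 2) := fun a => ⟨fl a, hfl1 a⟩
  have hinv : ∀ a, fl' (fl' a) = a := fun a => Subtype.ext <|
    (hfl1 (fl' a)).eq_of_eqOn hΦ τ a.2 j (fun k hk =>
      ((hfl2 (fl' a) k hk).trans (hfl2 a k hk)).symm)
      (by rw [hfl3]; change -(tupleSign τ (fl a)) = _; rw [hfl3, neg_neg])
  have hequiv : ∀ a b : TopTuple ξ Φ (n + 2), topTupleSetoid ξ Φ (n + 2) a b →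
      topTupleSetoid ξ Φ (n + 2) (fl' a) (fl' b) := by
    rintro a b ⟨u, hu⟩
    refine ⟨u, (IsTopTuple.smul hΦ hΓ (hfl1 a) u).eq_of_eqOn hΦ τ (hfl1 b) j (fun k hk => ?_) ?_⟩
    · change fl b k = (u • fl a) k
      rw [hfl2 b k hk, ← hu, Pi.smul_apply, Pi.smul_apply, hfl2 a k hk]
    · change tupleSign τ (u • fl a) = tupleSign τ (fl b)
      rw [tupleSign_smul, hfl3, hfl3, ← hu, tupleSign_smul]
  refine ⟨Quotient.map fl' hequiv, fun q => ?_, fun q => ?_⟩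
  · obtain ⟨a, rfl⟩ := Quotient.exists_rep q
    rw [Quotient.map_mk, Quotient.map_mk, hinv]
  · obtain ⟨a, rfl⟩ := Quotient.exists_rep q
    exact ⟨a, fl' a, rfl, rfl, funext fun k => hfl2 a _ (Fin.succAbove_ne j k), hfl3 a⟩

/-- For each fixed `j`, the j-th term of `altDiff θ` sees only the facet opposite entry `j`. The
flip keeps this facet and reverses the sign, so the contributions cancel in pairs. -/
lemma sum_signedValue_altDiff [CharZero K] {n : ℕ} (hΦ : IsShintaniDecomposition Γ Φ) (hΓ : stabilizer ξ ≤ Γ)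
    (hΓ' : Γ ≤ totallyPositiveUnits F) (hgen : HasGeneratorsIn ξ Φ)
    (τ : Fin (n + 2) ≃ (F →+* ℝ)) [Fintype (TopTupleOrbits ξ Φ (n + 2))]
    {θ : (Fin (n + 1) → PrimitiveSet ξ) → K} (hinv : ∀ (u : stabilizer ξ) a, θ (u • a) = θ a) :
    ∑ q : TopTupleOrbits ξ Φ (n + 2), signedValue τ (altDiff θ) q = 0 := by
  have e : ∀ q : TopTupleOrbits ξ Φ (n + 2), signedValue τ (altDiff θ) q =
      ∑ j : Fin (n + 2), (-1) ^ (j : ℕ) * signedValue τ (fun a => θ (a ∘ j.succAbove)) q :=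
    fun q => by
      simp only [signedValue, altDiff, zsmul_eq_mul, Finset.mul_sum]
      exact Finset.sum_congr rfl fun j _ => by ring
  simp only [e]
  rw [Finset.sum_comm]
  refine Finset.sum_eq_zero fun j _ => ?_
  rw [← Finset.mul_sum]
  refine mul_eq_zero_of_right _ ?_
  obtain ⟨φ, hφ, hφ'⟩ := exists_flip_involution hΦ hΓ hΓ' hgen τ j
  have hinv' : ∀ (u : stabilizer ξ) (a : Fin (n + 2) → PrimitiveSet ξ),
      θ ((u • a) ∘ j.succAbove) = θ (a ∘ j.succAbove) := fun u a => hinv u (a ∘ j.succAbove)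
  have hsum : ∀ q, signedValue (Φ := Φ) τ (fun a => θ (a ∘ j.succAbove)) q +
      signedValue τ (fun a => θ (a ∘ j.succAbove)) (φ q) = 0 := fun q => by
    obtain ⟨a, a', rfl, h2, h3, h4⟩ := hφ' q
    rw [← h2, signedValue_mk τ hinv', signedValue_mk τ hinv', h3, h4, neg_smul, add_neg_cancel]
  -- An orbit fixed by the flip contributes a value equal to its negative, hence 0 in characteristic
  -- zero.
  refine Finset.sum_involution (fun q _ => φ q) (fun q _ => hsum q) (fun q _ hq h => hq ?_)
    (fun _ _ => Finset.mem_univ _) fun q _ => hφ q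
  have := hsum q
  rw [h] at this
  exact self_eq_neg.1 (eq_neg_of_add_eq_zero_left this)

end OrbitSums

/-! ### Endpoints of a line in an orthant -/

section Feasibility

variable {ι : Type*}

/-- The point of the line `x + ℝ D` where the `j`-th coordinate vanishes has non-negative
coordinates. -/
def Feasible (x D : ι → ℝ) (j : ι) : Prop := ∀ k, 0 ≤ x k - x j / D j * D k

lemma feasible_neg_iff (x D : ι → ℝ) (j : ι) : Feasible x (-D) j ↔ Feasible x D j := by
  simp only [Feasible, Pi.neg_apply, div_neg, neg_mul, mul_neg, neg_neg]

/-- The parameters t with x - t D ≥ 0 form an interval. A feasible `j` with `D j > 0` attains its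
upper end, and genericity forbids two coordinates from vanishing there together. -/
lemma Feasible.unique {x D : ι → ℝ}
    (hgen : ∀ j k, D j ≠ 0 → j ≠ k → x k - x j / D j * D k ≠ 0) {j j' : ι}
    (hj : 0 < D j) (hj' : 0 < D j') (h : Feasible x D j) (h' : Feasible x D j') : j = j' := by
  by_contra hne
  have h1 := h j'
  have h2 := h' j
  rw [sub_nonneg, ← le_div_iff₀ hj'] at h1
  rw [sub_nonneg, ← le_div_iff₀ hj] at h2
  refine hgen j j' hj.ne' hne ?_
  rw [le_antisymm h1 h2, div_mul_cancel₀ _ hj'.ne', sub_self]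

lemma Feasible.exists_neg [Finite ι] {x D : ι → ℝ} (hneg : ∃ k, D k < 0) {j : ι}
    (h : Feasible x D j) : ∃ k, D k < 0 ∧ Feasible x D k := by
  classical
  have := Fintype.ofFinite ι
  -- Coordinates with negative `D` bound t from below; the largest of these bounds is the lower end
  -- of the interval.
  obtain ⟨k, hk, hmax⟩ := Finset.exists_max_image (Finset.univ.filter fun k => D k < 0)
    (fun k => x k / D k) (by obtain ⟨k, hk⟩ := hneg; exact ⟨k, by simpa using hk⟩)
  have hk : D k < 0 := by simpa using hk
  have hjk : x k / D k ≤ x j / D j := by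
    have := h k
    rwa [sub_nonneg, ← div_le_iff_of_neg hk] at this
  refine ⟨k, hk, fun l => ?_⟩
  rw [sub_nonneg]
  rcases lt_trichotomy (D l) 0 with hl | hl | hl
  · rw [← div_le_iff_of_neg hl]
    exact hmax l (by simpa using hl)
  · have := h l
    rw [hl, mul_zero, sub_zero] at this
    rw [hl, mul_zero]
    exact this
  · have h1 := h l
    rw [sub_nonneg, ← le_div_iff₀ hl] at h1
    rw [← le_div_iff₀ hl]
    exact hjk.trans h1

open Classical in
-- The interval is empty, or has two ends, each attained by one coordinate: `D` is positive at the
-- upper one and negative at the lower one.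
lemma sum_sign_feasible [Fintype ι] {x D : ι → ℝ} (hpos : ∃ j, 0 < D j) (hneg : ∃ j, D j < 0)
    (hgen : ∀ j k, D j ≠ 0 → j ≠ k → x k - x j / D j * D k ≠ 0) :
    ∑ j, ((SignType.sign (D j) : ℤ) * if Feasible x D j then 1 else 0) = 0 := by
  have hgen' : ∀ j k, (-D) j ≠ 0 → j ≠ k → x k - x j / (-D) j * (-D) k ≠ 0 := fun j k hj hjk => by
    have := hgen j k (by simpa using hj) hjk
    simpa only [Pi.neg_apply, div_neg, neg_mul, mul_neg, neg_neg] using this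
  by_cases hex : ∃ j, 0 < D j ∧ Feasible x D j
  · obtain ⟨j, hj, hfj⟩ := hex
    obtain ⟨k, hk, hfk⟩ := hfj.exists_neg hneg
    have hjk : j ≠ k := by rintro rfl; exact lt_asymm hj hk
    rw [← Finset.sum_subset (Finset.subset_univ {j, k}), Finset.sum_pair hjk]
    · simp [sign_pos hj, sign_neg hk, hfj, hfk]
    · intro l _ hl
      simp only [Finset.mem_insert, Finset.mem_singleton, not_or] at hl
      rcases lt_trichotomy (D l) 0 with h | h | h
      · rw [if_neg, mul_zero]
        intro hfl
        refine hl.2 (Feasible.unique hgen' (j := l) (j' := k) ?_ ?_ ?_ ?_)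
        · simpa using h
        · simpa using hk
        · rwa [feasible_neg_iff]
        · rwa [feasible_neg_iff]
      · simp [h]
      · rw [if_neg, mul_zero]
        exact fun hfl => hl.1 (Feasible.unique hgen h hj hfl hfj)
  · refine Finset.sum_eq_zero fun l _ => ?_
    rcases lt_trichotomy (D l) 0 with h | h | h
    · rw [if_neg, mul_zero]
      intro hfl
      have hfl' : Feasible x (-D) l := by rwa [feasible_neg_iff]
      obtain ⟨k, hk, hfk⟩ := hfl'.exists_neg
        (by obtain ⟨k, hk⟩ := hpos; exact ⟨k, by simpa using hk⟩)
      exact hex ⟨k, by simpa using hk, by rwa [feasible_neg_iff] at hfk⟩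
    · simp [h]
    · rw [if_neg, mul_zero]
      exact fun hfl => hex ⟨l, h, hfl⟩

end Feasibility

/-! ### The cocycle relation for cones at a point -/

section ConeCocycle

variable {F : Type} [Field F] {n : ℕ}

/-- The coordinate at σ is the expansion, along its first row, of a determinant in which the row of
σ occurs twice. -/
lemma sum_det_smul_eq_zero (τ : Fin n ≃ (F →+* ℝ)) (v : Fin (n + 1) → RealSpace F) :
    ∑ j : Fin (n + 1), ((-1) ^ (j : ℕ) * (spaceBasis τ).det (v ∘ j.succAbove)) • v j = 0 := by
  funext σ
  let M : Matrix (Fin (n + 1)) (Fin (n + 1)) ℝ :=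
    Matrix.of (Fin.cons (fun j => v j σ) fun i j => v j (τ i))
  have hM : M.det = 0 :=
    Matrix.det_zero_of_row_eq (Fin.succ_ne_zero (τ.symm σ)).symm (by
      funext j
      simp [M])
  rw [Matrix.det_succ_row_zero] at hM
  rw [Finset.sum_apply, Pi.zero_apply, ← hM]
  refine Finset.sum_congr rfl fun j _ => ?_
  rw [spaceBasis_det_apply, Pi.smul_apply, smul_eq_mul]
  have e : M.submatrix Fin.succ j.succAbove =
      Matrix.of fun i k => (v ∘ j.succAbove) k (τ i) := by
    ext i k
    simp [M]
  rw [e]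
  simp only [M, Matrix.of_apply, Fin.cons_zero]
  ring

open Classical in
/-- The signed indicator functions of simplicial cones in the positive orthant form a cocycle at
points in general position. -/
lemma sum_sign_mem_vectorCone (τ : Fin n ≃ (F →+* ℝ)) {v : Fin (n + 1) → RealSpace F} {σ : F →+* ℝ}
    (hv : ∀ j, 0 < v j σ) {y : RealSpace F}
    (hy : ∀ j k, j ≠ k → y ∉ Submodule.span ℝ (v '' {j, k}ᶜ)) :
    ∑ j : Fin (n + 1), (-1) ^ (j : ℕ) *
      ((SignType.sign ((spaceBasis τ).det (v ∘ j.succAbove)) : ℤ) *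
        if y ∈ vectorCone (v ∘ j.succAbove) then 1 else 0) = 0 := by
  set D : Fin (n + 1) → ℝ := fun j => (-1) ^ (j : ℕ) * (spaceBasis τ).det (v ∘ j.succAbove) with hD
  have hrel : ∑ j, D j • v j = 0 := sum_det_smul_eq_zero τ v
  have hsign : ∀ j : Fin (n + 1), (SignType.sign (D j) : ℤ) =
      (-1) ^ (j : ℕ) * (SignType.sign ((spaceBasis τ).det (v ∘ j.succAbove)) : ℤ) := fun j => by
    rw [hD]
    rcases neg_one_pow_eq_or ℝ (j : ℕ) with h | h
    · have h' : ((-1 : ℤ)) ^ (j : ℕ) = 1 := by exact_mod_cast h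
      simp only [h, h', one_mul]
    · have h' : ((-1 : ℤ)) ^ (j : ℕ) = -1 := by exact_mod_cast h
      simp only [h, h', neg_mul, one_mul, Left.sign_neg, SignType.coe_neg]
  simp only [← mul_assoc, ← hsign]
  by_cases hall : ∀ j, D j = 0
  · simp [hall]
  push Not at hall
  have hdet : ∀ j, D j ≠ 0 → LinearIndependent ℝ (v ∘ j.succAbove) := fun j hj =>
    (det_ne_zero_iff τ _).1 (right_ne_zero_of_mul hj)
  have hcoord : ∑ j, D j * v j σ = 0 := by
    have := congrFun hrel σ
    simpa using this
  -- All `v j` have a positive coordinate at σ, so a nontrivial relation among them has coefficients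
  -- of both signs.
  have hpos : ∃ j, 0 < D j := by
    by_contra! hcon
    obtain ⟨j, hj⟩ := hall
    have h1 := (Finset.sum_eq_zero_iff_of_nonpos fun k _ =>
      mul_nonpos_of_nonpos_of_nonneg (hcon k) (hv k).le).1 hcoord j (Finset.mem_univ j)
    exact (mul_ne_zero hj (hv j).ne') h1
  have hneg : ∃ j, D j < 0 := by
    by_contra! hcon
    obtain ⟨j, hj⟩ := hall
    have h1 := (Finset.sum_eq_zero_iff_of_nonneg fun k _ =>
      mul_nonneg (hcon k) (hv k).le).1 hcoord j (Finset.mem_univ j)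
    exact (mul_ne_zero hj (hv j).ne') h1
  obtain ⟨x, hx⟩ : ∃ x : Fin (n + 1) → ℝ, y = ∑ k, x k • v k := by
    obtain ⟨j, hj⟩ := hall
    have hfd := finiteDimensional_realSpace τ
    have hmem : y ∈ Submodule.span ℝ (Set.range v) := by
      have h1 := (hdet j hj).span_eq_top_of_card_eq_finrank'
        (by rw [finrank_realSpace τ, Fintype.card_fin])
      have h2 : Submodule.span ℝ (Set.range (v ∘ j.succAbove)) ≤ Submodule.span ℝ (Set.range v) :=
        Submodule.span_mono (Set.range_comp_subset_range _ _)
      exact h2 (h1 ▸ Submodule.mem_top)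
    obtain ⟨x, hx⟩ := (Submodule.mem_span_range_iff_exists_fun ℝ).1 hmem
    exact ⟨x, hx.symm⟩
  -- When `D j ≠ 0`, this multiple of the relation removes `v j` from the expression of `y`.
  -- Membership in the cone without `v j` thus becomes feasibility at `j`.
  have hshift : ∀ j, y = ∑ k, (x k - x j / D j * D k) • v k := fun j => by
    simp only [sub_smul, Finset.sum_sub_distrib, mul_smul, ← Finset.smul_sum, hrel, smul_zero,
      sub_zero, hx]
  have hshift' : ∀ j, D j ≠ 0 →
      y = ∑ k, (x (j.succAbove k) - x j / D j * D (j.succAbove k)) • v (j.succAbove k) :=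
    fun j hj => by
      have h1 := hshift j
      rw [Fin.sum_univ_succAbove _ j, div_mul_cancel₀ _ hj, sub_self, zero_smul, zero_add] at h1
      exact h1
  have hgen : ∀ j k, D j ≠ 0 → j ≠ k → x k - x j / D j * D k ≠ 0 := fun j k hj hjk h0 => by
    refine hy j k hjk ?_
    rw [hshift j]
    refine Submodule.sum_mem _ fun i _ => ?_
    rcases eq_or_ne i j with rfl | hij
    · rw [div_mul_cancel₀ _ hj, sub_self, zero_smul]; exact zero_mem _
    rcases eq_or_ne i k with rfl | hik
    · rw [h0, zero_smul]; exact zero_mem _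
    · exact Submodule.smul_mem _ _ (Submodule.subset_span ⟨i, by simp [hij, hik], rfl⟩)
  have hmem : ∀ j, D j ≠ 0 → (y ∈ vectorCone (v ∘ j.succAbove) ↔ Feasible x D j) :=
    fun j hj => by
      constructor
      · rintro ⟨z, hz, hyz⟩ k
        have hc := coeff_eq_of_linearIndependent (hdet j hj) (hyz.symm.trans (hshift' j hj))
        rcases Fin.eq_self_or_eq_succAbove j k with hk | ⟨k, rfl⟩
        · rw [hk, div_mul_cancel₀ _ hj, sub_self]
        · have h1 := congrFun hc k
          exact (hz k).trans h1.le
      · intro h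
        exact ⟨_, fun k => h (j.succAbove k), hshift' j hj⟩
  refine Eq.trans ?_ (sum_sign_feasible hpos hneg hgen)
  refine Finset.sum_congr rfl fun j _ => ?_
  by_cases hj : D j = 0
  · simp [hj]
  · simp only [hmem j hj]

end ConeCocycle

/-! ### Points in general position -/

section GenericPoint

open NumberField

variable {F : Type} [Field F] {ξ : AddChar (𝓞 F) ℂ}

variable (ξ) in
/-- A totally positive point outside all proper subspaces spanned by tuples in `A_ξ`. -/
def IsGeneric (n : ℕ) (x : RealSpace F) : Prop :=
  (∀ τ, 0 < x τ) ∧ ∀ m ≤ n, ∀ b : Fin m → PrimitiveSet ξ, x ∉ Submodule.span ℝ (Set.range (tupleVec b))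

/-- Δ_ξ permutes A_ξ, hence permutes the excluded subspaces. -/
lemma IsGeneric.unitMul {n : ℕ} {x : RealSpace F} (hx : IsGeneric ξ n x) (u : stabilizer ξ) :
    IsGeneric ξ n (unitMul (u : (𝓞 F)ˣ) x) := by
  refine ⟨fun τ => mul_pos (u.2.1 τ) (hx.1 τ), fun m hm b hb => hx.2 m hm (u⁻¹ • b) ?_⟩
  have e : Set.range (tupleVec (u⁻¹ • b)) =
      ShintaniEcc.unitMul ((u⁻¹ : stabilizer ξ) : (𝓞 F)ˣ) '' Set.range (tupleVec b) := by
    rw [← Set.range_comp]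
    congr 1
    funext i
    exact tupleVec_smul u⁻¹ b i
  rw [e, ← Submodule.map_span]
  exact ⟨_, hb, unitMul_inv_cancel _ x⟩

lemma IsGeneric.coeff_pos {n : ℕ} {x : RealSpace F} (hx : IsGeneric ξ n x)
    {a : Fin (n + 1) → PrimitiveSet ξ} {z : Fin (n + 1) → ℝ} (hz : ∀ i, 0 ≤ z i)
    (h : x = ∑ i, z i • tupleVec a i) (i : Fin (n + 1)) : 0 < z i := by
  refine (hz i).lt_of_ne fun h0 => hx.2 n le_rfl (a ∘ i.succAbove) ?_
  rw [h, Fin.sum_univ_succAbove _ i, ← h0, zero_smul, zero_add]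
  exact Submodule.sum_mem _ fun k _ => Submodule.smul_mem _ _ (Submodule.subset_span ⟨k, rfl⟩)

lemma IsGeneric.mem_intrinsicInterior {n : ℕ} (τ : Fin (n + 1) ≃ (F →+* ℝ)) {x : RealSpace F}
    (hx : IsGeneric ξ n x) {a : Fin (n + 1) → PrimitiveSet ξ}
    (ha : LinearIndependent ℝ (tupleVec a)) (h : x ∈ tupleCone a) :
    x ∈ intrinsicInterior ℝ (tupleCone a) := by
  have hfd := finiteDimensional_realSpace τ
  obtain ⟨z, hz, rfl⟩ := h
  exact interior_subset_intrinsicInterior (mem_interior_vectorCone ha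
    (by rw [finrank_realSpace τ, Fintype.card_fin]) (hx.coeff_pos hz rfl))

lemma IsGeneric.not_mem_span {n : ℕ} {x : RealSpace F} (hx : IsGeneric ξ n x)
    (a : Fin (n + 2) → PrimitiveSet ξ) (j k : Fin (n + 2)) (hjk : j ≠ k) :
    x ∉ Submodule.span ℝ (tupleVec a '' {j, k}ᶜ) := by
  intro hmem
  obtain ⟨k, rfl⟩ := Fin.exists_succAbove_eq hjk.symm
  refine hx.2 n le_rfl (a ∘ j.succAbove ∘ k.succAbove) (Submodule.span_mono ?_ hmem)
  rintro _ ⟨i, hi, rfl⟩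
  simp only [Set.mem_compl_iff, Set.mem_insert_iff, Set.mem_singleton_iff, not_or] at hi
  obtain ⟨i, rfl⟩ := Fin.exists_succAbove_eq hi.1
  have hik : i ≠ k := fun h => hi.2 (by rw [h])
  obtain ⟨i, rfl⟩ := Fin.exists_succAbove_eq hik
  exact ⟨i, rfl⟩

variable [NumberField F]

lemma countable_primitiveSet : Countable (PrimitiveSet ξ) := by
  have : Countable (𝓞 F) := (RingOfIntegers.basis F).equivFun.toEquiv.countable_iff.2 inferInstance
  exact Subtype.countable

variable (ξ) in
-- A_ξ is countable and at most n vectors span a proper subspace, so the excluded set has measure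
-- zero, while the open orthant has positive measure.
lemma exists_isGeneric {n : ℕ} (τ : Fin (n + 1) ≃ (F →+* ℝ)) : ∃ x, IsGeneric ξ n x := by
  by_contra! hcon
  have := countable_primitiveSet (ξ := ξ)
  have hfd := finiteDimensional_realSpace τ
  let U : Set (RealSpace F) := {x | ∀ σ, 0 < x σ}
  have hU : IsOpen U := by
    have : U = ⋂ σ, {x | 0 < x σ} := by ext; simp [U]
    rw [this]
    exact isOpen_iInter_of_finite fun σ => isOpen_lt continuous_const (continuous_apply σ)
  have hUne : U.Nonempty := ⟨fun _ => 1, fun _ => zero_lt_one⟩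
  have hnull : MeasureTheory.volume (⋃ b : Σ m : Fin (n + 1), Fin m → PrimitiveSet ξ,
      (Submodule.span ℝ (Set.range (tupleVec b.2)) : Set (RealSpace F))) = 0 := by
    refine MeasureTheory.measure_iUnion_null fun b => ?_
    refine MeasureTheory.Measure.addHaar_submodule _ _ fun htop => ?_
    have h1 := finrank_range_le_card (R := ℝ) (tupleVec b.2)
    rw [Set.finrank, htop, finrank_top, finrank_realSpace τ, Fintype.card_fin] at h1
    exact absurd b.1.2 (by omega)
  refine (hU.measure_pos MeasureTheory.volume hUne).ne' (MeasureTheory.measure_mono_null ?_ hnull)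
  intro x hx
  have := hcon x
  simp only [IsGeneric, not_and, not_forall, not_not] at this
  obtain ⟨m, hm, b, hb⟩ := this hx
  exact Set.mem_iUnion.2 ⟨⟨⟨m, by omega⟩, b⟩, hb⟩

end GenericPoint

/-! ### The cocycle of a generic point -/

section PointCocycle

open NumberField
open scoped Classical

variable {F : Type} [Field F] {ξ : AddChar (𝓞 F) ℂ}

/-- The indicator of `u x ∈ σ_a`. -/
def orbitIndicator (x : RealSpace F) {n : ℕ} (a : Fin n → PrimitiveSet ξ) (u : stabilizer ξ) : ℤ :=
  if unitMul (u : (𝓞 F)ˣ) x ∈ tupleCone a then 1 else 0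

/-- The number of points of the orbit of `x` in `σ_a`, with the sign of `a`. -/
def pointCocycle {n : ℕ} (τ : Fin n ≃ (F →+* ℝ)) (x : RealSpace F) (a : Fin n → PrimitiveSet ξ) : ℤ :=
  tupleSign τ a * ∑ᶠ u, orbitIndicator x a u

lemma orbitIndicator_smul (x : RealSpace F) {n : ℕ} (a : Fin n → PrimitiveSet ξ)
    (v u : stabilizer ξ) : orbitIndicator x (v • a) (v * u) = orbitIndicator x a u := by
  rw [orbitIndicator, orbitIndicator]
  congr 1
  rw [← unitScale_tupleCone, unitScale_eq_image, Subgroup.coe_mul, unitMul_mul]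
  exact propext (unitMul_injective _).mem_set_image

lemma pointCocycle_smul {n : ℕ} (τ : Fin n ≃ (F →+* ℝ)) (x : RealSpace F) (u : stabilizer ξ)
    (a : Fin n → PrimitiveSet ξ) : pointCocycle τ x (u • a) = pointCocycle τ x a := by
  rw [pointCocycle, pointCocycle, tupleSign_smul]
  congr 1
  rw [← finsum_comp_equiv (Equiv.mulLeft u)]
  exact finsum_congr fun v => orbitIndicator_smul x a u v

lemma pointCocycle_comp_perm {n : ℕ} (τ : Fin n ≃ (F →+* ℝ)) (x : RealSpace F)
    (a : Fin n → PrimitiveSet ξ) (ρ : Equiv.Perm (Fin n)) :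
    pointCocycle τ x (a ∘ ρ) = Equiv.Perm.sign ρ * pointCocycle τ x a := by
  have e : tupleCone (a ∘ ρ) = tupleCone a := vectorCone_comp_equiv (tupleVec a) ρ
  rw [pointCocycle, pointCocycle, tupleSign_comp_perm, mul_assoc]
  simp only [orbitIndicator, e]

lemma pointCocycle_eq_zero {n : ℕ} (τ : Fin n ≃ (F →+* ℝ)) (x : RealSpace F)
    {a : Fin n → PrimitiveSet ξ} (ha : ¬ Function.Injective a) : pointCocycle τ x a = 0 := by
  have h : (spaceBasis τ).det (tupleVec a) = 0 := by
    by_contra hne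
    exact ha (injective_of_linearIndependent ((det_ne_zero_iff τ _).1 hne))
  rw [pointCocycle, tupleSign_eq, h]
  simp

variable [NumberField F] [NumberField.IsTotallyReal F]

/-- If u x lies in the cone, then u⁻¹ moves a point of the cone into a box around `x`, so
`finite_units_meeting` applies. -/
lemma finite_support_orbitIndicator {x : RealSpace F} (hx : ∀ τ, 0 < x τ) {n : ℕ}
    (a : Fin n → PrimitiveSet ξ) : (Function.support (orbitIndicator x a)).Finite := by
  have := exists_real F
  obtain ⟨σ₀, hσ₀⟩ := Finite.exists_min x
  obtain ⟨σ₁, hσ₁⟩ := Finite.exists_max x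
  have hfin := finite_units_meeting (b := fun i => (a i).1) (fun i => (a i).2.1.1)
    (lo := x σ₀) (hi := x σ₁) (hx σ₀)
  refine Set.Finite.of_finite_image (f := fun u : stabilizer ξ => ((u⁻¹ : stabilizer ξ) : (𝓞 F)ˣ))
    (hfin.subset ?_) ?_
  · rintro _ ⟨u, hu, rfl⟩
    have hmem : unitMul (u : (𝓞 F)ˣ) x ∈ tupleCone a := by
      by_contra hcon
      exact hu (if_neg hcon)
    refine ⟨u⁻¹.2.1, _, hmem, fun σ => ?_⟩
    have e : σ (((u⁻¹ : stabilizer ξ) : (𝓞 F)ˣ) : F) * unitMul (u : (𝓞 F)ˣ) x σ = x σ :=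
      congrFun (unitMul_inv_cancel (u : (𝓞 F)ˣ) x) σ
    rw [e]
    exact ⟨hσ₀ σ, hσ₁ σ⟩
  · intro u _ v _ h
    exact inv_injective (Subtype.ext h)

/-- Every point of the orbit is generic, so the relation holds pointwise in `u`; finite supports
permit summing over the orbit. -/
lemma sum_pointCocycle {n : ℕ} (τ : Fin (n + 1) ≃ (F →+* ℝ)) {x : RealSpace F}
    (hx : IsGeneric ξ n x) (a : Fin (n + 2) → PrimitiveSet ξ) :
    ∑ j : Fin (n + 2), (-1) ^ (j : ℕ) * pointCocycle τ x (a ∘ j.succAbove) = 0 := by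
  have hfin := fun j : Fin (n + 2) => finite_support_orbitIndicator hx.1 (a ∘ j.succAbove)
  have e : ∀ j : Fin (n + 2), (-1) ^ (j : ℕ) * pointCocycle τ x (a ∘ j.succAbove) =
      ∑ᶠ u, (-1) ^ (j : ℕ) * (tupleSign τ (a ∘ j.succAbove) *
        orbitIndicator x (a ∘ j.succAbove) u) := fun j => by
    rw [pointCocycle, mul_finsum, mul_finsum]
  simp only [e]
  rw [← finsum_sum_comm]
  · refine finsum_eq_zero_of_forall_eq_zero fun u => ?_
    have h := sum_sign_mem_vectorCone τ (v := tupleVec a) (σ := τ 0) (fun j => tupleVec_pos a j _)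
      (y := unitMul (u : (𝓞 F)ˣ) x) (fun j k hjk => (hx.unitMul u).not_mem_span a j k hjk)
    rw [← h]
    refine Finset.sum_congr rfl fun j _ => ?_
    rw [tupleSign_eq]
    rfl
  · intro j _
    exact (hfin j).subset ((Function.support_mul_subset_right _ _).trans
      (Function.support_mul_subset_right _ _))

/-- The orbit sum of the cocycle of a generic point is `1`. -/
lemma sum_orbits_pointCocycle {n : ℕ} (τ : Fin (n + 1) ≃ (F →+* ℝ)) {x : RealSpace F}
    (hx : IsGeneric ξ n x) {Φ : Set (Set (RealSpace F))} {Γ : Subgroup (𝓞 F)ˣ}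
    (hΦ : IsShintaniDecomposition Γ Φ) (hΓ : stabilizer ξ ≤ Γ) (hgen : HasGeneratorsIn ξ Φ)
    [Fintype (ConeOrbits ξ Φ (n + 1))]
    {a : ConeOrbits ξ Φ (n + 1) → Fin (n + 1) → PrimitiveSet ξ}
    (ha : IsGeneratorSystem ξ Φ (n + 1) a) :
    ∑ c, tupleSign τ (a c) * pointCocycle τ x (a c) = 1 := by
  have hfd := finiteDimensional_realSpace τ
  obtain ⟨σ, hσ, hxσ⟩ := hΦ.exists_mem hx.1
  have hxσ' := intrinsicInterior_subset hxσ
  -- A cone of smaller dimension lies in the span of at most n elements of A_ξ, which `x` avoids.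
  have hdim : coneDim σ = n + 1 := by
    obtain ⟨b, hb⟩ := hgen.exists_tuple hσ rfl
    have h1 : coneDim σ ≤ n + 1 := by
      rw [coneDim, ← finrank_realSpace τ]; exact Submodule.finrank_le _
    refine le_antisymm h1 (Nat.succ_le_of_lt ?_)
    by_contra hlt
    refine hx.2 _ (not_lt.1 hlt) b ?_
    rw [← span_vectorCone, ← tupleCone_eq, hb]
    exact Submodule.subset_span hxσ'
  obtain ⟨b, hb⟩ := hgen.exists_tuple hσ hdim
  have hbtop : IsTopTuple Φ b :=
    ⟨hb ▸ hσ, linearIndependent_of_coneDim (by rw [← tupleCone_eq, hb, hdim])⟩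
  obtain ⟨c₀, u₀, ρ₀, h₀⟩ := ha.exists_smul_eq_comp hbtop
  have hxb : x ∈ tupleCone b := hb ▸ hxσ'
  have hub : ∀ u : stabilizer ξ, unitMul (u : (𝓞 F)ˣ) x ∈ tupleCone (u • b) := fun u => by
    rw [← unitScale_tupleCone]; exact ⟨x, hxb, rfl⟩
  have hcone₀ : tupleCone (a c₀ ∘ ρ₀) = tupleCone (a c₀) :=
    vectorCone_comp_equiv (tupleVec (a c₀)) ρ₀
  have hmem₀ : unitMul (u₀ : (𝓞 F)ˣ) x ∈ tupleCone (a c₀) := by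
    rw [← hcone₀, ← h₀]; exact hub u₀
  -- If u x lies in the representative cone of `c`, then that cone is u times the cone of `x`. This
  -- determines the orbit `c`, and by freeness of the action it determines `u`.
  have huniq : ∀ c (u : stabilizer ξ), unitMul (u : (𝓞 F)ˣ) x ∈ tupleCone (a c) →
      c = c₀ ∧ u = u₀ := by
    intro c u hcu
    have hutop := IsTopTuple.smul hΦ hΓ hbtop u
    have hcone : tupleCone (u • b) = tupleCone (a c) :=
      hΦ.disjoint_interior.elim_set hutop.1 (ha.isTopTuple c).1 _
        ((hx.unitMul u).mem_intrinsicInterior τ hutop.2 (hub u))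
        ((hx.unitMul u).mem_intrinsicInterior τ (ha.isTopTuple c).2 hcu)
    obtain ⟨ρ, hρ⟩ := exists_perm_of_tupleCone_eq hutop.2 hcone
    have hq : (c, ρ) = (c₀, ρ₀) := (generatorSystem_bijective ha).1 <| Quotient.sound
      ⟨u₀ * u⁻¹, by
        change (u₀ * u⁻¹) • (a c ∘ ρ) = a c₀ ∘ ρ₀
        rw [← hρ, ← h₀, mul_smul, inv_smul_smul]⟩
    obtain ⟨rfl, rfl⟩ := Prod.mk.inj hq
    refine ⟨rfl, ?_⟩
    have h1 : (u₀⁻¹ * u) • b 0 = b 0 := by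
      have h2 : u • b 0 = u₀ • b 0 := congrFun (hρ.trans h₀.symm) 0
      rw [mul_smul, h2, inv_smul_smul]
    exact (inv_mul_eq_one.1 (stabilizer_free ξ (τ 0) _ _ h1)).symm
  have hval : ∀ c, tupleSign τ (a c) * pointCocycle τ x (a c) =
      ∑ᶠ u, orbitIndicator x (a c) u := fun c => by
    rw [pointCocycle, ← mul_assoc, tupleSign_sq τ (ha.isTopTuple c).2, one_mul]
  simp only [hval]
  rw [Finset.sum_eq_single c₀]
  · rw [finsum_eq_single _ u₀]
    · exact if_pos hmem₀
    · intro u hu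
      exact if_neg fun h => hu (huniq c₀ u h).2
  · intro c _ hc
    exact finsum_eq_zero_of_forall_eq_zero fun u => if_neg fun h => hc (huniq c u h).1
  · intro h; exact (h (Finset.mem_univ _)).elim

end PointCocycle

/-! ### The orbit sum as a functional on cohomology -/

section OrbitSumFunctional

open NumberField

variable {F : Type} [Field F] {ξ : AddChar (𝓞 F) ℂ}

lemma orbitSum_eq {Φ : Set (Set (RealSpace F))} {n : ℕ} (τ : Fin (n + 1) ≃ (F →+* ℝ))
    [Fintype (ConeOrbits ξ Φ (n + 1))]
    (a : ConeOrbits ξ Φ (n + 1) → Fin (n + 1) → PrimitiveSet ξ) (z : (CechComplex ξ).cycles n) :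
    orbitSum ξ Φ τ a z = ∑ c, tupleSign τ (a c) • cocycleFun z (a c) :=
  finsum_eq_sum_of_fintype _

variable [NumberField F] [NumberField.IsTotallyReal F]

lemma orbitSum_eq_zero {Φ : Set (Set (RealSpace F))} {Γ : Subgroup (𝓞 F)ˣ}
    (hΦ : IsShintaniDecomposition Γ Φ) (hΓ : stabilizer ξ ≤ Γ) (hΓ' : Γ ≤ totallyPositiveUnits F)
    (hgen : HasGeneratorsIn ξ Φ) {n : ℕ} (hfin : Finite (ConeOrbits ξ Φ (n + 1)))
    (τ : Fin (n + 1) ≃ (F →+* ℝ)) {a : ConeOrbits ξ Φ (n + 1) → Fin (n + 1) → PrimitiveSet ξ}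
    (ha : IsGeneratorSystem ξ Φ (n + 1) a) {z : (CechComplex ξ).cycles n}
    (hz : (CechComplex ξ).homologyπ n z = 0) : orbitSum ξ Φ τ a z = 0 := by
  have := Fintype.ofFinite (ConeOrbits ξ Φ (n + 1))
  have := finite_topTupleOrbits hgen hfin
  have := Fintype.ofFinite (TopTupleOrbits ξ Φ (n + 1))
  rw [orbitSum_eq]
  -- For g = 1 a cocycle with zero class is itself zero. For g ≥ 2 it is a coboundary, and the
  -- factorial relating tuples to cones is invertible.
  cases n with
  | zero => simp [cocycleFun_eq_zero_of_homologyπ hz]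
  | succ n =>
    obtain ⟨θ, -, hinv, h⟩ := homologyπ_eq_zero_iff_exists.1 hz
    have h1 := sum_signedValue τ ha (cochainFun_mem ((CechComplex ξ).iCycles (n + 1) z))
      (cochainFun_smul _)
    have h2 := sum_signedValue_altDiff hΦ hΓ hΓ' hgen τ hinv
    rw [← h] at h2
    have h3 := h1.symm.trans h2
    exact (mul_eq_zero.1 h3).resolve_left (Nat.cast_ne_zero.2 (Nat.factorial_ne_zero _))

/-- There is a cocycle whose orbit sum is `1` for every Shintani decomposition. -/
lemma exists_cocycle_orbitSum_eq_one (ξ : AddChar (𝓞 F) ℂ) {n : ℕ} (τ : Fin (n + 1) ≃ (F →+* ℝ)) :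
    ∃ z : (CechComplex ξ).cycles n, ∀ (Γ : Subgroup (𝓞 F)ˣ) (Φ : Set (Set (RealSpace F))),
      stabilizer ξ ≤ Γ → IsShintaniDecomposition Γ Φ → HasGeneratorsIn ξ Φ →
      Finite (ConeOrbits ξ Φ (n + 1)) → ∀ a, IsGeneratorSystem ξ Φ (n + 1) a →
      orbitSum ξ Φ τ a z = 1 := by
  obtain ⟨x, hx⟩ := exists_isGeneric ξ τ
  obtain ⟨z, hz⟩ := exists_cocycleFun_eq (K := valueField ξ) (G := stabilizer ξ)
    (f := fun a : Fin (n + 1) → PrimitiveSet ξ => (pointCocycle τ x a : valueField ξ))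
    ⟨fun ρ a => by simp only [pointCocycle_comp_perm, Int.cast_mul],
      fun a ha => by simp only [pointCocycle_eq_zero τ x ha, Int.cast_zero]⟩
    (fun u a => by rw [pointCocycle_smul])
    (funext fun a => by
      have := congrArg (Int.cast (R := valueField ξ)) (sum_pointCocycle τ hx a)
      rw [Int.cast_sum, Int.cast_zero] at this
      rw [altDiff, Pi.zero_apply, ← this]
      exact Finset.sum_congr rfl fun j _ => by push_cast; rfl)
  refine ⟨z, fun Γ Φ hΓ hΦ hgen hfin a ha => ?_⟩
  have := Fintype.ofFinite (ConeOrbits ξ Φ (n + 1))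
  rw [orbitSum_eq, hz]
  have h := congrArg (Int.cast (R := valueField ξ)) (sum_orbits_pointCocycle τ hx hΦ hΓ hgen ha)
  rw [Int.cast_sum, Int.cast_one] at h
  rw [← h]
  exact Finset.sum_congr rfl fun c _ => by rw [zsmul_eq_mul, Int.cast_mul]

end OrbitSumFunctional

end
end ShintaniEcc

/-! ### The main theorem -/

open ShintaniEcc NumberField

theorem proposition5p5 (F : Type) [Field F] [NumberField F] [NumberField.IsTotallyReal F]
    (n : ℕ) (hn : Module.finrank ℚ F = n + 1) (τ : Fin (n + 1) ≃ (F →+* ℝ))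
    (ξ : AddChar (𝓞 F) ℂ) (htors : IsOfFinOrder ξ) (hξ : ξ ≠ 1)
    (Γ : Subgroup (𝓞 F)ˣ) (hΓ : stabilizer ξ ≤ Γ) (hΓ' : Γ ≤ totallyPositiveUnits F)
    (Φ : Set (Set (RealSpace F))) (hΦ : IsShintaniDecomposition Γ Φ)
    (hgen : HasGeneratorsIn ξ Φ) :
    Finite (ConeOrbits ξ Φ (n + 1)) ∧
    ∃ κ : (CechComplex ξ).homology n ≅ PointCohomology ξ n,
      (∀ f, IsCechComparison (valueField ξ) (stabilizer ξ) (PrimitiveSet ξ) n f ↔ f = κ.hom) ∧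
      ∃ e : PointCohomology ξ n ≃ₗ[valueField ξ] valueField ξ,
        (∀ e' : PointCohomology ξ n →ₗ[valueField ξ] valueField ξ,
          (∀ z a, IsGeneratorSystem ξ Φ (n + 1) a →
            e' (κ.hom ((CechComplex ξ).homologyπ n z)) = orbitSum ξ Φ τ a z) ↔
          e' = e.toLinearMap) ∧
        ∀ (Γ' : Subgroup (𝓞 F)ˣ) (Φ' : Set (Set (RealSpace F))), stabilizer ξ ≤ Γ' →
          Γ' ≤ totallyPositiveUnits F → IsShintaniDecomposition Γ' Φ' → HasGeneratorsIn ξ Φ' →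
          ∀ z a, IsGeneratorSystem ξ Φ' (n + 1) a →
            e (κ.hom ((CechComplex ξ).homologyπ n z)) = orbitSum ξ Φ' τ a z := by
  have hfin := finite_coneOrbits htors hΓ' hΦ (ξ := ξ) (n + 1)
  refine ⟨hfin, ?_⟩
  obtain ⟨a₀, ha₀⟩ := hgen.exists_isGeneratorSystem (n + 1)
  obtain ⟨z₁, hz₁⟩ := exists_cocycle_orbitSum_eq_one ξ τ
  have hz₁Φ := hz₁ Γ Φ hΓ hΦ hgen hfin a₀ ha₀
  have hfree := stabilizer_free ξ (τ 0)
  -- Without elements of A_ξ there would be no cone orbits, and the orbit sum of `z₁` would be 0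
  -- instead of 1.
  obtain ⟨s₀⟩ : Nonempty (PrimitiveSet ξ) := by
    by_contra hempty
    have hcone : IsEmpty (ConeOrbits ξ Φ (n + 1)) := ⟨fun c => hempty ⟨a₀ c 0⟩⟩
    have : orbitSum ξ Φ τ a₀ z₁ = 0 := finsum_of_isEmpty _
    rw [this] at hz₁Φ
    exact zero_ne_one hz₁Φ
  obtain ⟨κ, hκ⟩ := exists_cechComparison_iso (valueField ξ) (stabilizer ξ) hfree s₀ n
  obtain ⟨r, b, χ, hr, hb, hχ⟩ := exists_stabilizer_basis ξ hn (τ 0)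
  obtain ⟨z₀, hz₀⟩ := exists_homology_generator (valueField ξ) hfree s₀ b
    (fun i j => mul_comm (b i) (b j)) hb χ hχ hr
  have hadd : ∀ (Φ' : Set (Set (RealSpace F))) a, Finite (ConeOrbits ξ Φ' (n + 1)) →
      ∀ (c : valueField ξ) (z w : (CechComplex ξ).cycles n),
      orbitSum ξ Φ' τ a (z - c • w) = orbitSum ξ Φ' τ a z - c * orbitSum ξ Φ' τ a w := by
    intro Φ' a hfin' c z w
    have := Fintype.ofFinite (ConeOrbits ξ Φ' (n + 1))
    simp only [orbitSum_eq, map_sub, map_smul, Pi.sub_apply, Pi.smul_apply, smul_sub,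
      Finset.sum_sub_distrib, smul_eq_mul, Finset.mul_sum, mul_smul_comm]
  set x := κ.hom ((CechComplex ξ).homologyπ n z₁) with hx
  have hπκ : Function.Surjective fun z => κ.hom ((CechComplex ξ).homologyπ n z) :=
    ((ConcreteCategory.bijective_of_isIso κ.hom).2).comp (homologyπ_surjective _ n)
  have hzero : ∀ {z}, κ.hom ((CechComplex ξ).homologyπ n z) = 0 →
      (CechComplex ξ).homologyπ n z = 0 := fun {z} h =>
    (ConcreteCategory.bijective_of_isIso κ.hom).1 (h.trans (map_zero _).symm)
  have hx0 : x ≠ 0 := fun h => by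
    rw [orbitSum_eq_zero hΦ hΓ hΓ' hgen hfin τ ha₀ (hzero h)] at hz₁Φ
    exact zero_ne_one hz₁Φ
  -- The space has dimension at most one, and `x` is nonzero because its orbit sum is.
  have hspan : ∀ y : PointCohomology ξ n, ∃ c : valueField ξ, c • x = y := by
    intro y
    obtain ⟨z, rfl⟩ := hπκ y
    obtain ⟨c, hc⟩ := hz₀ z
    obtain ⟨c₁, hc₁⟩ := hz₀ z₁
    have hc₁0 : c₁ ≠ 0 := by
      rintro rfl
      rw [zero_smul] at hc₁
      exact hx0 ((congrArg κ.hom hc₁).trans (map_zero _))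
    refine ⟨c / c₁, ?_⟩
    have h1 : (c / c₁) • (CechComplex ξ).homologyπ n z₁ = (CechComplex ξ).homologyπ n z := by
      rw [hc, hc₁, smul_smul, div_mul_cancel₀ _ hc₁0]
    exact (map_smul κ.hom.hom _ _).symm.trans (congrArg κ.hom h1)
  -- The inverse of `e₀` is the coordinate along the class of `z₁`; its definition involves neither
  -- Γ nor Φ.
  let e₀ : valueField ξ ≃ₗ[valueField ξ] PointCohomology ξ n :=
    LinearEquiv.ofBijective (LinearMap.toSpanSingleton (valueField ξ) (PointCohomology ξ n) x)
      ⟨fun c c' h => smul_left_injective _ hx0 h, hspan⟩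
  have he : ∀ (Γ' : Subgroup (𝓞 F)ˣ) (Φ' : Set (Set (RealSpace F))), stabilizer ξ ≤ Γ' →
      Γ' ≤ totallyPositiveUnits F → IsShintaniDecomposition Γ' Φ' → HasGeneratorsIn ξ Φ' →
      ∀ z a, IsGeneratorSystem ξ Φ' (n + 1) a →
        e₀.symm (κ.hom ((CechComplex ξ).homologyπ n z)) = orbitSum ξ Φ' τ a z := by
    intro Γ' Φ' hΓ₁ hΓ₁' hΦ' hgen' z a ha
    have hfin' := finite_coneOrbits htors hΓ₁' hΦ' (ξ := ξ) (n + 1)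
    rw [LinearEquiv.symm_apply_eq]
    obtain ⟨c, hc⟩ := hspan (κ.hom ((CechComplex ξ).homologyπ n z))
    -- Subtracting c z₁ leaves a cocycle with zero class, on which the orbit sum for Φ' vanishes.
    -- Since that of `z₁` is 1, the orbit sum of `z` is `c`.
    have h0 : κ.hom ((CechComplex ξ).homologyπ n (z - c • z₁)) = 0 := by
      rw [map_sub, map_smul, map_sub, map_smul, ← hc, hx, sub_self]
    have h1 := orbitSum_eq_zero hΦ' hΓ₁ hΓ₁' hgen' hfin' τ ha (hzero h0)
    rw [hadd Φ' a hfin', hz₁ Γ' Φ' hΓ₁ hΦ' hgen' hfin' a ha, mul_one, sub_eq_zero] at h1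
    rw [h1, ← hc]
    rfl
  refine ⟨κ, hκ, e₀.symm, fun e' => ⟨fun h => ?_, ?_⟩, he⟩
  · refine LinearMap.ext fun y => ?_
    obtain ⟨z, rfl⟩ := hπκ y
    exact (h z a₀ ha₀).trans (he Γ Φ hΓ hΓ' hΦ hgen z a₀ ha₀).symm
  · rintro rfl z a ha
    exact he Γ Φ hΓ hΓ' hΦ hgen z a ha
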